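/- **Setting.** Let $\mathcal F$ be the class of continuous log-concave probability densities $f_0$ on $\mathbb R$. For $f_0\in\mathcal F$ let $P_0$, $F_0$ and $F_0^{-1}$ be its distribution, distribution function and quantile function, and let $\psi_0=(\log f_0)'$ be its score function on $\{f_0>0\}$ (right derivative; the choice of version is immaterial). The density quantile function $J_0:=f_0\circ F_0^{-1}$ has derivative $J_0'=\psi_0\circ F_0^{-1}$ on $(0,1)$, and the Fisher information is $i(f_0):=\int\psi_0^2f_0$. For $\gamma\in(0,1]$ and $L,r>0$ let $$\mathcal J_{\gamma,L}:=\Bigl\{f_0\in\mathcal F:\ |J_0'(u)|\le \frac{L}{\{u\wedge(1-u)\}^{(1-\gamma)/2}}\ \text{ for all }u\in(0,1)\Bigr\},\qquad \mathcal J_{\gamma,L,r}:=\{f_0\in\mathcal J_{\gamma,L}: i(f_0)\le r\}.$$ For $X_1,\dots,X_n$ i.i.d. from $f_0$ and an estimator $\hat\psi_n=\hat\psi_n(\cdot\,;X_1,\dots,X_n)$ let $\mathcal L(\hat\psi_n,\psi_0):=\int(\hat\psi_n-\psi_0)^2f_0$ and $$\mathrm{Quantile}_{f_0}(1-\delta,\hat\psi_n,\psi_0):=\inf\bigl\{s\in[0,\infty):\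 \mathbb P_{f_0}\{\mathcal L(\hat\psi_n,\psi_0)\le s\}\ge 1-\delta\bigr\}\qquad(\inf\emptyset:=\infty).$$ For $\mathcal G\subseteq\mathcal F$ the minimax $(1-\delta)$th quantile is $\mathcal M_n(\delta,\mathcal G):=\inf_{\hat\psi_n}\sup_{f_0\in\mathcal G}\mathrm{Quantile}_{f_0}(1-\delta,\hat\psi_n,\psi_0)$, the infimum being over all jointly measurable $\hat\psi_n:\mathbb R\times\mathbb R^n\to\mathbb R$. Write $\log_+x:=1\vee\log x$ and $\varepsilon_{n,\delta}:=n^{-1}\log(n^2/\delta)$. **The multiscale estimator.** Let $\epsilon:=2\varepsilon_{n,\delta}/9$, $\mathrm{sgn}(x):=2\cdot\mathbf 1_{\{x\ge0\}}-1$, $K(x):=(1-|x|)\mathbf 1_{\{|x|\le1\}}$ with weak derivative $K'(x):=-\mathrm{sgn}(x)\mathbf 1_{\{|x|<1\}}$, and let $\mathbb P_n$ be the empirical distribution. For $z\in\mathbb R$, $h>0$ and $\omega\in\{-1,1\}$ set $\hat f_h(z):=\frac1{nh}\sum_iK(\frac{z-X_i}h)$, $\hat f_h'(z):=\frac1{nh^2}\sum_iK'(\frac{z-X_i}h)$,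 $\hat\tau:=\mathrm{sgn}(\hat f_h'(z))$, $$\hat V_h(z):=3\sqrt{\epsilon\,\mathbb P_n([z-h,z+h])+\epsilon^2}+\tfrac{1+4\epsilon}{n},\qquad \hat M_h^{(\omega)}(z):=(1-2\epsilon)h^2|\hat f_h'(z)|+2\omega\hat V_h(z),$$ $$\hat D_h^{(\omega)}(z):=h\bigl\{(1-2\epsilon)h\hat f_h(z)+\omega\hat V_h(z)+(3-\tfrac4n)\epsilon-\tfrac1n\bigr\},$$ and let $\hat\psi_h^{(\omega)}(z)$ be $\hat\tau\hat M_h^{(\omega\hat\tau)}(z)/\hat D_h^{(-\omega\hat\tau)}(z)$ if $\hat D_h^{(-1)}(z)>0$ and $\hat M_h^{(-1)}(z)>0$; $\hat\tau\hat M_h^{(\omega\hat\tau)}(z)/\hat D_h^{(-1)}(z)$ if $\hat D_h^{(-1)}(z)>0$ and $\hat M_h^{(-1)}(z)\le0$; and $\omega\cdot\infty$ otherwise. Put $$\hat\psi^{(1)}(x):=\inf\{\hat\psi_h^{(1)}(z): x-z\ge h>0\},\qquad \hat\psi^{(-1)}(x):=\sup\{\hat\psi_h^{(-1)}(z): z-x\ge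 h>0\},$$ and let $\hat\psi_{n,\delta}(x)$ be $\hat\psi^{(-1)}(x)$ if $\hat\psi^{(-1)}(x)>0$, otherwise $\hat\psi^{(1)}(x)$ if $\hat\psi^{(1)}(x)<0$, and otherwise $0$. **Theorem.** For every $\gamma\in(0,1]$ there is a constant $C_\gamma\in(0,\infty)$, depending only on $\gamma$, such that for all $n\ge3$, $\delta\in(0,1)$ and $L,r>0$, with $\bar r:=r\wedge L^2$, $$\mathcal M_n(\delta,\mathcal J_{\gamma,L,r})\le C_\gamma\,\bar r\min\Bigl\{\Bigl(\frac{L^{2/\gamma}}{\bar r^{1/\gamma}}\varepsilon_{n,\delta}\Bigr)^{\gamma\wedge\frac13}\log_+^{\mathbf 1_{\{\gamma=1/3\}}}\Bigl(\frac1{\varepsilon_{n,\delta}}\Bigr),\,1\Bigr\},$$ $$\mathcal M_n(\delta,\mathcal J_{\gamma,L})\le C_\gamma\,L^2\min\Bigl\{\varepsilon_{n,\delta}^{\gamma\wedge\frac13}\log_+^{\mathbf 1_{\{\gamma=1/3\}}}\Bigl(\frac1{\varepsilon_{n,\delta}}\Bigr),\,1\Bigr\}.$$ Both bounds are attained by the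 multiscale estimator, whose definition does not involve $\gamma,L,r$: the map $(x,X_1,\dots,X_n)\mapsto\hat\psi_{n,\delta}(x)$ is measurable, and $\sup_{f_0}\mathrm{Quantile}_{f_0}(1-\delta,\hat\psi_{n,\delta},\psi_0)$, over $\mathcal J_{\gamma,L,r}$ and over $\mathcal J_{\gamma,L}$ respectively, is at most the corresponding right-hand side. -/

import Mathlib

open MeasureTheory ProbabilityTheory
open scoped ENNReal NNReal

noncomputable section

namespace ScoreEstimation

/-! ### Log-concave densities, score functions and the tail-growth classes -/

/-- The class of continuous log-concave probability densities on `ℝ`: the logarithm of `f`, read as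
`-∞` where `f` vanishes, is concave. -/
structure IsLogConcaveDensity (f : ℝ → ℝ) : Prop where
  continuous : Continuous f
  nonneg : ∀ x, 0 ≤ f x
  lintegral_eq_one : ∫⁻ x, ENNReal.ofReal (f x) = 1
  concaveOn_log : ConcaveOn ℝ {x | 0 < f x} (fun x => Real.log (f x))

/-- The distribution `P₀` with Lebesgue density `f`. -/
def law (f : ℝ → ℝ) : Measure ℝ := volume.withDensity (fun x => ENNReal.ofReal (f x))

/-- The quantile function `F₀⁻¹(u) = inf {x : F₀(x) ≥ u}`, used for `u ∈ (0, 1)` only. -/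
def quantileFn (f : ℝ → ℝ) (u : ℝ) : ℝ := sInf {x : ℝ | u ≤ cdf (law f) x}

/-- The score function on the open interval `{x | 0 < f x}`, in the version given by the right
derivative of `log f`. Its values where `f` vanishes are irrelevant: below it is only evaluated at
quantiles of levels in `(0, 1)`, which lie in that interval, or multiplied by `f`. -/
def score (f : ℝ → ℝ) (x : ℝ) : ℝ := derivWithin (fun y => Real.log (f y)) (Set.Ioi x) x

/-- The derivative `J₀' = ψ₀ ∘ F₀⁻¹` on `(0, 1)` of the density quantile function
`J₀ = f ∘ F₀⁻¹`. -/
def densityQuantileDeriv (f : ℝ → ℝ) (u : ℝ) : ℝ := score f (quantileFn f u)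

/-- The Fisher information for location, `i(f) = ∫ ψ₀² f`. -/
def fisherInfo (f : ℝ → ℝ) : ℝ≥0∞ := ∫⁻ x, ENNReal.ofReal (score f x ^ 2 * f x)

/-- The class `𝒥_{γ,L}`. -/
def tailGrowthClass (γ L : ℝ) : Set (ℝ → ℝ) :=
  {f | IsLogConcaveDensity f ∧
    ∀ u ∈ Set.Ioo (0 : ℝ) 1, |densityQuantileDeriv f u| ≤ L / min u (1 - u) ^ ((1 - γ) / 2)}

/-- The class `𝒥_{γ,L,r}`. -/
def tailGrowthFisherClass (γ L r : ℝ) : Set (ℝ → ℝ) :=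
  {f | f ∈ tailGrowthClass γ L ∧ fisherInfo f ≤ ENNReal.ofReal r}

/-! ### Loss and minimax quantiles -/

/-- The loss `∫ (ψ - ψ₀)² f`, for `ψ` with values in `[-∞, ∞]` and with the convention
`∞ * 0 = 0`. -/
def loss (f : ℝ → ℝ) (ψ : ℝ → EReal) : ℝ≥0∞ :=
  ∫⁻ x, (ψ x - (score f x : EReal)).abs ^ 2 * ENNReal.ofReal (f x)

/-- The `(1 - δ)`th quantile, under an i.i.d. sample of size `n` from `f`, of the loss of the
estimator `ψhat`, whose value at `x` for the sample `X` is `ψhat x X`. -/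
def lossQuantile (n : ℕ) (δ : ℝ) (f : ℝ → ℝ) (ψhat : ℝ → (Fin n → ℝ) → EReal) : ℝ≥0∞ :=
  ⨅ (s : ℝ≥0) (_ : ENNReal.ofReal (1 - δ) ≤
      Measure.pi (fun _ : Fin n => law f) {X | loss f (fun x => ψhat x X) ≤ (s : ℝ≥0∞)}),
    (s : ℝ≥0∞)

/-- The largest `(1 - δ)`th quantile of the loss of `ψhat` over the densities in `G`. -/
def worstQuantile (n : ℕ) (δ : ℝ) (G : Set (ℝ → ℝ)) (ψhat : ℝ → (Fin n → ℝ) → EReal) : ℝ≥0∞ :=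
  ⨆ f ∈ G, lossQuantile n δ f ψhat

/-- The minimax `(1 - δ)`th quantile over `G`: the infimum is over all jointly measurable
real-valued estimators. -/
def minimaxQuantile (n : ℕ) (δ : ℝ) (G : Set (ℝ → ℝ)) : ℝ≥0∞ :=
  ⨅ (ψhat : ℝ → (Fin n → ℝ) → ℝ) (_ : Measurable (Function.uncurry ψhat)),
    worstQuantile n δ G (fun x X => (ψhat x X : EReal))

/-! ### The rate -/

/-- `ε_{n,δ} = n⁻¹ log(n² / δ)`. -/
def epsRate (n : ℕ) (δ : ℝ) : ℝ := Real.log ((n : ℝ) ^ 2 / δ) / n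

/-- `log₊ x = max 1 (log x)`. -/
def logPlus (x : ℝ) : ℝ := max 1 (Real.log x)

/-! ### The multiscale estimator -/

/-- The constant `2 log(n² / δ) / (9n)` that enters the confidence bands. -/
def epsBand (n : ℕ) (δ : ℝ) : ℝ := 2 * epsRate n δ / 9

/-- `sgn`, with the convention `sgn 0 = 1`. -/
def sgn (x : ℝ) : ℝ := if 0 ≤ x then 1 else -1

/-- The triangular kernel. -/
def kern (x : ℝ) : ℝ := if |x| ≤ 1 then 1 - |x| else 0

/-- The weak derivative of the triangular kernel. -/
def kernDeriv (x : ℝ) : ℝ := if |x| < 1 then -sgn x else 0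

/-- The kernel density estimator with bandwidth `h`. -/
def kde {n : ℕ} (X : Fin n → ℝ) (h z : ℝ) : ℝ := (1 / n) * ∑ i, h⁻¹ * kern ((z - X i) / h)

/-- The weak derivative of the kernel density estimator. -/
def kdeDeriv {n : ℕ} (X : Fin n → ℝ) (h z : ℝ) : ℝ :=
  (1 / n) * ∑ i, (h ^ 2)⁻¹ * kernDeriv ((z - X i) / h)

/-- The empirical probability of `[z - h, z + h]`. -/
def empProb {n : ℕ} (X : Fin n → ℝ) (h z : ℝ) : ℝ :=
  (1 / n) * ∑ i, Set.indicator (Set.Icc (z - h) (z + h)) (fun _ => (1 : ℝ)) (X i)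

/-- `V̂_{n,δ,h}(z)`. -/
def bandV {n : ℕ} (δ : ℝ) (X : Fin n → ℝ) (h z : ℝ) : ℝ :=
  3 * √(epsBand n δ * empProb X h z + epsBand n δ ^ 2) + (1 + 4 * epsBand n δ) / n

/-- The numerator `M̂^{(ω)}_{n,δ,h}(z)`, for `ω = ±1`. -/
def bandM {n : ℕ} (δ : ℝ) (X : Fin n → ℝ) (h z ω : ℝ) : ℝ :=
  (1 - 2 * epsBand n δ) * (h ^ 2 * |kdeDeriv X h z|) + 2 * ω * bandV δ X h z

/-- The denominator `D̂^{(ω)}_{n,δ,h}(z)`, for `ω = ±1`. -/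
def bandD {n : ℕ} (δ : ℝ) (X : Fin n → ℝ) (h z ω : ℝ) : ℝ :=
  h * ((1 - 2 * epsBand n δ) * (h * kde X h z) + ω * bandV δ X h z
    + (3 - 4 / n) * epsBand n δ - 1 / n)

open Classical in
/-- The lower (`ω = -1`) and upper (`ω = 1`) confidence limits at `z` for the score function of the
density smoothed with bandwidth `h`. -/
def bandLimit {n : ℕ} (δ : ℝ) (X : Fin n → ℝ) (h z ω : ℝ) : EReal :=
  let τ : ℝ := sgn (kdeDeriv X h z)
  if 0 < bandD δ X h z (-1) then
    if 0 < bandM δ X h z (-1) then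
      ((τ * bandM δ X h z (ω * τ) / bandD δ X h z (-(ω * τ)) : ℝ) : EReal)
    else
      ((τ * bandM δ X h z (ω * τ) / bandD δ X h z (-1) : ℝ) : EReal)
  else (ω : EReal) * ⊤

/-- The upper endpoint of the multiscale confidence interval for the score at `x`. -/
def upperLimit {n : ℕ} (δ : ℝ) (X : Fin n → ℝ) (x : ℝ) : EReal :=
  ⨅ (z : ℝ) (h : ℝ) (_ : 0 < h) (_ : h ≤ x - z), bandLimit δ X h z 1

/-- The lower endpoint of the multiscale confidence interval for the score at `x`. -/
def lowerLimit {n : ℕ} (δ : ℝ) (X : Fin n → ℝ) (x : ℝ) : EReal :=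
  ⨆ (z : ℝ) (h : ℝ) (_ : 0 < h) (_ : h ≤ z - x), bandLimit δ X h z (-1)

open Classical in
/-- The multiscale estimator at `x` for the sample `X`. (For `n ≥ 3` it can be infinite only
at samples with ties.) -/
def multiscaleEstimator (n : ℕ) (δ : ℝ) (x : ℝ) (X : Fin n → ℝ) : EReal :=
  if 0 < lowerLimit δ X x then lowerLimit δ X x
  else if upperLimit δ X x < 0 then upperLimit δ X x
  else 0

end ScoreEstimation

end

open MeasureTheory ProbabilityTheory
open scoped ENNReal NNReal

noncomputable section

namespace ScoreEstimation

section

/-! ### Chernoff bounds for binomial tails -/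

/-! Everything follows from one deterministic bound for the loss of the multiscale estimator on an
event of probability at least 1 - δ.

The event. Given X i and X j, the other n - 2 observations are i.i.d., so the number of them between
(or outside) X i and X j is binomial. Chernoff bounds at level δ/n² and a union bound over pairs
cost δ in total (`measure_not_goodSample_le`). Comparing an arbitrary interval with intervals, or
complements of intervals, ending at observations turns this into one band for the probabilities of
all intervals (`GoodSample.abs_sub_le`), hence for the smoothed density and its derivative at every
centre and bandwidth.

The shape constraint. The score ψ of a log-concave density is decreasing, so the score of the
density smoothed over a window to the left of x is at least ψ x, and over a window to the right at
most ψ x. The limits therefore cover ψ x (`GoodAt.coverage`), and the estimator lies between 0 and ψ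
x. To the right of the mode its error is bounded, for every h with h f(x) at most an eighth of the
upper tail probability, by a bias, the increase of |ψ| from x - 2h to x, plus a deviation of order
√(ε / (h f(x))) / h (`ScorePair.pointwise`). Reflection handles the left of the mode.

Integration. The right of the mode is cut into blocks with upper tail probability in (q/2, q]. On a
block the density varies by a factor at most two, and |ψ| is at most of the order of an envelope N.
The bias is an increment of a bounded monotone function, so its integral over x is of order hN
wherever the score moves (`lintegral_monotone_sub_le`). Choosing among dyadic bandwidths pointwise
gives a block loss of order q N² (ε/q)^(1/3) (`ScorePair.lintegral_sq_block_le`), while comparison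
with the zero estimator gives q N².

Summation. The tail condition and the Fisher information give q N² ≤ min(4 L² q^γ, r). Summing min(4
L² q^γ, r) min(1, (ε/q)^(1/3)) over q = 2^(-k) produces the rate, the exponents γ and 1/3 competing
and balancing at γ = 1/3 (`sum_block_bound_le`). The class without a Fisher bound is contained in
the one with r = K L² (`exists_mem_tailGrowthFisherClass`). -/

/-- The Chernoff bounds do not exclude, at level `exp (-t)`, that a binomial variable with
parameters `N` and `p` is at most `k`. -/
def TailOK (N : ℕ) (t : ℝ) (k : ℕ) (p : ℝ) : Prop :=
  ∀ y ∈ Set.Icc (0 : ℝ) 1, y ^ k ≤ Real.exp t * (1 - p + p * y) ^ N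

/-- The Kullback-Leibler divergence between Bernoulli distributions. -/
def bernoulliKL (q p : ℝ) : ℝ := q * Real.log (q / p) + (1 - q) * Real.log ((1 - q) / (1 - p))

/-- With d = p - q, the expression exceeds by d²/6 the mean of x(1-x) on [q, p] under the weight
proportional to x - q. That mean is the variance in Jensen's lower bound for KL(q, p) = ∫_q^p (x -
q)/(x(1-x)) dx. -/
lemma bernstein_denominator_pos {q p : ℝ} (hq : 0 ≤ q) (hqp : q < p) (hp : p < 1) :
    0 < q * (1 - q) + 2 / 3 * (1 - 2 * q) * (p - q) - (p - q) ^ 2 / 3 := by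
  have h1 : 0 < p - q := by linarith
  have h2 : 0 < 1 - p := by linarith
  nlinarith [mul_nonneg hq h2.le, mul_pos h1 h2, mul_nonneg hq h1.le]

/-- The case q = 0 of the next lemma, whose general argument would differentiate log x at the left
endpoint x = q. -/
lemma bernstein_le_bernoulliKL_zero {p : ℝ} (hp0 : 0 < p) (hp : p < 1) :
    p ^ 2 / (2 * (2 / 3 * p - p ^ 2 / 3)) ≤ -Real.log (1 - p) := by
  have key : MonotoneOn (fun x : ℝ => -Real.log (1 - x) - 3 * x / (4 - 2 * x)) (Set.Icc 0 p) := by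
    have hd : ∀ x ∈ Set.Icc (0 : ℝ) p, HasDerivAt
        (fun x : ℝ => -Real.log (1 - x) - 3 * x / (4 - 2 * x))
        (-((-1) / (1 - x)) - ((3 * 1) * (4 - 2 * x) - 3 * x * (-(2 * 1))) / (4 - 2 * x) ^ 2) x := by
      intro x hx
      have h1 : (1 - x) ≠ 0 := by linarith [hx.2]
      have h2 : (4 - 2 * x) ≠ 0 := by linarith [hx.2]
      exact ((((hasDerivAt_id x).const_sub 1).log h1).neg).sub
        (((hasDerivAt_id x).const_mul 3).div (((hasDerivAt_id x).const_mul 2).const_sub 4) h2)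
    refine monotoneOn_of_hasDerivWithinAt_nonneg (convex_Icc 0 p)
      (fun x hx => (hd x hx).continuousAt.continuousWithinAt)
      (fun x hx => (hd x (interior_subset hx)).hasDerivWithinAt) ?_
    intro x hx
    have hx := interior_subset hx
    have h1 : 0 < 1 - x := by linarith [hx.2]
    have h2 : 0 < 4 - 2 * x := by linarith [hx.2]
    have : -((-1) / (1 - x)) - ((3 * 1) * (4 - 2 * x) - 3 * x * (-(2 * 1))) / (4 - 2 * x) ^ 2
        = 4 * (1 - x + x ^ 2) / ((1 - x) * (4 - 2 * x) ^ 2) := by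
      have h3 : 2 - x ≠ 0 := by linarith
      have h4 : 4 - 2 * x = 2 * (2 - x) := by ring
      rw [h4]
      field_simp; ring
    rw [this]
    have : 0 < 1 - x + x ^ 2 := by nlinarith [sq_nonneg x]
    positivity
  have h := key (Set.left_mem_Icc.2 hp0.le) (Set.right_mem_Icc.2 hp0.le) hp0.le
  have h2 : 0 < 4 - 2 * p := by linarith
  have : p ^ 2 / (2 * (2 / 3 * p - p ^ 2 / 3)) = 3 * p / (4 - 2 * p) := by
    rw [div_eq_div_iff (by nlinarith) h2.ne']; ring
  rw [this]
  simp at h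
  linarith

/-- For q > 0, both sides vanish at p = q, and the derivative in p of their difference is (p - q)³
times a nonnegative quadratic over a positive denominator. -/
lemma bernstein_le_bernoulliKL {q p : ℝ} (hq : 0 ≤ q) (hqp : q < p) (hp : p < 1) :
    (p - q) ^ 2 / (2 * (q * (1 - q) + 2 / 3 * (1 - 2 * q) * (p - q) - (p - q) ^ 2 / 3))
      ≤ bernoulliKL q p := by
  rcases hq.eq_or_lt with rfl | hq0
  · have := bernstein_le_bernoulliKL_zero hqp hp
    simp only [bernoulliKL]
    simp at this ⊢
    exact this
  have hW : ∀ x ∈ Set.Icc q p,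
      0 < q * (1 - q) + 2 / 3 * (1 - 2 * q) * (x - q) - (x - q) ^ 2 / 3 := by
    intro x hx
    rcases hx.1.eq_or_lt with h | h
    · subst h; nlinarith [mul_pos hq0 (show 0 < 1 - q by linarith)]
    · exact bernstein_denominator_pos hq h (by linarith [hx.2])
  set W : ℝ → ℝ := fun x => q * (1 - q) + 2 / 3 * (1 - 2 * q) * (x - q) - (x - q) ^ 2 / 3 with hWdef
  set H : ℝ → ℝ := fun x => (q * (Real.log q - Real.log x) +
    (1 - q) * (Real.log (1 - q) - Real.log (1 - x))) - (x - q) ^ 2 / (2 * W x) with hH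
  have hd : ∀ x ∈ Set.Icc q p, HasDerivAt H
      ((q * (-(1 / x)) + (1 - q) * (-((-1) / (1 - x)))) -
        ((2 * (x - q)) * (2 * W x) - (x - q) ^ 2 * (2 * (2 / 3 * (1 - 2 * q) - 2 * (x - q) / 3)))
          / (2 * W x) ^ 2) x := by
    intro x hx
    have h0 : x ≠ 0 := by linarith [hx.1]
    have h1 : (1 - x) ≠ 0 := by linarith [hx.2]
    have h2 : 2 * W x ≠ 0 := by have := hW x hx; simp only [hWdef]; positivity
    have e1 : HasDerivAt (fun y : ℝ => y - q) 1 x := (hasDerivAt_id x).sub_const q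
    have e2 : HasDerivAt (fun y : ℝ => (y - q) ^ 2) (2 * (x - q)) x := by
      simpa using e1.fun_pow 2
    have e3 : HasDerivAt W (2 / 3 * (1 - 2 * q) - 2 * (x - q) / 3) x := by
      have := ((e1.const_mul (2 / 3 * (1 - 2 * q))).const_add (q * (1 - q))).fun_sub (e2.div_const 3)
      simpa [hWdef] using this
    exact ((((((hasDerivAt_id x).log h0).const_sub (Real.log q))).const_mul q).add
      ((((((hasDerivAt_id x).const_sub 1).log h1)).const_sub (Real.log (1 - q))).const_mul
        (1 - q))).sub (e2.div (e3.const_mul 2) h2)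
  have key : MonotoneOn H (Set.Icc q p) := by
    refine monotoneOn_of_hasDerivWithinAt_nonneg (convex_Icc q p)
      (fun x hx => (hd x hx).continuousAt.continuousWithinAt)
      (fun x hx => (hd x (interior_subset hx)).hasDerivWithinAt) ?_
    intro x hx
    have hx := interior_subset hx
    have hWx : 0 < W x := hW x hx
    have h0 : 0 < x := by linarith [hx.1]
    have h1 : 0 < 1 - x := by linarith [hx.2]
    have hd0 : 0 ≤ x - q := by linarith [hx.1]
    have : ((q * (-(1 / x)) + (1 - q) * (-((-1) / (1 - x)))) -
        ((2 * (x - q)) * (2 * W x) - (x - q) ^ 2 * (2 * (2 / 3 * (1 - 2 * q) - 2 * (x - q) / 3)))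
          / (2 * W x) ^ 2) = (x - q) * (2 * W x ^ 2 - (2 * W x - (x - q) *
            (2 / 3 * (1 - 2 * q) - 2 * (x - q) / 3)) * (x * (1 - x))) /
            (2 * (x * (1 - x)) * W x ^ 2) := by
      field_simp
      ring
    rw [this]
    apply div_nonneg _ (by positivity)
    apply mul_nonneg hd0
    have : 2 * W x ^ 2 - (2 * W x - (x - q) *
            (2 / 3 * (1 - 2 * q) - 2 * (x - q) / 3)) * (x * (1 - x)) =
        (x - q) ^ 2 * (2 / 9 * (1 - 2 * q) ^ 2 + 2 / 3 * (q * (1 - q)) -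
          2 / 9 * (1 - 2 * q) * (x - q) + 2 / 9 * (x - q) ^ 2) := by
      simp only [hWdef]; ring
    rw [this]
    apply mul_nonneg (sq_nonneg _)
    nlinarith [sq_nonneg ((1 - 2 * q) - (x - q)), mul_pos hq0 (show 0 < 1 - q by linarith),
      sq_nonneg (1 - 2 * q), sq_nonneg (x - q)]
  have h := key (Set.left_mem_Icc.2 hqp.le) (Set.right_mem_Icc.2 hqp.le) hqp.le
  simp only [hH, sub_self] at h
  unfold bernoulliKL
  rw [Real.log_div hq0.ne' (by linarith), Real.log_div (by linarith) (by linarith)]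
  simp only [hWdef] at h
  simp at h
  linarith

/-- A binomial variable that is not excluded to be at most `N₀ q` has success probability at most
`R` as soon as `N₀ KL(q, R) ≥ t`. -/
lemma TailOK.le_of_bernoulliKL {N : ℕ} {t : ℝ} {k : ℕ} {p : ℝ} (h : TailOK N t k p) (hp : p ≤ 1)
    (hN : 0 < N) {N₀ q R : ℝ} (hNN : N₀ ≤ N) (hk : (k : ℝ) = N₀ * q) (hq : 0 ≤ q)
    (hqR : q < R) (hR : R < 1) (ht : t ≤ N₀ * bernoulliKL q R) : p ≤ R := by
  by_contra! hpR
  have hq1 : 0 < 1 - q := by linarith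
  have hR0 : 0 < R := by linarith
  have hR1 : 0 < 1 - R := by linarith
  -- The minimiser of y^(-q) (1 - R + R y), at which the Chernoff bound becomes exp(-N₀ KL(q, R)).
  -- `N₀` need not be an integer: the base (1-R)/(1-q) is at most one, so lowering the exponent from
  -- `N` to `N₀` only weakens the bound.
  set y := q * (1 - R) / (R * (1 - q)) with hy
  have hy0 : 0 ≤ y := by positivity
  have hy1 : y < 1 := by rw [hy, div_lt_one (by positivity)]; nlinarith
  have hbase : 1 - R + R * y = (1 - R) / (1 - q) := by rw [hy]; field_simp; ring
  have hb1 : 1 - p + p * y < (1 - R) / (1 - q) := by rw [← hbase]; nlinarith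
  have hb0 : 0 ≤ 1 - p + p * y := by nlinarith
  have hble : (1 - R) / (1 - q) ≤ 1 := by rw [div_le_one hq1]; linarith
  have hbp : 0 < (1 - R) / (1 - q) := by positivity
  have h1 := h y ⟨hy0, hy1.le⟩
  have h2 : y ^ k < Real.exp t * ((1 - R) / (1 - q)) ^ N₀ := by
    calc y ^ k ≤ _ := h1
      _ < Real.exp t * ((1 - R) / (1 - q)) ^ N := by
        gcongr
      _ ≤ _ := by
        gcongr
        rw [← Real.rpow_natCast]
        exact Real.rpow_le_rpow_of_exponent_ge hbp hble hNN
  have h3 : Real.exp t * ((1 - R) / (1 - q)) ^ N₀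
      = Real.exp (t + N₀ * Real.log ((1 - R) / (1 - q))) := by
    rw [Real.exp_add, Real.rpow_def_of_pos hbp, mul_comm N₀]
  rw [h3] at h2
  rcases hq.eq_or_lt with rfl | hq0
  · have hk0 : k = 0 := by simpa using hk
    subst hk0
    simp only [pow_zero, Real.one_lt_exp_iff, bernoulliKL, sub_zero, div_one, zero_mul, zero_add,
      one_mul] at h2 ht
    rw [one_div, Real.log_inv] at ht
    linarith
  · have hyp : 0 < y := by positivity
    rw [← Real.exp_log (pow_pos hyp k), Real.exp_lt_exp, Real.log_pow, hk, hy,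
      Real.log_div (by positivity) (by positivity), Real.log_mul hq0.ne' hR1.ne',
      Real.log_mul hR0.ne' hq1.ne', Real.log_div hR1.ne' hq1.ne'] at h2
    unfold bernoulliKL at ht
    rw [Real.log_div hq0.ne' hR0.ne', Real.log_div hq1.ne' hR1.ne'] at ht
    nlinarith

/-- The upper confidence bound for a probability. -/
def upperConf (ε q : ℝ) : ℝ := (1 - 2 * ε) * q + 3 * ε + 3 * √(ε * q + ε ^ 2)

lemma eps_le_sqrt {ε q : ℝ} (hε : 0 ≤ ε) (hq : 0 ≤ q) : ε ≤ √(ε * q + ε ^ 2) :=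
  Real.le_sqrt_of_sq_le (by nlinarith [mul_nonneg hε hq])

set_option maxHeartbeats 800000 in
lemma TailOK.le_upperConf_of_five_le {n k : ℕ} {ε p : ℝ} (hn : 5 ≤ n) (hkn : k ≤ n) (hε : 2 / 3 ≤ n * ε)
    (h : TailOK (n - 2) (9 / 2 * n * ε) k p) (hp : p ≤ 1) : p ≤ upperConf ε (k / n) := by
  have hn0 : (0 : ℝ) < n := by positivity
  have hε0 : 0 < ε := by by_contra! h; nlinarith
  set q : ℝ := k / n with hq
  have hq0 : 0 ≤ q := by positivity
  have hq1 : q ≤ 1 := by rw [hq, div_le_one hn0]; exact_mod_cast hkn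
  set s := √(ε * q + ε ^ 2) with hs
  have hss : s ^ 2 = ε * q + ε ^ 2 := Real.sq_sqrt (by positivity)
  have hsε : ε ≤ s := eps_le_sqrt hε0.le hq0
  set R := upperConf ε q with hRdef
  have hR : R = (1 - 2 * ε) * q + 3 * ε + 3 * s := rfl
  rcases le_or_gt 1 R with hR1 | hR1
  · linarith
  -- Since s ≥ ε, a value ε ≥ 1/6 already makes R at least one.
  rcases le_or_gt (1 / 6) ε with h6 | h6
  · exfalso
    rcases le_or_gt ε (1 / 2) with h2 | h2
    · nlinarith [mul_nonneg (show 0 ≤ 1 - 2 * ε by linarith) hq0]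
    · nlinarith
  -- The effective sample size is nρ: the hypothesis nε ≥ 2/3 says exactly that nρ ≤ n - 2, and k =
  -- nρ · (q/ρ).
  set ρ := 1 - 3 * ε with hρ
  have hρ0 : 0 < ρ := by linarith
  have hD : ρ * R - q = 3 * ρ * (ε + s) - ε * q * (5 - 6 * ε) := by rw [hR, hρ]; ring
  have hqR : 0 < ρ * R - q := by
    rw [hD]
    have : ε * q = s ^ 2 - ε ^ 2 := by linarith
    rw [this]
    have hs3 : 3 * s < 1 := by nlinarith [mul_nonneg (show 0 ≤ 1 - 2 * ε by linarith) hq0]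
    have : 3 * ρ * (ε + s) - (s ^ 2 - ε ^ 2) * (5 - 6 * ε)
      = (ε + s) * (3 * ρ - (s - ε) * (5 - 6 * ε)) := by ring
    rw [this]
    apply mul_pos (by linarith)
    nlinarith
  have hqlt : q / ρ < R := by rw [div_lt_iff₀ hρ0]; linarith
  refine h.le_of_bernoulliKL hp (by omega) (N₀ := n * ρ) (q := q / ρ) ?_ ?_
    (by positivity) hqlt hR1 ?_
  · rw [Nat.cast_sub (by omega), hρ]; push_cast; nlinarith
  · rw [hq]; field_simp
  · have hb := bernstein_le_bernoulliKL (by positivity) hqlt hR1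
    have hW := bernstein_denominator_pos (by positivity) hqlt hR1
    refine le_trans ?_ (mul_le_mul_of_nonneg_left hb (by positivity))
    have e0 : q = ρ * (q / ρ) := by field_simp
    set u := q / ρ with hu
    set W := u * (1 - u) + 2 / 3 * (1 - 2 * u) * (R - u) - (R - u) ^ 2 / 3 with hWd
    rw [← mul_div_assoc, le_div_iff₀ (by positivity)]
    have e1 : ρ ^ 2 * W = q * (ρ - q) + 2 / 3 * (ρ - 2 * q) * (ρ * R - q) - (ρ * R - q) ^ 2 / 3 := by
      rw [hWd, e0]; ring
    have e2 : ρ ^ 2 * (R - u) ^ 2 = (ρ * R - q) ^ 2 := by rw [e0]; ring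
    suffices hmain : 9 * ε * (ρ ^ 2 * W) ≤ ρ * (ρ ^ 2 * (R - u) ^ 2) by
      have hρ2 : 0 < ρ ^ 2 := by positivity
      have h9 : 9 * ε * W ≤ ρ * (R - u) ^ 2 := by
        by_contra! hc
        have := mul_lt_mul_of_pos_left hc hρ2
        linarith
      have := mul_le_mul_of_nonneg_left h9 hn0.le
      linarith
    rw [e1, e2, hD]
    -- Modulo s² = εq + ε², the slack is εq times a factor that is nonnegative for ε < 1/6.
    have : ρ * (3 * ρ * (ε + s) - ε * q * (5 - 6 * ε)) ^ 2 - 9 * ε * (q * (ρ - q) +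
        2 / 3 * (ρ - 2 * q) * (3 * ρ * (ε + s) - ε * q * (5 - 6 * ε)) -
        (3 * ρ * (ε + s) - ε * q * (5 - 6 * ε)) ^ 2 / 3) =
        ε * q * (ρ * (-27 * ε + (2 + 12 * ε) * (3 * (ε + s)) + 6 * ε * (5 - 6 * ε)) +
          q * (9 - ε * (5 - 6 * ε) * (7 + 6 * ε))) + 9 * ρ ^ 2 * (s ^ 2 - (ε * q + ε ^ 2)) := by
      rw [hρ]; ring
    have h1 : 0 ≤ -27 * ε + (2 + 12 * ε) * (3 * (ε + s)) + 6 * ε * (5 - 6 * ε) := by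
      have h8 : (2 + 12 * ε) * (6 * ε) ≤ (2 + 12 * ε) * (3 * (ε + s)) :=
        mul_le_mul_of_nonneg_left (by linarith) (by linarith)
      have h7 : 0 < ε ^ 2 := by positivity
      nlinarith
    have h2 : 0 ≤ 9 - ε * (5 - 6 * ε) * (7 + 6 * ε) := by 
      have h8 : ε * (5 - 6 * ε) * (7 + 6 * ε) = 35 * ε - 12 * ε ^ 2 - 36 * ε ^ 3 := by ring
      have h7 : 0 < ε ^ 2 := by positivity
      have h6 : 0 < ε ^ 3 := by positivity
      rw [h8]; linarith
    rw [hss, sub_self, mul_zero, add_zero] at this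
    have h3 : 0 ≤ ε * q * (ρ * (-27 * ε + (2 + 12 * ε) * (3 * (ε + s)) + 6 * ε * (5 - 6 * ε)) +
          q * (9 - ε * (5 - 6 * ε) * (7 + 6 * ε))) := by positivity
    linarith

lemma TailOK.zero_le {N : ℕ} {t p : ℝ} (h : TailOK N t 0 p) :
    Real.exp (-t) ≤ (1 - p) ^ N := by
  have := h 0 ⟨le_rfl, zero_le_one⟩
  rw [pow_zero, mul_zero, add_zero] at this
  rw [Real.exp_neg, inv_le_iff_one_le_mul₀ (Real.exp_pos t)]
  linarith

/-- For n ≥ 5 the condition on ε yields nε ≥ 2/3. For n = 3 and n = 4 there is a direct check: if k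
≥ 1 the bound is at least one; if k = 0 it equals 6ε, and a larger p ≤ 1 would force ε < 1/6, which
contradicts exp(-t) ≤ (1-p)^(n-2). -/
lemma TailOK.le_upperConf {n k : ℕ} {ε p : ℝ} (hn : 3 ≤ n) (hkn : k ≤ n - 2)
    (hε : 4 / 9 * Real.log n ≤ n * ε) (h : TailOK (n - 2) (9 / 2 * n * ε) k p) (hp : p ≤ 1) :
    p ≤ upperConf ε (k / n) := by
  have hl2 := Real.log_two_gt_d9
  have hl3 : 1.09 < Real.log 3 := by
    -- 531441 = 3^12 just exceeds 2^19 = 524288, which turns the numerical bound for log 2 into one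
    -- for log 3.
    have h1 : Real.log (2 ^ 19) < Real.log (3 ^ 12) := by
      apply Real.log_lt_log <;> norm_num
    rw [Real.log_pow, Real.log_pow] at h1
    push_cast at h1
    linarith
  rcases (show n = 3 ∨ n = 4 ∨ 5 ≤ n by omega) with rfl | rfl | hn5
  · push_cast at hε h ⊢
    have hε1 : 0.161 ≤ ε := by linarith
    rcases Nat.eq_zero_or_pos k with rfl | hk
    · have h0 := h.zero_le
      simp only [upperConf, Nat.cast_zero, zero_div, mul_zero, zero_add]
      rw [Real.sqrt_sq (by linarith)]
      by_contra! hc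
      have h1 : Real.exp (-(9 / 4 : ℝ)) ≤ Real.exp (-(9 / 2 * 3 * ε)) := by
        apply Real.exp_le_exp.2; linarith
      have h2 : (0.1 : ℝ) ≤ Real.exp (-(9 / 4 : ℝ)) := by
        rw [Real.exp_neg, ← one_div, le_div_iff₀ (Real.exp_pos _)]
        have h3 := Real.exp_one_lt_d9
        have h4 : Real.exp (9 / 4) ^ 4 = Real.exp 1 ^ 9 := by
          rw [← Real.exp_nat_mul, ← Real.exp_nat_mul]; norm_num
        have h5 : Real.exp 1 ^ 9 ≤ 10 ^ 4 := by
          calc Real.exp 1 ^ 9 ≤ 2.72 ^ 9 := by gcongr; linarith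
            _ ≤ _ := by norm_num
        have h6 : Real.exp (9 / 4) ≤ 10 := by
          by_contra! hc
          have : (10 : ℝ) ^ 4 < Real.exp (9 / 4) ^ 4 := by gcongr
          linarith
        linarith
      norm_num at h0
      linarith
    · have hk1 : k = 1 := by omega
      subst hk1
      refine hp.trans ?_
      unfold upperConf
      have : (0.28 : ℝ) ≤ √(ε * ((1 : ℕ) / 3) + ε ^ 2) :=
        Real.le_sqrt_of_sq_le (by push_cast; nlinarith)
      push_cast at this ⊢
      linarith
  · push_cast at hε h ⊢
    have hl4 : Real.log 4 = 2 * Real.log 2 := by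
      rw [show (4 : ℝ) = 2 ^ 2 by norm_num, Real.log_pow]; norm_num
    have hε1 : 0.154 ≤ ε := by rw [hl4] at hε; linarith
    rcases Nat.eq_zero_or_pos k with rfl | hk
    · have h0 := h.zero_le
      simp only [upperConf, Nat.cast_zero, zero_div, mul_zero, zero_add]
      rw [Real.sqrt_sq (by linarith)]
      by_contra! hc
      have h1 : Real.exp (-3 : ℝ) ≤ Real.exp (-(9 / 2 * 4 * ε)) := by
        apply Real.exp_le_exp.2; linarith
      have h2 : (0.04 : ℝ) ≤ Real.exp (-3 : ℝ) := by
        rw [Real.exp_neg, ← one_div, le_div_iff₀ (Real.exp_pos _)]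
        have h3 := Real.exp_one_lt_d9
        have h4 : Real.exp 3 = Real.exp 1 ^ 3 := by
          rw [← Real.exp_nat_mul]; norm_num
        have h5 : Real.exp 1 ^ 3 ≤ 25 := by
          calc Real.exp 1 ^ 3 ≤ 2.72 ^ 3 := by gcongr; linarith
            _ ≤ _ := by norm_num
        linarith
      norm_num at h0
      nlinarith
    · have hq : (1 / 4 : ℝ) ≤ (k : ℝ) / 4 := by
        have : (1 : ℝ) ≤ k := by exact_mod_cast hk
        linarith
      have hq1 : (k : ℝ) / 4 ≤ 1 / 2 := by
        have : (k : ℝ) ≤ 2 := by exact_mod_cast hkn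
        linarith
      refine hp.trans ?_
      unfold upperConf
      have : (0.24 : ℝ) ≤ √(ε * ((k : ℝ) / 4) + ε ^ 2) :=
        Real.le_sqrt_of_sq_le (by nlinarith)
      nlinarith
  · refine h.le_upperConf_of_five_le hn5 (by omega) ?_ hp
    have h5 : Real.log 5 ≤ Real.log n := by
      apply Real.log_le_log (by norm_num); exact_mod_cast hn5
    have h6 : 1.5 ≤ Real.log 5 := by
      have h1 : Real.log (2 ^ 9) ≤ Real.log (5 ^ 4) := by
        apply Real.log_le_log <;> norm_num
      rw [Real.log_pow, Real.log_pow] at h1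
      push_cast at h1
      linarith
    linarith

/-- The fraction is a Padé approximant of log at 1; the difference has derivative (x-1)⁴ / (x
(x²+4x+1)²). -/
lemma log_ge_pade {s : ℝ} (hs : 1 ≤ s) : 3 * (s ^ 2 - 1) / (s ^ 2 + 4 * s + 1) ≤ Real.log s := by
  have key : MonotoneOn (fun x : ℝ => Real.log x - 3 * (x ^ 2 - 1) / (x ^ 2 + 4 * x + 1))
      (Set.Icc 1 s) := by
    have hd : ∀ x ∈ Set.Icc (1 : ℝ) s, HasDerivAt
        (fun x : ℝ => Real.log x - 3 * (x ^ 2 - 1) / (x ^ 2 + 4 * x + 1))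
        (x⁻¹ - ((3 * (2 * x)) * (x ^ 2 + 4 * x + 1) - 3 * (x ^ 2 - 1) * (2 * x + 4)) /
          (x ^ 2 + 4 * x + 1) ^ 2) x := by
      intro x hx
      have h0 : 0 < x := by linarith [hx.1]
      have h1 : x ^ 2 + 4 * x + 1 ≠ 0 := by positivity
      have e : HasDerivAt (fun x : ℝ => x ^ 2) (2 * x) x := by simpa using hasDerivAt_pow 2 x
      have e2 : HasDerivAt (fun x : ℝ => x ^ 2 + 4 * x + 1) (2 * x + 4) x := by
        simpa using (e.fun_add ((hasDerivAt_id x).const_mul 4)).add_const 1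
      exact (Real.hasDerivAt_log h0.ne').fun_sub (((e.sub_const 1).const_mul 3).fun_div e2 h1)
    refine monotoneOn_of_hasDerivWithinAt_nonneg (convex_Icc 1 s)
      (fun x hx => (hd x hx).continuousAt.continuousWithinAt)
      (fun x hx => (hd x (interior_subset hx)).hasDerivWithinAt) ?_
    intro x hx
    have h0 : 0 < x := by linarith [(interior_subset hx).1]
    have : (x⁻¹ - ((3 * (2 * x)) * (x ^ 2 + 4 * x + 1) - 3 * (x ^ 2 - 1) * (2 * x + 4)) /
          (x ^ 2 + 4 * x + 1) ^ 2) = (x - 1) ^ 4 / (x * (x ^ 2 + 4 * x + 1) ^ 2) := by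
      field_simp; ring
    rw [this]
    positivity
  have h := key (Set.left_mem_Icc.2 hs) (Set.right_mem_Icc.2 hs) hs
  norm_num at h
  exact h

lemma bernstein_le_poisson {s : ℝ} (hs : 1 ≤ s) :
    3 * (s - 1) ^ 2 / (2 * (s + 2)) ≤ s * Real.log s - s + 1 := by
  have h1 := mul_le_mul_of_nonneg_left (log_ge_pade hs) (show 0 ≤ s by linarith)
  have h2 : s * (3 * (s ^ 2 - 1) / (s ^ 2 + 4 * s + 1)) - s + 1 - 3 * (s - 1) ^ 2 / (2 * (s + 2))
      = (s - 1) ^ 4 / (2 * (s + 2) * (s ^ 2 + 4 * s + 1)) := by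
    have h3 : s ^ 2 + 4 * s + 1 ≠ 0 := by positivity
    have h4 : s + 2 ≠ 0 := by positivity
    field_simp; ring
  have h3 : 0 ≤ (s - 1) ^ 4 / (2 * (s + 2) * (s ^ 2 + 4 * s + 1)) := by positivity
  linarith

set_option maxHeartbeats 800000 in
/-- The lower confidence bound for a probability, in Poisson form. -/
lemma TailOK.lowerConf_le {n c : ℕ} {ε p : ℝ} (hn : 3 ≤ n) (hc : c ≤ n - 2) (hε : 0 < ε)
    (hp0 : 0 ≤ p) (h : TailOK (n - 2) (9 / 2 * n * ε) (n - 2 - c) (1 - p)) :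
    (c : ℝ) / n + 3 * ε - 3 * √(ε * (c / n) + ε ^ 2) ≤ p := by
  have hn0 : (0 : ℝ) < n := by positivity
  set q : ℝ := c / n with hq
  have hq0 : 0 ≤ q := by positivity
  set s := √(ε * q + ε ^ 2) with hs
  have hss : s ^ 2 = ε * q + ε ^ 2 := Real.sq_sqrt (by positivity)
  have hsε : ε ≤ s := eps_le_sqrt hε.le hq0
  by_contra! hlt
  set Y := q + 3 * ε - 3 * s with hY
  have hY0 : 0 < Y := by linarith
  have hq1 : 0 < q := by linarith
  have hYq : Y ≤ q := by linarith
  -- Tilting the count of the complement by y amounts, once y^(n-2) is cancelled, to tilting the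
  -- count c of the inside by 1/y. The base is then at least one, so the exponent n - 2 can be
  -- raised to n.
  set y := Y / q with hy
  have hy0 : 0 < y := by positivity
  have hy1 : y ≤ 1 := by rw [hy, div_le_one hq1]; exact hYq
  have h1 := h y ⟨hy0.le, hy1⟩
  have h2 : y ^ (n - 2 - c) = y ^ (n - 2) / y ^ c := by
    rw [eq_div_iff (by positivity), ← pow_add]; congr 1; omega
  have h3 : 1 - (1 - p) + (1 - p) * y = y * (1 + p * (1 / y - 1)) := by field_simp; ring
  rw [h2, h3, mul_pow, div_le_iff₀ (by positivity)] at h1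
  have hy2 : 0 ≤ 1 / y - 1 := by rw [sub_nonneg, le_div_iff₀ hy0]; linarith
  have h4 : 1 ≤ Real.exp (9 / 2 * n * ε) * (1 + p * (1 / y - 1)) ^ (n - 2) * y ^ c := by
    have : 0 < y ^ (n - 2) := by positivity
    by_contra! hcon
    have := mul_lt_mul_of_pos_left hcon this
    nlinarith
  have h5 : (1 + p * (1 / y - 1)) ^ (n - 2) ≤ Real.exp ((n : ℝ) * p * (1 / y - 1)) := by
    calc (1 + p * (1 / y - 1)) ^ (n - 2) ≤ (1 + p * (1 / y - 1)) ^ n := by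
          apply pow_le_pow_right₀ _ (by omega)
          have := mul_nonneg hp0 hy2
          linarith
      _ ≤ (Real.exp (p * (1 / y - 1))) ^ n := by
          gcongr
          have := Real.add_one_le_exp (p * (1 / y - 1))
          linarith
      _ = _ := by rw [← Real.exp_nat_mul]; ring_nf
  have h6 : 1 ≤ Real.exp (9 / 2 * n * ε + n * p * (1 / y - 1) + c * Real.log y) := by
    rw [Real.exp_add, Real.exp_add, ← Real.log_pow, Real.exp_log (by positivity)]
    refine h4.trans ?_
    gcongr
  rw [Real.one_le_exp_iff] at h6
  have hcq : (c : ℝ) = n * q := by rw [hq]; field_simp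
  rw [hcq] at h6
  have h7 : 0 ≤ 9 / 2 * ε + p * (1 / y - 1) + q * Real.log y := by
    have : 9 / 2 * n * ε + n * p * (1 / y - 1) + n * q * Real.log y
      = n * (9 / 2 * ε + p * (1 / y - 1) + q * Real.log y) := by ring
    rw [this] at h6
    exact nonneg_of_mul_nonneg_right h6 hn0
  have hYlt : Y < q := by nlinarith
  have hsy : 1 / y = q / Y := by rw [hy, one_div_div]
  have h8 : p * (q / Y - 1) < q - Y := by
    have : Y * (q / Y - 1) = q - Y := by field_simp
    rw [← this]
    apply mul_lt_mul_of_pos_right hlt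
    rw [sub_pos, lt_div_iff₀ hY0]; linarith
  have h9 := bernstein_le_poisson (s := q / Y) (by rw [le_div_iff₀ hY0]; linarith)
  have h10 : Real.log y = -Real.log (q / Y) := by rw [← hsy, one_div, Real.log_inv, neg_neg]
  rw [h10, hsy] at h7
  have h11 : Y * (3 * (q / Y - 1) ^ 2 / (2 * (q / Y + 2))) = 3 * (q - Y) ^ 2 / (2 * (q + 2 * Y)) := by
    field_simp
  have h12 : Y * (q / Y * Real.log (q / Y) - q / Y + 1) = q * Real.log (q / Y) - q + Y := by
    field_simp
  have h13 := mul_le_mul_of_nonneg_left h9 hY0.le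
  rw [h11, h12] at h13
  -- This equation is how Y is chosen: with q - Y = 3(s - ε) it reads (s - ε)² = ε(q + 2ε - 2s).
  have h14 : 3 * (q - Y) ^ 2 / (2 * (q + 2 * Y)) = 9 / 2 * ε := by
    rw [div_eq_iff (by positivity)]
    rw [hY]
    linear_combination 27 * hss
  linarith

end

section

/-! ### Simultaneous control of the spacings of a sample -/

lemma isClosed_setOf_tailOK (N : ℕ) (t : ℝ) (k : ℕ) : IsClosed {p | TailOK N t k p} := by
  have : {p | TailOK N t k p}
      = ⋂ y ∈ Set.Icc (0 : ℝ) 1, {p | y ^ k ≤ Real.exp t * (1 - p + p * y) ^ N} := by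
    ext p; simp [TailOK]
  rw [this]
  exact isClosed_biInter fun y _ => isClosed_le (by fun_prop) (by fun_prop)

-- No union over the values of the count is needed. If k is the largest excluded value, every
-- excluded count is at most k, and a y that excludes k bounds the probability of a count of at most
-- k by Markov's inequality for y^count.
open Classical in
lemma measure_pi_not_tailOK_le {ι : Type*} [Fintype ι] (μ : Measure ℝ) [IsProbabilityMeasure μ]
    {Q : Set ℝ} (hQ : MeasurableSet Q) (t : ℝ) :
    Measure.pi (fun _ : ι => μ) {y | ¬ TailOK (Fintype.card ι) t
      (Finset.univ.filter fun l => y l ∈ Q).card (μ.real Q)} ≤ ENNReal.ofReal (Real.exp (-t)) := by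
  set p := μ.real Q with hp
  set N := Fintype.card ι
  set bad := (Finset.range (N + 1)).filter fun k => ¬ TailOK N t k p with hbad
  have hsub : ∀ y : ι → ℝ, (Finset.univ.filter fun l => y l ∈ Q).card ∈ Finset.range (N + 1) := by
    intro y
    rw [Finset.mem_range, Nat.lt_succ_iff]
    exact (Finset.card_le_univ _)
  by_cases hne : bad.Nonempty
  swap
  · rw [Finset.not_nonempty_iff_eq_empty] at hne
    have : {y : ι → ℝ | ¬ TailOK N t (Finset.univ.filter fun l => y l ∈ Q).card p} = ∅ := by
      ext y
      simp only [Set.mem_ofPred_eq, Set.mem_empty_iff_false, iff_false]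
      intro h
      have : (Finset.univ.filter fun l => y l ∈ Q).card ∈ bad := Finset.mem_filter.2 ⟨hsub y, h⟩
      rw [hne] at this
      simp at this
    rw [this]; simp
  set k := bad.max' hne with hk
  have hkb : ¬ TailOK N t k p := (Finset.mem_filter.1 (bad.max'_mem hne)).2
  unfold TailOK at hkb
  push Not at hkb
  obtain ⟨y, hy, hyk⟩ := hkb
  have hp0 : 0 ≤ p := measureReal_nonneg
  have hp1 : p ≤ 1 := measureReal_le_one
  have hb0 : 0 ≤ 1 - p + p * y := by nlinarith [mul_nonneg hp0 hy.1]
  have hyk0 : 0 < y ^ k := lt_of_le_of_lt (by positivity) hyk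
  set g : ℝ → ℝ := fun x => 1 - (1 - y) * Q.indicator (fun _ => (1 : ℝ)) x with hg
  have hgv : ∀ x, g x = if x ∈ Q then y else 1 := by
    intro x; simp only [hg, Set.indicator]; split_ifs <;> ring
  have hg0 : ∀ x, 0 ≤ g x := by intro x; rw [hgv]; split_ifs; exacts [hy.1, zero_le_one]
  have hg1 : ∀ x, g x ≤ 1 := by intro x; rw [hgv]; split_ifs; exacts [hy.2, le_rfl]
  have hgm : Measurable g := by
    simp only [hg]
    exact measurable_const.sub (measurable_const.mul (measurable_const.indicator hQ))
  have hprod : ∀ x : ι → ℝ, ∏ l, g (x l) = y ^ (Finset.univ.filter fun l => x l ∈ Q).card := by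
    intro x
    simp_rw [hgv]
    rw [Finset.prod_ite]; simp
  have hint : ∫ x, g x ∂μ = 1 - p + p * y := by
    simp only [hg]
    rw [integral_sub (integrable_const _) (((integrable_const _).indicator hQ).const_mul _),
      integral_const_mul, integral_indicator_const _ hQ]
    simp [← hp]; ring
  have hInt : ∫ x : ι → ℝ, ∏ l, g (x l) ∂(Measure.pi fun _ : ι => μ) = (1 - p + p * y) ^ N := by
    rw [integral_fintype_prod_eq_prod (fun _ => g)]
    simp [hint, N]
  have hintg : Integrable (fun x : ι → ℝ => ∏ l, g (x l)) (Measure.pi fun _ : ι => μ) := by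
    refine Integrable.of_bound (C := 1) ?_ (ae_of_all _ fun x => ?_)
    · exact (Finset.measurable_prod _ fun l _ => hgm.comp (measurable_pi_apply l)).aestronglyMeasurable
    · rw [Real.norm_of_nonneg (Finset.prod_nonneg fun l _ => hg0 _)]
      exact Finset.prod_le_one (fun l _ => hg0 _) fun l _ => hg1 _
  have hM := mul_meas_ge_le_integral_of_nonneg
    (ae_of_all _ fun x => Finset.prod_nonneg fun l _ => hg0 _) hintg (y ^ k)
  rw [hInt] at hM
  have hle : (Measure.pi fun _ : ι => μ).real {x | y ^ k ≤ ∏ l, g (x l)} ≤ Real.exp (-t) := by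
    have h1 : (1 - p + p * y) ^ N ≤ Real.exp (-t) * y ^ k := by
      rw [Real.exp_neg, inv_mul_eq_div, le_div_iff₀ (Real.exp_pos t)]
      linarith
    by_contra! hc
    have := mul_lt_mul_of_pos_left hc hyk0
    linarith
  calc _ ≤ (Measure.pi fun _ : ι => μ) {x | y ^ k ≤ ∏ l, g (x l)} := by
        apply measure_mono
        intro x hx
        have hmem : (Finset.univ.filter fun l => x l ∈ Q).card ∈ bad :=
          Finset.mem_filter.2 ⟨hsub x, hx⟩
        have := bad.le_max' _ hmem
        simp only [Set.mem_ofPred_eq, hprod]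
        exact pow_le_pow_of_le_one hy.1 hy.2 this
    _ = ENNReal.ofReal ((Measure.pi fun _ : ι => μ).real {x | y ^ k ≤ ∏ l, g (x l)}) := by
        rw [ofReal_measureReal]
    _ ≤ _ := ENNReal.ofReal_le_ofReal hle

open Classical in
/-- The number of observations other than the `i`th and the `j`th in `Q`. -/
def othersIn {n : ℕ} (X : Fin n → ℝ) (i j : Fin n) (Q : Set ℝ) : ℕ :=
  (Finset.univ.filter fun l => l ≠ i ∧ l ≠ j ∧ X l ∈ Q).card

/-- The set Q depends on the sample only through its ith and jth coordinates. Integrating out the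
other coordinates first, with these two frozen, reduces the claim to a fixed set and n - 2
independent observations. -/
lemma measure_pi_not_tailOK_pair_le {n : ℕ} (μ : Measure ℝ) [IsProbabilityMeasure μ]
    {i j : Fin n} (hij : i ≠ j) {Q : ℝ → ℝ → Set ℝ}
    (hQ : MeasurableSet {p : (ℝ × ℝ) × ℝ | p.2 ∈ Q p.1.1 p.1.2}) (t : ℝ) :
    Measure.pi (fun _ : Fin n => μ) {X | ¬ TailOK (n - 2) t (othersIn X i j (Q (X i) (X j)))
      (μ.real (Q (X i) (X j)))} ≤ ENNReal.ofReal (Real.exp (-t)) := by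
  classical
  set A := {X : Fin n → ℝ | ¬ TailOK (n - 2) t (othersIn X i j (Q (X i) (X j)))
      (μ.real (Q (X i) (X j)))} with hA
  have hpair : Measurable fun X : Fin n → ℝ => (X i, X j) :=
    (measurable_pi_apply i).prodMk (measurable_pi_apply j)
  have hcount : Measurable fun X : Fin n → ℝ => othersIn X i j (Q (X i) (X j)) := by
    have : (fun X : Fin n → ℝ => othersIn X i j (Q (X i) (X j))) = fun X =>
        ∑ l, if l ≠ i ∧ l ≠ j ∧ X l ∈ Q (X i) (X j) then 1 else 0 := by
      funext X; rw [othersIn, Finset.card_filter]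
    rw [this]
    refine Finset.measurable_sum _ fun l _ => Measurable.ite ?_ measurable_const measurable_const
    by_cases hl : l ≠ i ∧ l ≠ j
    · have : {X : Fin n → ℝ | l ≠ i ∧ l ≠ j ∧ X l ∈ Q (X i) (X j)} =
          (fun X => ((X i, X j), X l)) ⁻¹' {p : (ℝ × ℝ) × ℝ | p.2 ∈ Q p.1.1 p.1.2} := by
        ext X; simp [hl]
      rw [this]
      exact (hpair.prodMk (measurable_pi_apply l)) hQ
    · have : {X : Fin n → ℝ | l ≠ i ∧ l ≠ j ∧ X l ∈ Q (X i) (X j)} = ∅ := by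
        ext X; simp only [Set.mem_ofPred_eq, Set.mem_empty_iff_false, iff_false]; tauto
      rw [this]; exact MeasurableSet.empty
  have hprob : Measurable fun X : Fin n → ℝ => μ.real (Q (X i) (X j)) := by
    have h1 : Measurable fun p : ℝ × ℝ => μ (Q p.1 p.2) := measurable_measure_prodMk_left hQ
    exact (h1.comp hpair).ennreal_toReal
  have hAm : MeasurableSet A := by
    have : A = ⋃ k : ℕ, {X | othersIn X i j (Q (X i) (X j)) = k} ∩
        {X | TailOK (n - 2) t k (μ.real (Q (X i) (X j)))}ᶜ := by
      ext X; simp [hA]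
    rw [this]
    refine MeasurableSet.iUnion fun k => (hcount (measurableSet_singleton k)).inter ?_
    exact (hprob (isClosed_setOf_tailOK (n - 2) t k).measurableSet).compl
  rw [← lintegral_indicator_one hAm]
  have hle : ∫⁻ X, A.indicator 1 X ∂(Measure.pi fun _ : Fin n => μ) ≤
      ∫⁻ _, ENNReal.ofReal (Real.exp (-t)) ∂(Measure.pi fun _ : Fin n => μ) := by
    refine lintegral_le_of_lmarginal_le (Finset.univ.filter fun l => l ≠ i ∧ l ≠ j)
      (measurable_one.indicator hAm) measurable_const ?_
    intro X
    simp only [lmarginal]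
    set s := Finset.univ.filter fun l : Fin n => l ≠ i ∧ l ≠ j with hs
    have hi : i ∉ s := by simp [hs]
    have hj : j ∉ s := by simp [hs]
    have hcard : Fintype.card s = n - 2 := by
      rw [Fintype.card_coe]
      have : s = (Finset.univ.erase i).erase j := by
        ext l; simp [hs, and_comm]
      rw [this, Finset.card_erase_of_mem (by simp [hij.symm]), Finset.card_erase_of_mem (by simp)]
      simp; omega
    have key := measure_pi_not_tailOK_le (ι := s) μ (Q := Q (X i) (X j)) (measurable_prodMk_left (x := (X i, X j)) hQ) t
    rw [hcard] at key
    simp only [lintegral_const, measure_univ, mul_one]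
    set B := {y : s → ℝ | ¬ TailOK (n - 2) t (Finset.univ.filter fun l => y l ∈ Q (X i) (X j)).card
      (μ.real (Q (X i) (X j)))} with hB
    have hmem : ∀ y : s → ℝ, Function.updateFinset X s y ∈ A ↔ y ∈ B := by
      intro y
      have e1 : Function.updateFinset X s y i = X i := by simp [Function.updateFinset, hi]
      have e2 : Function.updateFinset X s y j = X j := by simp [Function.updateFinset, hj]
      have e3 : othersIn (Function.updateFinset X s y) i j (Q (X i) (X j))
          = (Finset.univ.filter fun l => y l ∈ Q (X i) (X j)).card := by
        rw [othersIn]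
        have : (Finset.univ.filter fun l => l ≠ i ∧ l ≠ j ∧
            Function.updateFinset X s y l ∈ Q (X i) (X j)) =
            (Finset.univ.filter fun l : s => y l ∈ Q (X i) (X j)).map
              (Function.Embedding.subtype _) := by
          ext l
          simp only [Finset.mem_filter, Finset.mem_univ, true_and, Finset.mem_map,
            Function.Embedding.coe_subtype, Subtype.exists, exists_and_right, exists_eq_right]
          constructor
          · rintro ⟨h1, h2, h3⟩
            have hl : l ∈ s := by simp [hs, h1, h2]
            exact ⟨hl, by simpa [Function.updateFinset, hl] using h3⟩
          · rintro ⟨hl, h3⟩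
            have hl' := hl
            simp only [hs, Finset.mem_filter, Finset.mem_univ, true_and] at hl'
            exact ⟨hl'.1, hl'.2, by simpa [Function.updateFinset, hl] using h3⟩
        rw [this, Finset.card_map]
      simp [hA, hB, e1, e2, e3]
    have hBm : MeasurableSet B := by
      have hm : Measurable fun y : s → ℝ => Function.updateFinset X s y := measurable_updateFinset
      have := hm hAm
      convert this using 1
      ext y
      exact (hmem y).symm
    refine le_trans (le_of_eq ?_) key
    rw [← lintegral_indicator_one hBm]
    congr 1
    funext y
    by_cases h : y ∈ B
    · rw [Set.indicator_of_mem h, Set.indicator_of_mem ((hmem y).2 h)]; rfl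
    · rw [Set.indicator_of_notMem h, Set.indicator_of_notMem (fun h' => h ((hmem y).1 h'))]
  simpa using hle

/-- All the spacings of the sample, and their complements, have probabilities compatible with the
Chernoff bounds. -/
def GoodSample {n : ℕ} (μ : Measure ℝ) (t : ℝ) (X : Fin n → ℝ) : Prop :=
  ∀ i j, i < j →
    TailOK (n - 2) t (othersIn X i j (Set.Ioo (min (X i) (X j)) (max (X i) (X j))))
      (μ.real (Set.Ioo (min (X i) (X j)) (max (X i) (X j)))) ∧
    TailOK (n - 2) t (othersIn X i j (Set.Icc (min (X i) (X j)) (max (X i) (X j)))ᶜ)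
      (μ.real (Set.Icc (min (X i) (X j)) (max (X i) (X j)))ᶜ)

/-- Two events for each unordered pair make n(n-1) ≤ n² events; at t = log(n²/δ) the bound is δ. -/
lemma measure_not_goodSample_le {n : ℕ} (μ : Measure ℝ) [IsProbabilityMeasure μ] (t : ℝ) :
    Measure.pi (fun _ : Fin n => μ) {X | ¬ GoodSample μ t X}
      ≤ ENNReal.ofReal ((n : ℝ) ^ 2 * Real.exp (-t)) := by
  classical
  set S := (Finset.univ : Finset (Fin n × Fin n)).filter fun q => q.1 ≠ q.2 with hS
  have hQ1 : MeasurableSet {p : (ℝ × ℝ) × ℝ | p.2 ∈ Set.Ioo (min p.1.1 p.1.2) (max p.1.1 p.1.2)} := by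
    have h1 : MeasurableSet {p : (ℝ × ℝ) × ℝ | min p.1.1 p.1.2 < p.2} :=
      measurableSet_lt (by fun_prop) (by fun_prop)
    have h2 : MeasurableSet {p : (ℝ × ℝ) × ℝ | p.2 < max p.1.1 p.1.2} :=
      measurableSet_lt (by fun_prop) (by fun_prop)
    exact h1.inter h2
  have hQ2 : MeasurableSet {p : (ℝ × ℝ) × ℝ |
      p.2 ∈ (Set.Icc (min p.1.1 p.1.2) (max p.1.1 p.1.2))ᶜ} := by
    have h1 : MeasurableSet {p : (ℝ × ℝ) × ℝ | min p.1.1 p.1.2 ≤ p.2} :=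
      measurableSet_le (by fun_prop) (by fun_prop)
    have h2 : MeasurableSet {p : (ℝ × ℝ) × ℝ | p.2 ≤ max p.1.1 p.1.2} :=
      measurableSet_le (by fun_prop) (by fun_prop)
    exact (h1.inter h2).compl
  -- ordered pairs `(i, j)` with `i < j` carry the inner event, those with `j < i` the outer one
  let E : Fin n × Fin n → Set (Fin n → ℝ) := fun q =>
    if q.1 < q.2 then
      {X | ¬ TailOK (n - 2) t
        (othersIn X q.1 q.2 (Set.Ioo (min (X q.1) (X q.2)) (max (X q.1) (X q.2))))
        (μ.real (Set.Ioo (min (X q.1) (X q.2)) (max (X q.1) (X q.2))))}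
    else
      {X | ¬ TailOK (n - 2) t
        (othersIn X q.2 q.1 (Set.Icc (min (X q.2) (X q.1)) (max (X q.2) (X q.1)))ᶜ)
        (μ.real (Set.Icc (min (X q.2) (X q.1)) (max (X q.2) (X q.1)))ᶜ)}
  have hE : ∀ q ∈ S, Measure.pi (fun _ : Fin n => μ) (E q) ≤ ENNReal.ofReal (Real.exp (-t)) := by
    intro q hq
    have hne : q.1 ≠ q.2 := (Finset.mem_filter.1 hq).2
    by_cases h : q.1 < q.2
    · simp only [E, if_pos h]
      exact measure_pi_not_tailOK_pair_le μ hne (Q := fun a b => Set.Ioo (min a b) (max a b)) hQ1 t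
    · simp only [E, if_neg h]
      exact measure_pi_not_tailOK_pair_le μ hne.symm
        (Q := fun a b => (Set.Icc (min a b) (max a b))ᶜ) hQ2 t
  have hsub : {X : Fin n → ℝ | ¬ GoodSample μ t X} ⊆ ⋃ q ∈ S, E q := by
    intro X hX
    simp only [GoodSample, Set.mem_ofPred_eq, not_forall] at hX
    obtain ⟨i, j, hij, h⟩ := hX
    rw [not_and_or] at h
    rw [Set.mem_iUnion₂]
    rcases h with h | h
    · exact ⟨(i, j), by simp [hS, hij.ne], by simp only [E, if_pos hij]; exact h⟩
    · exact ⟨(j, i), by simp [hS, hij.ne'], by simp only [E, if_neg hij.not_gt]; exact h⟩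
  calc _ ≤ Measure.pi (fun _ : Fin n => μ) (⋃ q ∈ S, E q) := measure_mono hsub
    _ ≤ ∑ q ∈ S, Measure.pi (fun _ : Fin n => μ) (E q) := measure_biUnion_finset_le _ _
    _ ≤ ∑ q ∈ S, ENNReal.ofReal (Real.exp (-t)) := Finset.sum_le_sum hE
    _ = S.card * ENNReal.ofReal (Real.exp (-t)) := by simp
    _ ≤ _ := by
      rw [ENNReal.ofReal_mul (by positivity)]
      gcongr
      have : S.card ≤ n ^ 2 := by
        refine (Finset.card_filter_le _ _).trans ?_
        simp [sq]
      rw [show ((n : ℝ) ^ 2) = ((n ^ 2 : ℕ) : ℝ) by push_cast; rfl, ENNReal.ofReal_natCast]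
      exact_mod_cast this

end

section

/-! ### Uniform confidence bounds for the probabilities of intervals -/

lemma othersIn_comm {n : ℕ} (X : Fin n → ℝ) (i j : Fin n) (Q : Set ℝ) :
    othersIn X i j Q = othersIn X j i Q := by
  unfold othersIn; congr 1; ext l; simp only [Finset.mem_filter]; tauto

lemma GoodSample.inner {n : ℕ} {μ : Measure ℝ} {t : ℝ} {X : Fin n → ℝ} (h : GoodSample μ t X)
    {i j : Fin n} (hij : i ≠ j) (hX : X i ≤ X j) :
    TailOK (n - 2) t (othersIn X i j (Set.Ioo (X i) (X j))) (μ.real (Set.Ioo (X i) (X j))) := by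
  rcases lt_or_gt_of_ne hij with h1 | h1
  · simpa [min_eq_left hX, max_eq_right hX] using (h i j h1).1
  · simpa [min_eq_right hX, max_eq_left hX, othersIn_comm X i j] using (h j i h1).1

lemma GoodSample.outer {n : ℕ} {μ : Measure ℝ} {t : ℝ} {X : Fin n → ℝ} (h : GoodSample μ t X)
    {i j : Fin n} (hij : i ≠ j) (hX : X i ≤ X j) :
    TailOK (n - 2) t (othersIn X i j (Set.Icc (X i) (X j))ᶜ) (μ.real (Set.Icc (X i) (X j))ᶜ) := by
  rcases lt_or_gt_of_ne hij with h1 | h1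
  · simpa [min_eq_left hX, max_eq_right hX] using (h i j h1).2
  · simpa [min_eq_right hX, max_eq_left hX, othersIn_comm X i j] using (h j i h1).2

open Classical in
/-- The indices of the observations in `I`. -/
def idxIn {n : ℕ} (X : Fin n → ℝ) (I : Set ℝ) : Finset (Fin n) :=
  Finset.univ.filter fun l => X l ∈ I

lemma mem_idxIn {n : ℕ} {X : Fin n → ℝ} {I : Set ℝ} {l : Fin n} : l ∈ idxIn X I ↔ X l ∈ I := by
  simp [idxIn]

/-- The maximum is taken after removing the index of the minimum, so the two indices differ even if
observations are tied. -/
lemma exists_extreme_pair {n : ℕ} (X : Fin n → ℝ) {K : Finset (Fin n)} (hK : 2 ≤ K.card) :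
    ∃ i ∈ K, ∃ j ∈ K, i ≠ j ∧ X i ≤ X j ∧ ∀ l ∈ K, X l ∈ Set.Icc (X i) (X j) := by
  obtain ⟨i, hi, hmin⟩ := K.exists_min_image X (Finset.card_pos.1 (by omega))
  have h1 : (K.erase i).Nonempty := by
    rw [← Finset.card_pos, Finset.card_erase_of_mem hi]; omega
  obtain ⟨j, hj, hmax⟩ := (K.erase i).exists_max_image X h1
  have hjK := Finset.mem_of_mem_erase hj
  refine ⟨i, hi, j, hjK, (Finset.ne_of_mem_erase hj).symm, hmin j hjK, fun l hl => ⟨hmin l hl, ?_⟩⟩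
  by_cases hli : l = i
  · rw [hli]; exact hmin j hjK
  · exact hmax l (Finset.mem_erase.2 ⟨hli, hl⟩)

/-- Covers the case of fewer than two observations outside the interval, where no pair outside is
available for comparison. -/
lemma one_le_upperConf {n k : ℕ} {ε : ℝ} (hn : 3 ≤ n) (hk : n ≤ k + 1) (hkn : k ≤ n)
    (hε : 4 / 9 * Real.log n ≤ n * ε) : 1 ≤ upperConf ε (k / n) := by
  have hn0 : (0 : ℝ) < n := by positivity
  have hl : 0.69 ≤ Real.log n := by
    have h1 := Real.log_two_gt_d9
    have : Real.log 2 ≤ Real.log n := by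
      apply Real.log_le_log (by norm_num); exact_mod_cast (by omega : 2 ≤ n)
    linarith
  have hnε : 1 / 4 ≤ n * ε := by linarith
  have hε0 : 0 < ε := by by_contra! h; nlinarith
  have hq : 1 - 1 / n ≤ (k : ℝ) / n := by
    rw [le_div_iff₀ hn0, sub_mul, div_mul_cancel₀ _ hn0.ne']
    have : (n : ℝ) ≤ k + 1 := by exact_mod_cast hk
    linarith
  have hq1 : (k : ℝ) / n ≤ 1 := by rw [div_le_one hn0]; exact_mod_cast hkn
  have hs : ε ≤ √(ε * (k / n) + ε ^ 2) := eps_le_sqrt hε0.le (by positivity)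
  have h4 : 1 / (n : ℝ) ≤ 4 * ε := by rw [div_le_iff₀ hn0]; linarith
  unfold upperConf
  nlinarith

lemma upperConf_nonneg {ε q : ℝ} (hε : 0 ≤ ε) (hq : 0 ≤ q) (hq1 : q ≤ 1) : 0 ≤ upperConf ε q := by
  have := eps_le_sqrt hε hq
  unfold upperConf
  nlinarith

variable {n : ℕ} {μ : Measure ℝ} [IsProbabilityMeasure μ] {ε : ℝ} {X : Fin n → ℝ}

/-- If some observations outside I lie on each side of it, the nearest ones on the two sides bound
an open interval that contains I and has the same k observations inside. Otherwise all outside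
observations lie on one side, and I is contained in the complement of the closed interval spanned by
them, which again holds exactly k observations. -/
lemma GoodSample.measureReal_le (h : GoodSample μ (9 / 2 * n * ε) X) (hn : 3 ≤ n)
    (hε : 4 / 9 * Real.log n ≤ n * ε) {I : Set ℝ} (hI : I.OrdConnected) :
    μ.real I ≤ upperConf ε ((idxIn X I).card / n) := by
  classical
  set k := (idxIn X I).card with hk
  have hkn : k ≤ n := by simpa using (idxIn X I).card_le_univ
  rcases le_or_gt n (k + 1) with hk1 | hk1
  · exact measureReal_le_one.trans (one_le_upperConf hn hk1 hkn hε)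
  rcases I.eq_empty_or_nonempty with rfl | ⟨z, hz⟩
  · have hn0 : (0 : ℝ) < n := by positivity
    have : 0 ≤ Real.log n := Real.log_natCast_nonneg n
    have hε0 : 0 ≤ ε := by by_contra! h; nlinarith
    simpa using upperConf_nonneg hε0 (by positivity) (by rw [div_le_one hn0]; exact_mod_cast hkn)
  have hside : ∀ x ∉ I, x < z → ∀ y ∈ I, x < y := by
    intro x hx hxz y hy
    by_contra! hyx
    exact hx (hI.out hy hz ⟨hyx, hxz.le⟩)
  have hside' : ∀ x ∉ I, z < x → ∀ y ∈ I, y < x := by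
    intro x hx hxz y hy
    by_contra! hyx
    exact hx (hI.out hz hy ⟨hxz.le, hyx⟩)
  have hne : ∀ x ∉ I, x ≠ z := fun x hx h => hx (h ▸ hz)
  set O := Finset.univ.filter fun l => X l ∉ I with hO
  have hOc : O.card = n - k := by
    have := Finset.card_filter_add_card_filter_not (s := (Finset.univ : Finset (Fin n))) (fun l => X l ∈ I)
    simp only [Finset.card_univ, Fintype.card_fin] at this
    have h2 : k = (Finset.univ.filter fun l => X l ∈ I).card := by rw [hk, idxIn]
    rw [hO]
    omega
  by_cases hboth : (∃ l, X l ∉ I ∧ X l < z) ∧ ∃ l, X l ∉ I ∧ z < X l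
  · obtain ⟨⟨l₁, hl₁⟩, l₂, hl₂⟩ := hboth
    obtain ⟨i, hi, hmax⟩ := (Finset.univ.filter fun l => X l ∉ I ∧ X l < z).exists_max_image X
      ⟨l₁, by simpa using hl₁⟩
    obtain ⟨j, hj, hmin⟩ := (Finset.univ.filter fun l => X l ∉ I ∧ z < X l).exists_min_image X
      ⟨l₂, by simpa using hl₂⟩
    simp only [Finset.mem_filter, Finset.mem_univ, true_and] at hi hj hmax hmin
    have hlt : X i < X j := hi.2.trans hj.2
    have hcount : othersIn X i j (Set.Ioo (X i) (X j)) = k := by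
      rw [othersIn, hk, idxIn]
      congr 1
      ext l
      simp only [Finset.mem_filter, Finset.mem_univ, true_and, Set.mem_Ioo]
      constructor
      · rintro ⟨-, -, h1, h2⟩
        by_contra hl
        rcases lt_or_gt_of_ne (hne _ hl) with h3 | h3
        · exact absurd (hmax l ⟨hl, h3⟩) (not_le.2 h1)
        · exact absurd (hmin l ⟨hl, h3⟩) (not_le.2 h2)
      · intro hl
        refine ⟨fun h => hi.1 (h ▸ hl), fun h => hj.1 (h ▸ hl), hside _ hi.1 hi.2 _ hl,
          hside' _ hj.1 hj.2 _ hl⟩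
    have hT := h.inner (fun h => by rw [h] at hlt; exact lt_irrefl _ hlt) hlt.le
    rw [hcount] at hT
    refine le_trans (measureReal_mono fun y hy => ?_) (hT.le_upperConf hn (by omega) hε
      measureReal_le_one)
    exact ⟨hside _ hi.1 hi.2 _ hy, hside' _ hj.1 hj.2 _ hy⟩
  · obtain ⟨i, hi, j, hj, hij, hXij, hall⟩ := exists_extreme_pair X (K := O) (by omega)
    simp only [hO, Finset.mem_filter, Finset.mem_univ, true_and] at hi hj hall
    have hdisj : ∀ y ∈ I, y ∉ Set.Icc (X i) (X j) := by
      rintro y hy ⟨h1, h2⟩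
      have hiz : X i < z := by
        by_contra! hc
        exact absurd h1 (not_le.2 (hside' _ hi (lt_of_le_of_ne hc (hne _ hi).symm) y hy))
      have hjz : z < X j := by
        by_contra! hc
        exact absurd h2 (not_le.2 (hside _ hj (lt_of_le_of_ne hc (hne _ hj)) y hy))
      exact hboth ⟨⟨i, hi, hiz⟩, j, hj, hjz⟩
    have hcount : othersIn X i j (Set.Icc (X i) (X j))ᶜ = k := by
      rw [othersIn, hk, idxIn]
      congr 1
      ext l
      simp only [Finset.mem_filter, Finset.mem_univ, true_and, Set.mem_compl_iff]
      constructor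
      · rintro ⟨-, -, h1⟩
        by_contra hl
        exact h1 (hall l hl)
      · intro hl
        exact ⟨fun h => hi (h ▸ hl), fun h => hj (h ▸ hl), hdisj _ hl⟩
    have hT := h.outer hij hXij
    rw [hcount] at hT
    exact le_trans (measureReal_mono fun y hy => hdisj y hy) (hT.le_upperConf hn (by omega) hε
      measureReal_le_one)

/-- The extreme observations in I span a closed interval inside I. They are themselves not counted
among the free observations, which is the loss of 2/n. -/
lemma GoodSample.le_measureReal (h : GoodSample μ (9 / 2 * n * ε) X) (hn : 3 ≤ n)
    (hε : 0 < ε) {I : Set ℝ} (hI : I.OrdConnected) :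
    ((idxIn X I).card - 2 : ℝ) / n + 3 * ε - 3 * √(ε * ((idxIn X I).card / n) + ε ^ 2)
      ≤ μ.real I := by
  classical
  set k := (idxIn X I).card with hk
  have hn0 : (0 : ℝ) < n := by positivity
  have hkn : k ≤ n := by simpa using (idxIn X I).card_le_univ
  have hs := eps_le_sqrt hε.le (show 0 ≤ (k : ℝ) / n by positivity)
  rcases lt_or_ge k 2 with hk2 | hk2
  · refine le_trans ?_ measureReal_nonneg
    have : (k - 2 : ℝ) / n ≤ 0 := by
      apply div_nonpos_of_nonpos_of_nonneg _ hn0.le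
      have : (k : ℝ) ≤ 2 := by exact_mod_cast hk2.le
      linarith
    linarith
  · obtain ⟨i, hi, j, hj, hij, hXij, hall⟩ := exists_extreme_pair X (K := idxIn X I) hk2
    rw [mem_idxIn] at hi hj
    have hcount : othersIn X i j (Set.Icc (X i) (X j))ᶜ = n - 2 - (k - 2) := by
      have h1 : othersIn X i j (Set.Icc (X i) (X j))ᶜ
          = (Finset.univ.filter fun l => ¬ X l ∈ I).card := by
        rw [othersIn]
        congr 1
        ext l
        simp only [Finset.mem_filter, Finset.mem_univ, true_and, Set.mem_compl_iff]
        constructor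
        · rintro ⟨-, -, h1⟩ hl
          exact h1 (hall l (mem_idxIn.2 hl))
        · intro hl
          exact ⟨fun h => hl (h ▸ hi), fun h => hl (h ▸ hj), fun h => hl (hI.out hi hj h)⟩
      have := Finset.card_filter_add_card_filter_not (s := (Finset.univ : Finset (Fin n))) (fun l => X l ∈ I)
      simp only [Finset.card_univ, Fintype.card_fin] at this
      have h2 : k = (Finset.univ.filter fun l => X l ∈ I).card := by rw [hk, idxIn]
      rw [h1]
      omega
    have hT := h.outer hij hXij
    rw [hcount, probReal_compl_eq_one_sub measurableSet_Icc] at hT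
    have := hT.lowerConf_le hn (by omega) hε measureReal_nonneg
    refine le_trans ?_ (this.trans (measureReal_mono (hI.out hi hj)))
    push_cast [hk2]
    gcongr
    linarith

/-- The simultaneous confidence band for the probabilities of intervals. -/
lemma GoodSample.abs_sub_le (h : GoodSample μ (9 / 2 * n * ε) X) (hn : 3 ≤ n)
    (hε : 4 / 9 * Real.log n ≤ n * ε) {I : Set ℝ} (hI : I.OrdConnected) :
    |μ.real I - (1 - 2 * ε) * ((idxIn X I).card / n) - ((3 - 4 / n) * ε - 1 / n)| ≤
      3 * √(ε * ((idxIn X I).card / n) + ε ^ 2) + (1 + 4 * ε) / n := by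
  have hn0 : (0 : ℝ) < n := by positivity
  have hε0 : 0 < ε := by
    have : 0 < Real.log n := Real.log_pos (by exact_mod_cast (by omega : 1 < n))
    by_contra! h; nlinarith
  have h1 := h.measureReal_le hn hε hI
  have h2 := h.le_measureReal hn hε0 hI
  unfold upperConf at h1
  set q : ℝ := (idxIn X I).card / n with hq
  have hq0 : 0 ≤ q := by positivity
  have h3 : ((idxIn X I).card - 2 : ℝ) / n = q - 2 / n := by rw [hq]; ring
  rw [h3] at h2
  have e1 : (3 - 4 / n) * ε = 3 * ε - 4 * ε / n := by ring
  have e2 : (1 + 4 * ε) / n = 1 / n + 4 * ε / n := by ring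
  have e3 : (2 : ℝ) / n = 1 / n + 1 / n := by ring
  have : 0 ≤ 4 * ε / n := by positivity
  -- The upper end of the band is exactly `upperConf`; the lower end has slack 2εq + 8ε/n.
  rw [abs_le, e1, e2]
  constructor <;> nlinarith [mul_nonneg hε0.le hq0]

end

section

/-! ### The confidence limits in terms of interval probabilities -/

lemma card_idxIn {n : ℕ} (X : Fin n → ℝ) (I : Set ℝ) :
    ((idxIn X I).card : ℝ) = ∑ i, I.indicator (fun _ => (1 : ℝ)) (X i) := by
  classical
  rw [idxIn, Finset.card_filter]
  push_cast
  refine Finset.sum_congr rfl fun i _ => ?_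
  by_cases h : X i ∈ I <;> simp [h]

lemma empProb_eq {n : ℕ} (X : Fin n → ℝ) (h z : ℝ) :
    empProb X h z = (idxIn X (Set.Icc (z - h) (z + h))).card / n := by
  rw [empProb, card_idxIn]; ring

/-- Since `sgn 0 = 1`, an observation at z itself counts on the left, whence the half-open interval.
-/
lemma kernDeriv_div {h : ℝ} (hh : 0 < h) (z x : ℝ) :
    kernDeriv ((z - x) / h) = (Set.Ioo z (z + h)).indicator (fun _ => (1 : ℝ)) x -
      (Set.Ioc (z - h) z).indicator (fun _ => (1 : ℝ)) x := by
  have e1 : |(z - x) / h| < 1 ↔ z - h < x ∧ x < z + h := by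
    rw [abs_div, abs_of_pos hh, div_lt_one hh, abs_lt]
    constructor <;> rintro ⟨h1, h2⟩ <;> constructor <;> linarith
  have e2 : 0 ≤ (z - x) / h ↔ x ≤ z := by
    rw [le_div_iff₀ hh]; constructor <;> intro h <;> linarith
  simp only [kernDeriv, sgn, e1, e2, Set.indicator, Set.mem_Ioo, Set.mem_Ioc]
  split_ifs with h1 h2 h3 h4 h5 h6 h7 <;> simp_all
  all_goals linarith

lemma sq_mul_kdeDeriv {n : ℕ} (X : Fin n → ℝ) {h : ℝ} (hh : 0 < h) (z : ℝ) :
    h ^ 2 * kdeDeriv X h z = (idxIn X (Set.Ioo z (z + h))).card / n -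
      (idxIn X (Set.Ioc (z - h) z)).card / n := by
  rw [kdeDeriv, card_idxIn, card_idxIn, ← sub_div, ← Finset.sum_sub_distrib, ← Finset.mul_sum]
  simp_rw [kernDeriv_div hh]
  field_simp

lemma sq_mul_kdeDeriv' {n : ℕ} (X : Fin n → ℝ) {h : ℝ} (hh : h ≠ 0) (z : ℝ) :
    h ^ 2 * kdeDeriv X h z = 1 / n * ∑ i, kernDeriv ((z - X i) / h) := by
  rw [kdeDeriv, ← Finset.mul_sum]
  field_simp

lemma mul_kde {n : ℕ} (X : Fin n → ℝ) {h : ℝ} (hh : h ≠ 0) (z : ℝ) :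
    h * kde X h z = 1 / n * ∑ i, kern ((z - X i) / h) := by
  rw [kde, ← Finset.mul_sum]
  field_simp

lemma kern_eq_max (x : ℝ) : kern x = max (1 - |x|) 0 := by
  unfold kern
  split_ifs with h
  · rw [max_eq_left (by linarith)]
  · rw [max_eq_right (by linarith)]

lemma continuous_kern : Continuous kern := by
  rw [show kern = fun x => max (1 - |x|) 0 from funext kern_eq_max]
  fun_prop

/-- The layer-cake formula: the triangular kernel is an average of indicators of nested intervals,
so bands for interval probabilities carry over to the kernel estimator. -/
lemma kern_div_eq_integral {h : ℝ} (hh : 0 < h) (z x : ℝ) :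
    kern ((z - x) / h) = ∫ t in (0 : ℝ)..1,
      (Set.Icc (z - t * h) (z + t * h)).indicator (fun _ => (1 : ℝ)) x := by
  set a := |(z - x) / h| with ha
  have ha0 : 0 ≤ a := abs_nonneg _
  have e : ∀ t, (Set.Icc (z - t * h) (z + t * h)).indicator (fun _ => (1 : ℝ)) x
      = (Set.Ici a).indicator (fun _ => (1 : ℝ)) t := by
    intro t
    have : x ∈ Set.Icc (z - t * h) (z + t * h) ↔ t ∈ Set.Ici a := by
      rw [Set.mem_Ici, ha, abs_div, abs_of_pos hh, div_le_iff₀ hh, abs_le, Set.mem_Icc]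
      constructor <;> rintro ⟨h1, h2⟩ <;> constructor <;> linarith
    by_cases hx : x ∈ Set.Icc (z - t * h) (z + t * h)
    · rw [Set.indicator_of_mem hx, Set.indicator_of_mem (this.1 hx)]
    · rw [Set.indicator_of_notMem hx, Set.indicator_of_notMem fun h' => hx (this.2 h')]
  simp_rw [e]
  rw [intervalIntegral.integral_of_le zero_le_one, ← integral_Icc_eq_integral_Ioc,
    setIntegral_indicator measurableSet_Ici]
  have : Set.Icc (0 : ℝ) 1 ∩ Set.Ici a = Set.Icc a 1 := by
    ext t; simp only [Set.mem_inter_iff, Set.mem_Icc, Set.mem_Ici]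
    constructor
    · rintro ⟨⟨_, h1⟩, h2⟩; exact ⟨h2, h1⟩
    · rintro ⟨h1, h2⟩; exact ⟨⟨ha0.trans h1, h2⟩, h1⟩
  rw [this, kern_eq_max]
  simp [ha]

/-- `h² f_h'(z)` for the density smoothed with the triangular kernel. -/
def popA (μ : Measure ℝ) (h z : ℝ) : ℝ := μ.real (Set.Ioo z (z + h)) - μ.real (Set.Ioc (z - h) z)

/-- `h f_h(z)` for the density smoothed with the triangular kernel. -/
def popB (μ : Measure ℝ) (h z : ℝ) : ℝ :=
  ∫ t in (0 : ℝ)..1, μ.real (Set.Icc (z - t * h) (z + t * h))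

variable {n : ℕ} {μ : Measure ℝ} [IsProbabilityMeasure μ] {δ : ℝ} {X : Fin n → ℝ}

lemma intervalIntegrable_measureReal_Icc (μ : Measure ℝ) [IsProbabilityMeasure μ] {h : ℝ}
    (hh : 0 < h) (z : ℝ) : IntervalIntegrable
      (fun t => μ.real (Set.Icc (z - t * h) (z + t * h))) volume 0 1 := by
  apply Monotone.intervalIntegrable
  intro s t hst
  have := mul_le_mul_of_nonneg_right hst hh.le
  exact measureReal_mono (Set.Icc_subset_Icc (by linarith) (by linarith))

lemma mul_kde_eq_integral (X : Fin n → ℝ) {h : ℝ} (hh : 0 < h) (z : ℝ) :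
    h * kde X h z = ∫ t in (0 : ℝ)..1,
      ((idxIn X (Set.Icc (z - t * h) (z + t * h))).card : ℝ) / n := by
  rw [mul_kde X hh.ne']
  simp_rw [card_idxIn, kern_div_eq_integral hh]
  rw [intervalIntegral.integral_div, intervalIntegral.integral_finsetSum]
  · ring
  · intro i _
    apply Monotone.intervalIntegrable
    intro s t hst
    have := mul_le_mul_of_nonneg_right hst hh.le
    exact Set.indicator_le_indicator_of_subset
      (Set.Icc_subset_Icc (by linarith) (by linarith)) (fun _ => zero_le_one) _

lemma card_idxIn_mono (X : Fin n → ℝ) {I J : Set ℝ} (h : I ⊆ J) :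
    (idxIn X I).card ≤ (idxIn X J).card :=
  Finset.card_le_card fun _ hl => mem_idxIn.2 (h (mem_idxIn.1 hl))

/-- The sample is good at the level of the confidence bands. -/
def GoodAt (μ : Measure ℝ) (δ : ℝ) (X : Fin n → ℝ) : Prop :=
  GoodSample μ (9 / 2 * n * epsBand n δ) X

/-- The reason for the factor 2/9 in `epsBand`: the Chernoff exponent is then the logarithm of n²/δ.
-/
lemma n_mul_epsBand {n : ℕ} (hn : 0 < n) (δ : ℝ) :
    9 / 2 * n * epsBand n δ = Real.log ((n : ℝ) ^ 2 / δ) := by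
  have : (n : ℝ) ≠ 0 := by positivity
  unfold epsBand epsRate
  field_simp

lemma log_le_n_mul_epsBand {n : ℕ} (hn : 0 < n) (hδ : 0 < δ) (hδ1 : δ < 1) :
    4 / 9 * Real.log n ≤ n * epsBand n δ := by
  have hn0 : (0 : ℝ) < n := by positivity
  have h1 := n_mul_epsBand hn δ
  have h2 : 2 * Real.log n ≤ Real.log ((n : ℝ) ^ 2 / δ) := by
    rw [Real.log_div (by positivity) hδ.ne', Real.log_pow]
    have := Real.log_neg hδ hδ1
    push_cast; linarith
  linarith

lemma epsBand_pos {n : ℕ} (hn : 3 ≤ n) (hδ : 0 < δ) (hδ1 : δ < 1) : 0 < epsBand n δ := by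
  have h1 := log_le_n_mul_epsBand (by omega : 0 < n) hδ hδ1
  have hn0 : (0 : ℝ) < n := by positivity
  have : 0 < Real.log n := Real.log_pos (by exact_mod_cast (by omega : 1 < n))
  by_contra! h; nlinarith

/-- The width of the band for an interval with empirical probability `q`. -/
def widthV (n : ℕ) (ε q : ℝ) : ℝ := 3 * √(ε * q + ε ^ 2) + (1 + 4 * ε) / n

lemma bandV_eq (δ : ℝ) (X : Fin n → ℝ) (h z : ℝ) :
    bandV δ X h z = widthV n (epsBand n δ) ((idxIn X (Set.Icc (z - h) (z + h))).card / n) := by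
  rw [bandV, empProb_eq, widthV]

lemma widthV_mono {ε q q' : ℝ} (hε : 0 ≤ ε) (h : q ≤ q') : widthV n ε q ≤ widthV n ε q' := by
  unfold widthV; gcongr

/-- The additive centre of the band cancels in the difference of the two half-windows; each
contributes a width at most that of the whole window. -/
lemma GoodAt.abs_popA_sub_le (hg : GoodAt μ δ X) (hn : 3 ≤ n) (hδ : 0 < δ) (hδ1 : δ < 1)
    {h : ℝ} (hh : 0 < h) (z : ℝ) :
    |popA μ h z - (1 - 2 * epsBand n δ) * (h ^ 2 * kdeDeriv X h z)| ≤ 2 * bandV δ X h z := by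
  have hε := log_le_n_mul_epsBand (by omega : 0 < n) hδ hδ1
  have hε0 := epsBand_pos hn hδ hδ1
  have hb : ∀ I : Set ℝ, I.OrdConnected → I ⊆ Set.Icc (z - h) (z + h) →
      |μ.real I - (1 - 2 * epsBand n δ) * ((idxIn X I).card / n) -
        ((3 - 4 / n) * epsBand n δ - 1 / n)| ≤ bandV δ X h z := by
    intro I hI hsub
    refine (GoodSample.abs_sub_le hg hn hε hI).trans ?_
    rw [bandV_eq]
    apply widthV_mono hε0.le
    have := card_idxIn_mono X hsub
    gcongr
  have h1 := hb (Set.Ioo z (z + h)) Set.ordConnected_Ioo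
    fun x hx => ⟨by linarith [hx.1], hx.2.le⟩
  have h2 := hb (Set.Ioc (z - h) z) Set.ordConnected_Ioc
    fun x hx => ⟨hx.1.le, by linarith [hx.2]⟩
  rw [sq_mul_kdeDeriv X hh, popA]
  rw [abs_le] at *
  constructor <;> linarith [h1.1, h1.2, h2.1, h2.2]

lemma GoodAt.abs_popB_sub_le (hg : GoodAt μ δ X) (hn : 3 ≤ n) (hδ : 0 < δ) (hδ1 : δ < 1)
    {h : ℝ} (hh : 0 < h) (z : ℝ) :
    |popB μ h z - (1 - 2 * epsBand n δ) * (h * kde X h z) -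
      ((3 - 4 / n) * epsBand n δ - 1 / n)| ≤ bandV δ X h z := by
  have hε := log_le_n_mul_epsBand (by omega : 0 < n) hδ hδ1
  have hε0 := epsBand_pos hn hδ hδ1
  have hmono : Monotone fun t : ℝ => ((idxIn X (Set.Icc (z - t * h) (z + t * h))).card : ℝ) / n := by
    intro s t hst
    have := mul_le_mul_of_nonneg_right hst hh.le
    have := card_idxIn_mono X (Set.Icc_subset_Icc (a₁ := z - s * h) (a₂ := z - t * h)
      (b₁ := z + s * h) (b₂ := z + t * h) (by linarith) (by linarith))
    simp only
    gcongr
  have hint1 := intervalIntegrable_measureReal_Icc μ hh z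
  have hint2 : IntervalIntegrable (fun t : ℝ => ((idxIn X (Set.Icc (z - t * h) (z + t * h))).card : ℝ) / n)
    volume 0 1 := hmono.intervalIntegrable
  have hsplit : popB μ h z - (1 - 2 * epsBand n δ) * (h * kde X h z) -
      ((3 - 4 / n) * epsBand n δ - 1 / n) = ∫ t in (0 : ℝ)..1,
        (μ.real (Set.Icc (z - t * h) (z + t * h)) - (1 - 2 * epsBand n δ) *
          (((idxIn X (Set.Icc (z - t * h) (z + t * h))).card : ℝ) / n) -
            ((3 - 4 / n) * epsBand n δ - 1 / n)) := by
    rw [intervalIntegral.integral_sub (hint1.sub (hint2.const_mul _)) (by simp),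
      intervalIntegral.integral_sub hint1 (hint2.const_mul _), intervalIntegral.integral_const_mul,
      mul_kde_eq_integral X hh, popB]
    simp
  rw [hsplit]
  have := intervalIntegral.norm_integral_le_of_norm_le_const (a := (0 : ℝ)) (b := 1)
    (C := bandV δ X h z) (f := fun t => (μ.real (Set.Icc (z - t * h) (z + t * h)) -
      (1 - 2 * epsBand n δ) * (((idxIn X (Set.Icc (z - t * h) (z + t * h))).card : ℝ) / n) -
            ((3 - 4 / n) * epsBand n δ - 1 / n))) ?_
  · simpa using this
  · intro t ht
    rw [Set.uIoc_of_le zero_le_one] at ht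
    rw [Real.norm_eq_abs]
    refine (GoodSample.abs_sub_le hg hn hε Set.ordConnected_Icc).trans ?_
    rw [bandV_eq]
    apply widthV_mono hε0.le
    have : t * h ≤ h := by nlinarith [ht.2]
    have := card_idxIn_mono X (Set.Icc_subset_Icc (a₁ := z - t * h) (a₂ := z - h)
      (b₁ := z + t * h) (b₂ := z + h) (by linarith) (by linarith))
    gcongr

/-- The upper limit for a ratio with numerator in `[σ - 2V, σ + 2V]` and denominator in
`[Dm, Dp]`. -/
def ratioUpper (σ V Dm Dp : ℝ) : EReal :=
  if 0 < Dm then ((max ((σ + 2 * V) / Dm) ((σ + 2 * V) / Dp) : ℝ) : EReal) else ⊤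

/-- The sign of σ + 2V decides which end of the range of the denominator is the worst one; the
maximum covers both. -/
lemma le_ratioUpper {σ V Dm Dp A D m : ℝ} (hA : |A - σ| ≤ 2 * V) (hD1 : Dm ≤ D) (hD2 : D ≤ Dp)
    (hm : m * D ≤ A) : (m : EReal) ≤ ratioUpper σ V Dm Dp := by
  unfold ratioUpper
  split_ifs with h
  · rw [EReal.coe_le_coe_iff]
    have hD : 0 < D := h.trans_le hD1
    have h1 : m ≤ (σ + 2 * V) / D := by
      rw [le_div_iff₀ hD]; linarith [(abs_le.1 hA).2]
    rcases le_or_gt 0 (σ + 2 * V) with h2 | h2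
    · exact h1.trans ((div_le_div_of_nonneg_left h2 h hD1).trans (le_max_left _ _))
    · refine h1.trans (le_trans ?_ (le_max_right _ _))
      rw [div_le_div_iff₀ hD (hD.trans_le hD2)]
      nlinarith
  · exact le_top

lemma ratioUpper_le {σ V Dm Dp A D : ℝ} (hA : |A - σ| ≤ 2 * V) (h0 : 0 < Dm) (hmp : Dm ≤ Dp)
    (hD : Dp ≤ D) (hneg : A + 4 * V ≤ 0) :
    ratioUpper σ V Dm Dp ≤ (((A + 4 * V) / D : ℝ) : EReal) := by
  unfold ratioUpper
  rw [if_pos h0, EReal.coe_le_coe_iff]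
  have h1 : σ + 2 * V ≤ A + 4 * V := by linarith [(abs_le.1 hA).1]
  have hDp : 0 < Dp := h0.trans_le hmp
  have hD0 : 0 < D := hDp.trans_le hD
  apply max_le
  · rw [div_le_div_iff₀ h0 hD0]; nlinarith
  · rw [div_le_div_iff₀ hDp hD0]; nlinarith

/-- Serves to replace a window by a slightly smaller rational one: its width is no larger, so the
limit can only improve. -/
lemma ratioUpper_mono {σ V V' b h : ℝ} (hh : 0 < h) (hV' : 0 ≤ V') (hV : V' ≤ V)
    (hb : 0 < h * (b - V)) :
    ratioUpper σ V' (h * (b - V')) (h * (b + V')) ≤ ratioUpper σ V (h * (b - V)) (h * (b + V)) := by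
  have h1 : h * (b - V) ≤ h * (b - V') := by gcongr
  have h2 : h * (b + V') ≤ h * (b + V) := by gcongr
  have h3 : h * (b - V') ≤ h * (b + V') := by gcongr; linarith
  have h4 : 0 < h * (b - V') := hb.trans_le h1
  have h5 := h4.trans_le h3
  have h6 := h5.trans_le h2
  unfold ratioUpper
  rw [if_pos hb, if_pos h4, EReal.coe_le_coe_iff]
  rcases le_or_gt 0 (σ + 2 * V') with hs | hs
  · refine le_trans ?_ (le_max_left _ _)
    have : (σ + 2 * V') / (h * (b - V')) ≤ (σ + 2 * V) / (h * (b - V)) := by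
      apply div_le_div₀ <;> linarith
    exact max_le this ((div_le_div_of_nonneg_left hs h4 h3).trans this)
  · refine le_trans ?_ (le_max_right _ _)
    have : (σ + 2 * V') / (h * (b + V')) ≤ (σ + 2 * V) / (h * (b + V)) := by
      rw [div_le_div_iff₀ h5 h6]; nlinarith
    refine max_le (le_trans ?_ this) this
    rw [div_le_div_iff₀ h4 h5]; nlinarith

end

/-! ### The confidence limits as signed ratio bounds. -/

section

variable {n : ℕ} {δ : ℝ} {X : Fin n → ℝ}

/-- The centre of the band for `h f_h(z)`. -/
def bandCenter (δ : ℝ) (X : Fin n → ℝ) (h z : ℝ) : ℝ :=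
  (1 - 2 * epsBand n δ) * (h * kde X h z) + ((3 - 4 / n) * epsBand n δ - 1 / n)

/-- The centre of the band for `h² f_h'(z)`. -/
def bandSlope (δ : ℝ) (X : Fin n → ℝ) (h z : ℝ) : ℝ :=
  (1 - 2 * epsBand n δ) * (h ^ 2 * kdeDeriv X h z)

/-- The upper limit for `ω` times the score. -/
def signedLimit (δ : ℝ) (X : Fin n → ℝ) (h z ω : ℝ) : EReal :=
  ratioUpper (ω * bandSlope δ X h z) (bandV δ X h z) (h * (bandCenter δ X h z - bandV δ X h z))
    (h * (bandCenter δ X h z + bandV δ X h z))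

lemma bandD_eq (δ : ℝ) (X : Fin n → ℝ) (h z ω : ℝ) :
    bandD δ X h z ω = h * (bandCenter δ X h z + ω * bandV δ X h z) := by
  unfold bandD bandCenter; ring

lemma bandV_pos (hε : 0 < epsBand n δ) (h z : ℝ) : 0 < bandV δ X h z := by
  have hq : 0 ≤ empProb X h z := by rw [empProb_eq]; positivity
  unfold bandV
  have h1 := eps_le_sqrt hε.le hq
  have : 0 ≤ (1 + 4 * epsBand n δ) / n := by positivity
  linarith

lemma kern_nonneg (x : ℝ) : 0 ≤ kern x := by rw [kern_eq_max]; exact le_max_right _ _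

/-- If 2ε ≥ 1, the kernel estimate enters the centre with nonpositive weight, and V ≥ 3ε outweighs
the remaining terms. -/
lemma epsBand_lt_half (hε : 0 < epsBand n δ) {h z : ℝ} (hh : 0 < h)
    (hD : 0 < h * (bandCenter δ X h z - bandV δ X h z)) : 2 * epsBand n δ < 1 := by
  by_contra! hc
  have hD := pos_of_mul_pos_right hD hh.le
  have hk : 0 ≤ h * kde X h z := by
    rw [mul_kde X hh.ne']
    exact mul_nonneg (by positivity) (Finset.sum_nonneg fun i _ => kern_nonneg _)
  have hq : 0 ≤ empProb X h z := by rw [empProb_eq]; positivity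
  have h1 := eps_le_sqrt hε.le hq
  have h2 : 0 ≤ (1 + 4 * epsBand n δ) / n := by positivity
  have h3 : 0 ≤ 1 / (n : ℝ) := by positivity
  have h4 : 0 ≤ 4 / n * epsBand n δ := by positivity
  unfold bandCenter bandV at hD
  nlinarith

/-- The case distinction in the definition picks the worst end of the denominator from the sign of
the numerator limit, which is what the maximum in `ratioUpper` does. This needs 1 - 2ε > 0, which a
positive lower denominator guarantees. -/
lemma bandLimit_eq (hε : 0 < epsBand n δ) {h z : ℝ} (hh : 0 < h) {ω : ℝ} (hω : ω = 1 ∨ ω = -1) :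
    bandLimit δ X h z ω = (ω : EReal) * signedLimit δ X h z ω := by
  have hV := bandV_pos (X := X) hε h z
  set V := bandV δ X h z with hVd
  set b := bandCenter δ X h z with hb
  set k := h ^ 2 * kdeDeriv X h z with hk
  set c := 1 - 2 * epsBand n δ with hc
  unfold bandLimit signedLimit ratioUpper
  simp only [bandD_eq, ← hVd, ← hb, neg_one_mul, ← sub_eq_add_neg]
  by_cases hD : 0 < h * (b - V)
  swap
  · rw [if_neg hD, if_neg hD]
  have hc0 : 0 < c := by have := epsBand_lt_half (X := X) hε hh hD; rw [hc]; linarith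
  have hDp : h * (b - V) < h * (b + V) := by gcongr; linarith
  have hDp0 := hD.trans hDp
  rw [if_pos hD, if_pos hD, bandSlope, ← hc, ← hk, ← EReal.coe_mul]
  have hM : ∀ ω', bandM δ X h z ω' = c * |k| + 2 * ω' * V := by
    intro ω'; rw [bandM, hk, abs_mul, abs_of_pos (by positivity : 0 < h ^ 2)]
  have hmaxpos : ∀ a : ℝ, 0 ≤ a → max (a / (h * (b - V))) (a / (h * (b + V))) = a / (h * (b - V)) :=
    fun a ha => max_eq_left (div_le_div_of_nonneg_left ha hD hDp.le)
  have hmaxneg : ∀ a : ℝ, a ≤ 0 → max (a / (h * (b - V))) (a / (h * (b + V))) = a / (h * (b + V)) := by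
    intro a ha
    apply max_eq_right
    rw [div_le_div_iff₀ hD hDp0]; nlinarith
  have hks : 0 ≤ kdeDeriv X h z ↔ 0 ≤ k := by rw [hk]; exact (mul_nonneg_iff_of_pos_left (by positivity)).symm
  simp only [hM, sgn, hks]
  rcases le_or_gt 0 k with hk0 | hk0
  · rw [if_pos hk0, abs_of_nonneg hk0]
    have hck : 0 ≤ c * k := by positivity
    rcases hω with rfl | rfl
    · rw [hmaxpos _ (by linarith)]
      split_ifs <;> norm_num [sub_eq_add_neg]
    · split_ifs with h1
      · rw [hmaxneg _ (by linarith)]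
        norm_num
        rw [← EReal.coe_neg, ← neg_div]; congr 2; ring
      · rw [hmaxpos _ (by linarith)]
        norm_num
        rw [← EReal.coe_neg, ← neg_div]; congr 2; ring
  · rw [if_neg (not_le.2 hk0), abs_of_neg hk0]
    have hck : c * k < 0 := mul_neg_of_pos_of_neg hc0 hk0
    rcases hω with rfl | rfl
    · split_ifs with h1
      · rw [hmaxneg _ (by linarith)]
        norm_num; congr 1; ring
      · rw [hmaxpos _ (by linarith)]
        norm_num; congr 1; ring
    · rw [hmaxpos _ (by linarith)]
      split_ifs <;>
      · norm_num
        rw [← EReal.coe_neg, ← neg_div]; congr 2; ring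

/-! ### Measurability of the estimator -/

/-- The kernel derivative jumps at the centre and the ends of the window, so the perturbation is
one-sided: moving the centre to the right keeps a point at z on its left, and shrinking the
bandwidth by more than the shift keeps points at the ends outside. -/
lemma eventually_kernDeriv_eq (x : ℝ) {h z : ℝ} (hh : 0 < h) :
    ∀ᶠ η in nhdsWithin (0 : ℝ) (Set.Ioi 0), ∀ z' h', z < z' → z' < z + η → 0 < h' → h - 2 * η < h' →
      h' < h - η → kernDeriv ((z' - x) / h') = kernDeriv ((z - x) / h) := by
  have hev : ∀ a : ℝ, 0 < a → ∀ᶠ η in nhdsWithin (0 : ℝ) (Set.Ioi 0), 0 < η ∧ η < a := by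
    intro a ha
    exact Ioo_mem_nhdsGT ha
  rcases le_or_gt h |z - x| with h1 | h1
  · filter_upwards [hev 1 one_pos] with η hη z' h' hz1 hz2 hh' hh1 hh2
    have h2 : h' ≤ |z' - x| := by
      have := abs_sub_abs_le_abs_sub (z - x) (z' - x)
      rw [show z - x - (z' - x) = -(z' - z) by ring, abs_neg,
        abs_of_pos (show 0 < z' - z by linarith)] at this
      linarith
    rw [kernDeriv, kernDeriv, if_neg, if_neg]
    · rw [abs_div, abs_of_pos hh, div_lt_one hh]; exact not_lt.2 h1
    · rw [abs_div, abs_of_pos hh', div_lt_one hh']; exact not_lt.2 h2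
  · rcases le_or_gt x z with hx | hx
    · filter_upwards [hev ((h - |z - x|) / 3) (by linarith)] with η hη z' h' hz1 hz2 hh' hh1 hh2
      rw [abs_of_nonneg (by linarith)] at hη h1
      rw [kernDeriv, kernDeriv, if_pos, if_pos, sgn, sgn, if_pos, if_pos]
      · exact div_nonneg (by linarith) hh.le
      · exact div_nonneg (by linarith) hh'.le
      · rw [abs_of_nonneg (div_nonneg (by linarith) hh.le), div_lt_one hh]; exact h1
      · rw [abs_of_nonneg (div_nonneg (by linarith) hh'.le), div_lt_one hh']; linarith
    · filter_upwards [hev ((h - |z - x|) / 3) (by linarith), hev (x - z) (by linarith)]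
        with η hη hη' z' h' hz1 hz2 hh' hh1 hh2
      rw [abs_of_neg (by linarith)] at hη h1
      have e1 : (z - x) / h < 0 := div_neg_of_neg_of_pos (by linarith) hh
      have e2 : (z' - x) / h' < 0 := div_neg_of_neg_of_pos (by linarith) hh'
      rw [kernDeriv, kernDeriv, if_pos, if_pos, sgn, sgn, if_neg (not_le.2 e2),
        if_neg (not_le.2 e1)]
      · rw [abs_of_neg e1, ← neg_div, div_lt_one hh]; exact h1
      · rw [abs_of_neg e2, ← neg_div, div_lt_one hh']; linarith

lemma continuousAt_bandCenter (δ : ℝ) (X : Fin n → ℝ) {h z : ℝ} (hh : 0 < h) :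
    ContinuousAt (fun p : ℝ × ℝ => bandCenter δ X p.2 p.1) (z, h) := by
  have : (fun p : ℝ × ℝ => (1 - 2 * epsBand n δ) * (1 / n * ∑ i, kern ((p.1 - X i) / p.2)) +
      ((3 - 4 / n) * epsBand n δ - 1 / n)) =ᶠ[nhds (z, h)] fun p : ℝ × ℝ => bandCenter δ X p.2 p.1 := by
    have : ∀ᶠ p : ℝ × ℝ in nhds (z, h), p.2 ≠ 0 :=
      continuousAt_snd.eventually_ne hh.ne'
    filter_upwards [this] with p hp
    rw [bandCenter, mul_kde X hp]
  refine ContinuousAt.congr ?_ this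
  refine ContinuousAt.add (ContinuousAt.mul continuousAt_const (ContinuousAt.mul continuousAt_const
    (tendsto_finsetSum _ fun i _ => ?_))) continuousAt_const
  refine ContinuousAt.comp (f := fun p : ℝ × ℝ => (p.1 - X i) / p.2) continuous_kern.continuousAt ?_
  exact ContinuousAt.div (by fun_prop) (by fun_prop) hh.ne'

/-- For a nearby rational window inside the original one, the slope is unchanged, the width V is no
larger and the centre is almost the same by continuity. Inclusion of the window keeps it admissible
for the upper and the lower limit. -/
lemma exists_rat_signedLimit_lt (hε : 0 < epsBand n δ) {h z ω : ℝ} (hh : 0 < h) {c : EReal}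
    (hc : signedLimit δ X h z ω < c) :
    ∃ z' h' : ℚ, (0 : ℝ) < h' ∧ (z' + h' : ℝ) ≤ z + h ∧ z - h ≤ (z' - h' : ℝ) ∧
      signedLimit δ X h' z' ω < c := by
  set V := bandV δ X h z with hV
  have hV0 : 0 < V := bandV_pos hε h z
  have hD : 0 < h * (bandCenter δ X h z - V) := by
    by_contra hD
    rw [signedLimit, ratioUpper, if_neg hD] at hc
    exact not_top_lt hc
  set σ := ω * bandSlope δ X h z with hσ
  -- Only the kernel estimate and the bandwidth vary in F; the discontinuous slope and V are frozen
  -- at (z, h).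
  let F : ℝ × ℝ → ℝ := fun p => max ((σ + 2 * V) / (p.2 * (bandCenter δ X p.2 p.1 - V)))
    ((σ + 2 * V) / (p.2 * (bandCenter δ X p.2 p.1 + V)))
  have hcb := continuousAt_bandCenter δ X (z := z) hh
  have hc1 : ContinuousAt (fun p : ℝ × ℝ => p.2 * (bandCenter δ X p.2 p.1 - V)) (z, h) :=
    continuousAt_snd.mul (hcb.sub continuousAt_const)
  have hc2 : ContinuousAt (fun p : ℝ × ℝ => p.2 * (bandCenter δ X p.2 p.1 + V)) (z, h) :=
    continuousAt_snd.mul (hcb.add continuousAt_const)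
  have hDp : 0 < h * (bandCenter δ X h z + V) := hD.trans (by gcongr; linarith)
  have hF : ContinuousAt F (z, h) :=
    (continuousAt_const.div hc1 hD.ne').max (continuousAt_const.div hc2 hDp.ne')
  have hF' : ContinuousAt (fun p => (F p : EReal)) (z, h) :=
    continuous_coe_real_ereal.continuousAt.comp hF
  rw [signedLimit, ratioUpper, if_pos hD] at hc
  have hev : ∀ᶠ p : ℝ × ℝ in nhds (z, h), (F p : EReal) < c ∧
      0 < p.2 * (bandCenter δ X p.2 p.1 - V) ∧ 0 < p.2 :=
    (hF'.eventually_lt continuousAt_const hc).and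
      ((hc1.eventually (lt_mem_nhds hD)).and (continuousAt_snd.eventually (lt_mem_nhds hh)))
  obtain ⟨r, hr, hball⟩ := Metric.eventually_nhds_iff.1 hev
  have hk : ∀ᶠ η in nhdsWithin (0 : ℝ) (Set.Ioi 0), ∀ i : Fin n, ∀ z' h', z < z' → z' < z + η →
      0 < h' → h - 2 * η < h' → h' < h - η →
      kernDeriv ((z' - X i) / h') = kernDeriv ((z - X i) / h) :=
    Filter.eventually_all.2 fun i => eventually_kernDeriv_eq (X i) hh
  obtain ⟨η, hη, hη0, hηr⟩ := (hk.and (Ioo_mem_nhdsGT (half_pos hr))).exists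
  obtain ⟨z', hz1, hz2⟩ := exists_rat_btwn (show z < z + η by linarith)
  obtain ⟨h', hh1, hh2⟩ := exists_rat_btwn (show h - 2 * η < h - η by linarith)
  have hdist : dist ((z' : ℝ), (h' : ℝ)) (z, h) < r := by
    rw [Prod.dist_eq, max_lt_iff, Real.dist_eq, Real.dist_eq, abs_lt, abs_lt]
    refine ⟨⟨?_, ?_⟩, ?_, ?_⟩ <;> simp only <;> linarith
  obtain ⟨hFc, hDp', hh0⟩ := hball hdist
  simp only at hDp' hh0
  refine ⟨z', h', hh0, by linarith, by linarith, lt_of_le_of_lt ?_ hFc⟩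
  have hslope : bandSlope δ X h' z' = bandSlope δ X h z := by
    unfold bandSlope
    rw [sq_mul_kdeDeriv' X hh0.ne', sq_mul_kdeDeriv' X hh.ne']
    congr 2
    exact Finset.sum_congr rfl fun i _ => hη i z' h' hz1 hz2 hh0 hh1 hh2
  have hVle : bandV δ X h' z' ≤ V := by
    rw [hV, bandV_eq, bandV_eq]
    apply widthV_mono hε.le
    have := card_idxIn_mono X (Set.Icc_subset_Icc (a₁ := (z' : ℝ) - h') (a₂ := z - h)
      (b₁ := z' + h') (b₂ := z + h) (by linarith) (by linarith))
    gcongr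
  have := ratioUpper_mono (σ := σ) hh0 (bandV_pos (X := X) hε h' z').le hVle hDp'
  rw [signedLimit, hslope]
  refine this.trans (le_of_eq ?_)
  rw [ratioUpper, if_pos hDp']

end

/-! ### Rational windows suffice, and the estimator is jointly measurable. -/

section

variable {n : ℕ} {δ : ℝ} {X : Fin n → ℝ}

lemma upperLimit_eq (hε : 0 < epsBand n δ) (x : ℝ) :
    upperLimit δ X x = ⨅ (z : ℝ) (h : ℝ) (_ : 0 < h) (_ : h ≤ x - z), signedLimit δ X h z 1 := by
  unfold upperLimit
  refine iInf_congr fun z => iInf_congr fun h => iInf_congr fun hh => iInf_congr fun _ => ?_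
  rw [bandLimit_eq hε hh (Or.inl rfl)]; simp

lemma lowerLimit_eq (hε : 0 < epsBand n δ) (x : ℝ) :
    lowerLimit δ X x = ⨆ (z : ℝ) (h : ℝ) (_ : 0 < h) (_ : h ≤ z - x), -signedLimit δ X h z (-1) := by
  unfold lowerLimit
  refine iSup_congr fun z => iSup_congr fun h => iSup_congr fun hh => iSup_congr fun _ => ?_
  rw [bandLimit_eq hε hh (Or.inr rfl)]; simp

lemma upperLimit_eq_rat (hε : 0 < epsBand n δ) (x : ℝ) :
    upperLimit δ X x = ⨅ (z : ℚ) (h : ℚ),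
      if (0 : ℝ) < h ∧ (h : ℝ) ≤ x - z then signedLimit δ X h z 1 else ⊤ := by
  rw [upperLimit_eq hε]
  apply le_antisymm
  · refine le_iInf fun z => le_iInf fun h => ?_
    split_ifs with hc
    · exact iInf_le_of_le (z : ℝ) (iInf_le_of_le (h : ℝ) (iInf_le_of_le hc.1 (iInf_le_of_le hc.2 le_rfl)))
    · exact le_top
  · refine le_iInf fun z => le_iInf fun h => le_iInf fun hh => le_iInf fun hx => ?_
    by_contra! hc
    obtain ⟨z', h', h1, h2, -, h4⟩ := exists_rat_signedLimit_lt hε hh hc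
    refine absurd h4 (not_lt.2 ((iInf_le _ z').trans ((iInf_le _ h').trans ?_)))
    rw [if_pos ⟨h1, by linarith⟩]

lemma lowerLimit_eq_rat (hε : 0 < epsBand n δ) (x : ℝ) :
    lowerLimit δ X x = -⨅ (z : ℚ) (h : ℚ),
      if (0 : ℝ) < h ∧ (h : ℝ) ≤ z - x then signedLimit δ X h z (-1) else ⊤ := by
  rw [lowerLimit_eq hε]
  apply le_antisymm
  · refine iSup_le fun z => iSup_le fun h => iSup_le fun hh => iSup_le fun hx => ?_
    rw [EReal.neg_le_neg_iff]
    by_contra! hc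
    obtain ⟨z', h', h1, -, h3, h4⟩ := exists_rat_signedLimit_lt hε hh hc
    refine absurd h4 (not_lt.2 ((iInf_le _ z').trans ((iInf_le _ h').trans ?_)))
    rw [if_pos ⟨h1, by linarith⟩]
  · rw [EReal.neg_le]
    refine le_iInf fun z => le_iInf fun h => ?_
    split_ifs with hc
    · rw [EReal.neg_le]
      exact le_iSup_of_le (z : ℝ) (le_iSup_of_le (h : ℝ) (le_iSup_of_le hc.1 (le_iSup_of_le hc.2 le_rfl)))
    · exact le_top

lemma measurable_sgn : Measurable sgn := by
  unfold sgn
  exact Measurable.ite measurableSet_Ici measurable_const measurable_const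

lemma measurable_kernDeriv : Measurable kernDeriv := by
  unfold kernDeriv
  exact Measurable.ite (measurableSet_lt (by fun_prop) (by fun_prop)) measurable_sgn.neg
    measurable_const

lemma measurable_kde (h z : ℝ) : Measurable fun X : Fin n → ℝ => kde X h z := by
  unfold kde
  refine measurable_const.mul (Finset.measurable_sum _ fun i _ => measurable_const.mul ?_)
  exact continuous_kern.measurable.comp (by fun_prop)

lemma measurable_kdeDeriv (h z : ℝ) : Measurable fun X : Fin n → ℝ => kdeDeriv X h z := by
  unfold kdeDeriv
  refine measurable_const.mul (Finset.measurable_sum _ fun i _ => measurable_const.mul ?_)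
  exact measurable_kernDeriv.comp (by fun_prop)

lemma measurable_bandV (δ h z : ℝ) : Measurable fun X : Fin n → ℝ => bandV δ X h z := by
  have : Measurable fun X : Fin n → ℝ => empProb X h z := by
    unfold empProb
    refine measurable_const.mul (Finset.measurable_sum _ fun i _ => ?_)
    exact (measurable_const.indicator measurableSet_Icc).comp (measurable_pi_apply i)
  unfold bandV
  fun_prop

lemma measurable_signedLimit (δ h z ω : ℝ) :
    Measurable fun X : Fin n → ℝ => signedLimit δ X h z ω := by
  have h1 := measurable_bandV (n := n) δ h z
  have h2 : Measurable fun X : Fin n → ℝ => bandCenter δ X h z := by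
    unfold bandCenter
    have := measurable_kde (n := n) h z
    fun_prop
  have h3 : Measurable fun X : Fin n → ℝ => bandSlope δ X h z := by
    unfold bandSlope
    have := measurable_kdeDeriv (n := n) h z
    fun_prop
  unfold signedLimit ratioUpper
  refine Measurable.ite (measurableSet_lt (by fun_prop) (by fun_prop)) ?_ measurable_const
  apply Measurable.coe_real_ereal
  fun_prop

lemma measurable_limit_rat (δ ω : ℝ) (a : ℝ) :
    Measurable fun p : ℝ × (Fin n → ℝ) => ⨅ (z : ℚ) (h : ℚ),
      if (0 : ℝ) < h ∧ (h : ℝ) ≤ a * (p.1 - z) then signedLimit δ p.2 h z ω else ⊤ := by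
  refine Measurable.iInf fun z => Measurable.iInf fun h => Measurable.ite ?_
    ((measurable_signedLimit δ h z ω).comp measurable_snd) measurable_const
  have : MeasurableSet {p : ℝ × (Fin n → ℝ) | (h : ℝ) ≤ a * (p.1 - z)} :=
    measurableSet_le (by fun_prop) (by fun_prop)
  exact (MeasurableSet.const _).inter this

lemma measurable_multiscaleEstimator (hn : 3 ≤ n) (hδ : 0 < δ) (hδ1 : δ < 1) :
    Measurable (Function.uncurry (multiscaleEstimator n δ)) := by
  have hε := epsBand_pos hn hδ hδ1
  have h1 : Measurable fun p : ℝ × (Fin n → ℝ) => upperLimit δ p.2 p.1 := by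
    simp_rw [upperLimit_eq_rat hε]
    have := measurable_limit_rat (n := n) δ 1 1
    simpa only [one_mul] using this
  have h2 : Measurable fun p : ℝ × (Fin n → ℝ) => lowerLimit δ p.2 p.1 := by
    simp_rw [lowerLimit_eq_rat hε]
    have := measurable_limit_rat (n := n) δ (-1) (-1)
    simp only [neg_mul, one_mul, neg_sub] at this
    exact this.neg
  unfold Function.uncurry multiscaleEstimator
  exact Measurable.ite (measurableSet_lt measurable_const h2) h2
    (Measurable.ite (measurableSet_lt h1 measurable_const) h1 measurable_const)

end

section

/-! ### Log-concave densities and their scores -/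

/-- The properties of a log-concave density `f` with score `ψ` that are used below. They are
invariant under reflection, unlike the choice of the right derivative as the score. -/
structure ScorePair (f ψ : ℝ → ℝ) : Prop where
  continuous : Continuous f
  nonneg : ∀ x, 0 ≤ f x
  lintegral_eq_one : ∫⁻ x, ENNReal.ofReal (f x) = 1
  ordConnected : {x | 0 < f x}.OrdConnected
  antitoneOn : AntitoneOn ψ {x | 0 < f x}
  mul_integral_le : ∀ a b m, a ≤ b → (∀ t ∈ Set.Ioo a b, 0 < f t → m ≤ ψ t) →
    m * ∫ t in a..b, f t ≤ f b - f a
  le_mul_integral : ∀ a b m, a ≤ b → (∀ t ∈ Set.Ioo a b, 0 < f t → ψ t ≤ m) →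
    f b - f a ≤ m * ∫ t in a..b, f t

lemma ScorePair.reflect {f ψ : ℝ → ℝ} (h : ScorePair f ψ) :
    ScorePair (fun x => f (-x)) (fun x => -ψ (-x)) where
  continuous := h.continuous.comp continuous_neg
  nonneg x := h.nonneg _
  lintegral_eq_one := by
    have := (Measure.measurePreserving_neg (volume : Measure ℝ)).lintegral_comp
      (f := fun x => ENNReal.ofReal (f x)) (by have := h.continuous; fun_prop)
    rw [this, h.lintegral_eq_one]
  ordConnected := ⟨fun x hx y hy z hz =>
    h.ordConnected.out (x := -y) hy (y := -x) hx ⟨neg_le_neg hz.2, neg_le_neg hz.1⟩⟩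
  antitoneOn x hx y hy hxy := neg_le_neg (h.antitoneOn (a := -y) hy (b := -x) hx (neg_le_neg hxy))
  mul_integral_le a b m hab hm := by
    have := h.le_mul_integral (-b) (-a) (-m) (neg_le_neg hab) fun t ht hft => by
      have := hm (-t) ⟨by linarith [ht.2], by linarith [ht.1]⟩ (by simpa using hft)
      simp only [neg_neg] at this
      linarith
    rw [intervalIntegral.integral_comp_neg]
    linarith
  le_mul_integral a b m hab hm := by
    have := h.mul_integral_le (-b) (-a) (-m) (neg_le_neg hab) fun t ht hft => by
      have := hm (-t) ⟨by linarith [ht.2], by linarith [ht.1]⟩ (by simpa using hft)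
      simp only [neg_neg] at this
      linarith
    rw [intervalIntegral.integral_comp_neg]
    linarith

/-- The inequality passes to the first zero of f after c by continuity, and beyond it G no longer
changes, since f cannot become positive again. -/
lemma nonneg_of_nonneg_on_support_right {f G : ℝ → ℝ} (hf : Continuous f) (hf0 : ∀ x, 0 ≤ f x)
    (hU : {x | 0 < f x}.OrdConnected) (hG : Continuous G) {c b : ℝ} (hcb : c ≤ b) (hc : 0 < f c)
    (hpos : ∀ t ∈ Set.Icc c b, 0 < f t → 0 ≤ G t)
    (hconst : ∀ s ∈ Set.Icc c b, (∀ t ∈ Set.Icc s b, f t = 0) → G b = G s) : 0 ≤ G b := by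
  rcases (hf0 b).eq_or_lt with hb | hb
  swap
  · exact hpos b ⟨hcb, le_rfl⟩ hb
  set Z := {t ∈ Set.Icc c b | f t = 0} with hZ
  have hZc : IsClosed Z := isClosed_Icc.inter (isClosed_eq hf continuous_const)
  have hZb : BddBelow Z := ⟨c, fun t ht => ht.1.1⟩
  have hs := hZc.csInf_mem ⟨b, ⟨hcb, le_rfl⟩, hb.symm⟩ hZb
  set s := sInf Z
  have hcs : c < s := lt_of_le_of_ne hs.1.1 fun h => by rw [← h] at hs; exact hc.ne' hs.2
  have hlt : ∀ t ∈ Set.Ico c s, 0 < f t := by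
    intro t ht
    refine (hf0 t).lt_of_ne fun h => ?_
    exact absurd (csInf_le hZb ⟨⟨ht.1, ht.2.le.trans hs.1.2⟩, h.symm⟩) (not_le.2 ht.2)
  rw [hconst s hs.1 fun t ht => ?_]
  · have hmem : s ∈ closure (Set.Ico c s) := by
      rw [closure_Ico hcs.ne]; exact ⟨hcs.le, le_rfl⟩
    have hcl : IsClosed {t | 0 ≤ G t} := isClosed_le continuous_const hG
    exact (hcl.closure_subset_iff.2 fun t ht =>
      hpos t ⟨ht.1, ht.2.le.trans hs.1.2⟩ (hlt t ht)) hmem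
  · by_contra hft
    have : 0 < f s := hU.out hc ((hf0 t).lt_of_ne (Ne.symm hft)) ⟨hcs.le, ht.1⟩
    exact this.ne' hs.2

lemma nonneg_of_nonneg_on_support_left {f G : ℝ → ℝ} (hf : Continuous f) (hf0 : ∀ x, 0 ≤ f x)
    (hU : {x | 0 < f x}.OrdConnected) (hG : Continuous G) {a c : ℝ} (hac : a ≤ c) (hc : 0 < f c)
    (hpos : ∀ t ∈ Set.Icc a c, 0 < f t → 0 ≤ G t)
    (hconst : ∀ s ∈ Set.Icc a c, (∀ t ∈ Set.Icc a s, f t = 0) → G a = G s) : 0 ≤ G a := by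
  have := nonneg_of_nonneg_on_support_right (f := fun x => f (-x)) (G := fun x => G (-x))
    (hf.comp continuous_neg) (fun x => hf0 _)
    ⟨fun x hx y hy z hz => hU.out (x := -y) hy (y := -x) hx ⟨neg_le_neg hz.2, neg_le_neg hz.1⟩⟩
    (hG.comp continuous_neg) (c := -c) (b := -a) (neg_le_neg hac) (by simpa using hc)
    (fun t ht hft => hpos (-t) ⟨by linarith [ht.2], by linarith [ht.1]⟩ hft)
    (fun s hs hz => by
      rw [neg_neg]
      refine hconst (-s) ⟨by linarith [hs.2], by linarith [hs.1]⟩ fun t ht => ?_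
      have := hz (-t) ⟨by linarith [ht.2], by linarith [ht.1]⟩
      simpa using this)
  simpa using this

/-- An inequality between the increments of `f` and a multiple of its integral extends from
intervals in the support to all intervals. -/
lemma increment_nonneg {f : ℝ → ℝ} (hf : Continuous f) (hf0 : ∀ x, 0 ≤ f x)
    (hU : {x | 0 < f x}.OrdConnected) {a b κ m : ℝ} (hab : a ≤ b)
    (hcore : ∀ s t, a ≤ s → s ≤ t → t ≤ b → 0 < f s → 0 < f t →
      0 ≤ κ * (f t - f s) - m * ∫ u in s..t, f u) :
    0 ≤ κ * (f b - f a) - m * ∫ u in a..b, f u := by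
  have hint : ∀ s t, IntervalIntegrable f volume s t := fun s t => hf.intervalIntegrable s t
  have hzero : ∀ s t, s ≤ t → (∀ u ∈ Set.Icc s t, f u = 0) → ∫ u in s..t, f u = 0 := by
    intro s t hst hz
    rw [intervalIntegral.integral_congr (g := fun _ => 0)]
    · simp
    · intro u hu; rw [Set.uIcc_of_le hst] at hu; exact hz u hu
  by_cases hex : ∃ c ∈ Set.Icc a b, 0 < f c
  swap
  · push Not at hex
    have hz : ∀ u ∈ Set.Icc a b, f u = 0 := fun u hu => le_antisymm (hex u hu) (hf0 u)
    rw [hzero a b hab hz, hz a ⟨le_rfl, hab⟩, hz b ⟨hab, le_rfl⟩]; simp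
  obtain ⟨c, hc, hfc⟩ := hex
  have hGc : Continuous fun t => ∫ u in c..t, f u := intervalIntegral.continuous_primitive hint c
  have hGc' : Continuous fun t => ∫ u in t..c, f u := by
    have : (fun t => ∫ u in t..c, f u) = fun t => -∫ u in c..t, f u := by
      funext t; rw [intervalIntegral.integral_symm]
    rw [this]; exact hGc.neg
  have h1 : 0 ≤ κ * (f b - f c) - m * ∫ u in c..b, f u := by
    refine nonneg_of_nonneg_on_support_right (G := fun t => κ * (f t - f c) - m * ∫ u in c..t, f u)
      hf hf0 hU (by fun_prop) hc.2 hfc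
      (fun t ht hft => hcore c t hc.1 ht.1 ht.2 hfc hft) fun s hs hz => ?_
    have := intervalIntegral.integral_add_adjacent_intervals (hint c s) (hint s b)
    rw [hzero s b hs.2 hz] at this
    rw [← this, hz s ⟨le_rfl, hs.2⟩, hz b ⟨hs.2, le_rfl⟩, add_zero]
  have h2 : 0 ≤ κ * (f c - f a) - m * ∫ u in a..c, f u := by
    refine nonneg_of_nonneg_on_support_left (G := fun t => κ * (f c - f t) - m * ∫ u in t..c, f u)
      hf hf0 hU (by fun_prop) hc.1 hfc
      (fun t ht hft => hcore t c ht.1 ht.2 hc.2 hft hfc) fun s hs hz => ?_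
    have := intervalIntegral.integral_add_adjacent_intervals (hint a s) (hint s c)
    rw [hzero a s hs.1 hz] at this
    rw [← this, hz s ⟨hs.1, le_rfl⟩, hz a ⟨le_rfl, hs.1⟩, zero_add]
  rw [← intervalIntegral.integral_add_adjacent_intervals (hint a c) (hint c b)]
  linarith

namespace IsLogConcaveDensity

variable {f : ℝ → ℝ} (hf : IsLogConcaveDensity f)
include hf

lemma isOpen_support : IsOpen {x | 0 < f x} := isOpen_lt continuous_const hf.continuous

lemma hasDerivWithinAt {x : ℝ} (hx : 0 < f x) :
    HasDerivWithinAt f (score f x * f x) (Set.Ioi x) x := by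
  have hint : x ∈ interior {x | 0 < f x} := by rw [hf.isOpen_support.interior_eq]; exact hx
  have h1 : HasDerivWithinAt (fun y => Real.log (f y)) (score f x) (Set.Ioi x) x := by
    have := (hf.concaveOn_log.neg.differentiableWithinAt_Ioi_of_mem_interior hint).neg
    simp only [neg_neg] at this
    exact this.hasDerivWithinAt
  have h2 := h1.exp
  rw [Real.exp_log hx, mul_comm] at h2
  refine h2.congr_of_eventuallyEq ?_ (Real.exp_log hx).symm
  filter_upwards [nhdsWithin_le_nhds (hf.isOpen_support.mem_nhds hx)] with y hy
  exact (Real.exp_log hy).symm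

lemma antitoneOn_score : AntitoneOn (score f) {x | 0 < f x} := by
  have h := hf.concaveOn_log.neg.monotoneOn_rightDeriv
  rw [hf.isOpen_support.interior_eq] at h
  intro x hx y hy hxy
  have := h hx hy hxy
  have e : ∀ z, derivWithin (-fun y => Real.log (f y)) (Set.Ioi z) z = -score f z := by
    intro z
    rw [derivWithin.neg]; rfl
  simp only [e] at this
  linarith

/-- The fundamental theorem of calculus for right derivatives; the score is integrable on [a, b]
because it is monotone there. -/
lemma integral_score_mul {a b : ℝ} (hab : a ≤ b) (ha : 0 < f a) (hb : 0 < f b) :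
    IntervalIntegrable (fun t => score f t * f t) volume a b ∧
      ∫ t in a..b, score f t * f t = f b - f a := by
  have hsub : Set.Icc a b ⊆ {x | 0 < f x} := hf.concaveOn_log.1.ordConnected.out ha hb
  have hint : IntervalIntegrable (fun t => score f t * f t) volume a b := by
    apply IntervalIntegrable.mul_continuousOn _ hf.continuous.continuousOn
    apply AntitoneOn.intervalIntegrable
    rw [Set.uIcc_of_le hab]
    exact hf.antitoneOn_score.mono hsub
  exact ⟨hint, intervalIntegral.integral_eq_sub_of_hasDeriv_right_of_le hab
    hf.continuous.continuousOn
    (fun x hx => hf.hasDerivWithinAt (hsub ⟨hx.1.le, hx.2.le⟩)) hint⟩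

theorem scorePair : ScorePair f (score f) where
  continuous := hf.continuous
  nonneg := hf.nonneg
  lintegral_eq_one := hf.lintegral_eq_one
  ordConnected := hf.concaveOn_log.1.ordConnected
  antitoneOn := hf.antitoneOn_score
  mul_integral_le a b m hab hm := by
    have := increment_nonneg (κ := 1) (m := m) hf.continuous hf.nonneg
      hf.concaveOn_log.1.ordConnected hab fun s t has hst htb hfs hft => by
        obtain ⟨h1, h2⟩ := hf.integral_score_mul hst hfs hft
        rw [one_mul, ← h2, ← intervalIntegral.integral_const_mul, sub_nonneg]
        refine intervalIntegral.integral_mono_on_of_le_Ioo hst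
          ((hf.continuous.intervalIntegrable s t).const_mul m) h1 fun u hu => ?_
        have hu' : u ∈ Set.Icc s t := ⟨hu.1.le, hu.2.le⟩
        have := hm u ⟨has.trans_lt hu.1, hu.2.trans_le htb⟩
          (hf.concaveOn_log.1.ordConnected.out hfs hft hu')
        exact mul_le_mul_of_nonneg_right this (hf.nonneg u)
    linarith
  le_mul_integral a b m hab hm := by
    have := increment_nonneg (κ := -1) (m := -m) hf.continuous hf.nonneg
      hf.concaveOn_log.1.ordConnected hab fun s t has hst htb hfs hft => by
        obtain ⟨h1, h2⟩ := hf.integral_score_mul hst hfs hft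
        have : ∫ u in s..t, score f u * f u ≤ ∫ u in s..t, m * f u := by
          refine intervalIntegral.integral_mono_on_of_le_Ioo hst h1
            ((hf.continuous.intervalIntegrable s t).const_mul m) fun u hu => ?_
          have hu' : u ∈ Set.Icc s t := ⟨hu.1.le, hu.2.le⟩
          have := hm u ⟨has.trans_lt hu.1, hu.2.trans_le htb⟩
            (hf.concaveOn_log.1.ordConnected.out hfs hft hu')
          exact mul_le_mul_of_nonneg_right this (hf.nonneg u)
        rw [h2, intervalIntegral.integral_const_mul] at this
        linarith
    linarith

end IsLogConcaveDensity

end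

/-! ### Smoothed scores, the hazard rate and the error at a single point. -/

section

/-- The survival function of the density `f`. -/
def survival (f : ℝ → ℝ) (x : ℝ) : ℝ := (law f).real (Set.Ioi x)

lemma survival_nonneg (f : ℝ → ℝ) (x : ℝ) : 0 ≤ survival f x := measureReal_nonneg

namespace ScorePair

variable {f ψ : ℝ → ℝ} (hs : ScorePair f ψ)
include hs

lemma isProbabilityMeasure : IsProbabilityMeasure (law f) :=
  ⟨by rw [law, withDensity_apply _ MeasurableSet.univ, setLIntegral_univ, hs.lintegral_eq_one]⟩

lemma law_real_eq {I : Set ℝ} (hI : MeasurableSet I) : (law f).real I = ∫ t in I, f t := by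
  rw [Measure.real, law, withDensity_apply _ hI, integral_eq_lintegral_of_nonneg_ae
    (ae_of_all _ hs.nonneg) hs.continuous.aestronglyMeasurable.restrict]

lemma law_Ioc {a b : ℝ} (hab : a ≤ b) : (law f).real (Set.Ioc a b) = ∫ t in a..b, f t := by
  rw [hs.law_real_eq measurableSet_Ioc, intervalIntegral.integral_of_le hab]

lemma law_Ioo {a b : ℝ} (hab : a ≤ b) : (law f).real (Set.Ioo a b) = ∫ t in a..b, f t := by
  rw [hs.law_real_eq measurableSet_Ioo, intervalIntegral.integral_of_le hab,
    integral_Ioc_eq_integral_Ioo]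

lemma law_Icc {a b : ℝ} (hab : a ≤ b) : (law f).real (Set.Icc a b) = ∫ t in a..b, f t := by
  rw [hs.law_real_eq measurableSet_Icc, intervalIntegral.integral_of_le hab,
    integral_Icc_eq_integral_Ioc]

lemma integral_nonneg' {a b : ℝ} (hab : a ≤ b) : 0 ≤ ∫ t in a..b, f t :=
  intervalIntegral.integral_nonneg hab fun t _ => hs.nonneg t

lemma survival_sub {a b : ℝ} (hab : a ≤ b) : survival f a - survival f b = ∫ t in a..b, f t := by
  have := hs.isProbabilityMeasure
  have h := measureReal_union (μ := law f) (s₁ := Set.Ioc a b) (s₂ := Set.Ioi b)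
    (by rw [Set.disjoint_left]; intro t h1 h2; exact absurd h1.2 (not_le.2 h2)) measurableSet_Ioi
  rw [Set.Ioc_union_Ioi_eq_Ioi hab, hs.law_Ioc hab] at h
  unfold survival
  linarith

/-- With `popA_eq`, this writes numerator and denominator of the smoothed score as integrals over s
of the increment and the mass of f on the same interval [z-s, z+s], which are compared for each s.
-/
lemma mul_popB_eq {h : ℝ} (hh : 0 < h) (z : ℝ) :
    h * popB (law f) h z = ∫ s in (0 : ℝ)..h, ∫ t in (z - s)..(z + s), f t := by
  have h1 : popB (law f) h z = ∫ t in (0 : ℝ)..1, (fun s => ∫ u in (z - s)..(z + s), f u) (t * h) := by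
    unfold popB
    refine intervalIntegral.integral_congr fun t ht => ?_
    rw [Set.uIcc_of_le zero_le_one] at ht
    have : 0 ≤ t * h := mul_nonneg ht.1 hh.le
    exact hs.law_Icc (by linarith)
  rw [h1, intervalIntegral.integral_comp_mul_right (fun s => ∫ u in (z - s)..(z + s), f u) hh.ne']
  simp only [zero_mul, one_mul, smul_eq_mul]
  field_simp

lemma continuous_integral_symm (z : ℝ) : Continuous fun s => ∫ t in (z - s)..(z + s), f t := by
  have hint : ∀ s t, IntervalIntegrable f volume s t := fun s t =>
    hs.continuous.intervalIntegrable s t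
  have h := intervalIntegral.continuous_primitive hint z
  have : (fun s => ∫ t in (z - s)..(z + s), f t) = fun s =>
      (∫ t in z..(z + s), f t) - ∫ t in z..(z - s), f t := by
    funext s
    rw [intervalIntegral.integral_interval_sub_left (hint _ _) (hint _ _)]
  rw [this]
  exact (h.comp (by fun_prop : Continuous fun s : ℝ => z + s)).sub
    (h.comp (by fun_prop : Continuous fun s : ℝ => z - s))

lemma popA_eq {h : ℝ} (hh : 0 < h) (z : ℝ) :
    popA (law f) h z = ∫ s in (0 : ℝ)..h, (f (z + s) - f (z - s)) := by
  have hc := hs.continuous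
  rw [popA, hs.law_Ioo (by linarith), hs.law_Ioc (by linarith),
    intervalIntegral.integral_sub (Continuous.intervalIntegrable (by fun_prop) _ _)
      (Continuous.intervalIntegrable (by fun_prop) _ _),
    intervalIntegral.integral_comp_add_left, intervalIntegral.integral_comp_sub_left]
  simp

/-- The score of the smoothed density is at least the infimum of the score over the window. -/
lemma mul_popB_le_popA {h z m : ℝ} (hh : 0 < h)
    (hm : ∀ t ∈ Set.Ioo (z - h) (z + h), 0 < f t → m ≤ ψ t) :
    m * (h * popB (law f) h z) ≤ popA (law f) h z := by
  have hc := hs.continuous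
  rw [hs.mul_popB_eq hh, hs.popA_eq hh, ← intervalIntegral.integral_const_mul]
  refine intervalIntegral.integral_mono_on hh.le
    ((hs.continuous_integral_symm z).const_mul m |>.intervalIntegrable _ _)
    (Continuous.intervalIntegrable (by fun_prop) _ _) fun s hs' => ?_
  exact hs.mul_integral_le _ _ m (by linarith [hs'.1]) fun t ht hft =>
    hm t ⟨by linarith [hs'.2, ht.1], by linarith [hs'.2, ht.2]⟩ hft

lemma popA_le_mul_popB {h z m : ℝ} (hh : 0 < h)
    (hm : ∀ t ∈ Set.Ioo (z - h) (z + h), 0 < f t → ψ t ≤ m) :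
    popA (law f) h z ≤ m * (h * popB (law f) h z) := by
  have hc := hs.continuous
  rw [hs.mul_popB_eq hh, hs.popA_eq hh, ← intervalIntegral.integral_const_mul]
  refine intervalIntegral.integral_mono_on hh.le
    (Continuous.intervalIntegrable (by fun_prop) _ _)
    ((hs.continuous_integral_symm z).const_mul m |>.intervalIntegrable _ _) fun s hs' => ?_
  exact hs.le_mul_integral _ _ m (by linarith [hs'.1]) fun t ht hft =>
    hm t ⟨by linarith [hs'.2, ht.1], by linarith [hs'.2, ht.2]⟩ hft

lemma survival_tendsto : Filter.Tendsto (survival f) Filter.atTop (nhds 0) := by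
  have := hs.isProbabilityMeasure
  have h : Filter.Tendsto (fun x => law f (Set.Ioi x)) Filter.atTop (nhds (law f (⋂ x : ℝ, Set.Ioi x))) := by
    apply tendsto_measure_iInter_atTop
    · exact fun x => measurableSet_Ioi.nullMeasurableSet
    · exact fun x y hxy => Set.Ioi_subset_Ioi hxy
    · exact ⟨0, measure_ne_top _ _⟩
  have he : (⋂ x : ℝ, Set.Ioi x) = ∅ := by
    ext y; simp only [Set.mem_iInter, Set.mem_Ioi, Set.mem_empty_iff_false, iff_false, not_forall]
    exact ⟨y, lt_irrefl y⟩
  rw [he, measure_empty] at h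
  exact (ENNReal.tendsto_toReal ENNReal.zero_ne_top).comp h

lemma survival_antitone : Antitone (survival f) := by
  have := hs.isProbabilityMeasure
  exact fun x y hxy => measureReal_mono (Set.Ioi_subset_Ioi hxy)

/-- The hazard rate dominates the modulus of the score. -/
lemma neg_mul_survival_le {x : ℝ} (hx : 0 < f x) : -ψ x * survival f x ≤ f x := by
  have hlim : Filter.Tendsto (fun y => -ψ x * (survival f x - survival f y)) Filter.atTop
      (nhds (-ψ x * (survival f x - 0))) :=
    (tendsto_const_nhds.sub hs.survival_tendsto).const_mul _
  rw [sub_zero] at hlim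
  refine le_of_tendsto hlim ?_
  filter_upwards [Filter.eventually_ge_atTop x] with y hy
  have := hs.le_mul_integral x y (ψ x) hy fun t ht hft => hs.antitoneOn hx hft ht.1.le
  rw [hs.survival_sub hy]
  linarith [hs.nonneg y]

lemma survival_pos {x : ℝ} (hx : 0 < f x) : 0 < survival f x := by
  have hopen : IsOpen {y | 0 < f y} := isOpen_lt continuous_const hs.continuous
  obtain ⟨r, hr, hball⟩ := Metric.isOpen_iff.1 hopen x hx
  have h1 : 0 < ∫ t in x..(x + r / 2), f t := by
    refine intervalIntegral.intervalIntegral_pos_of_pos_on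
      (hs.continuous.intervalIntegrable _ _) (fun t ht => hball ?_) (by linarith)
    rw [Metric.mem_ball, Real.dist_eq, abs_lt]
    constructor <;> linarith [ht.1, ht.2]
  rw [← hs.survival_sub (by linarith)] at h1
  linarith [survival_nonneg f (x + r / 2)]

end ScorePair

/-- The negative part of the score, set to zero where `f` vanishes. -/
def negScore (f ψ : ℝ → ℝ) (x : ℝ) : ℝ := open Classical in if 0 < f x then max (-ψ x) 0 else 0

/-- The half-width of the confidence band in terms of the expected number of observations. -/
lemma widthV_le {n : ℕ} {ε P q w : ℝ} (hε : 0 < ε) (hε1 : ε ≤ 1 / 100) (hn : 1 / (n : ℝ) ≤ 2.1 * ε)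
    (hq : 0 ≤ q) (hP : P ≤ 8 / 3 * w) (hw : 400 * ε ≤ w)
    (hband : |P - (1 - 2 * ε) * q - ((3 - 4 / n) * ε - 1 / n)| ≤ widthV n ε q) :
    widthV n ε q ≤ 6 * (√(ε / w) * w) := by
  have hw0 : 0 < w := by linarith
  have h1 := (abs_le.1 hband).1
  unfold widthV at *
  set s := √(ε * q + ε ^ 2) with hs
  have hss : s ^ 2 = ε * q + ε ^ 2 := Real.sq_sqrt (by positivity)
  have hs0 : 0 ≤ s := Real.sqrt_nonneg _
  have e1 : (3 - 4 / n) * ε = 3 * ε - 4 * ε * (1 / n) := by ring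
  have e2 : (1 + 4 * ε) / n = 1 / n + 4 * ε * (1 / n) := by ring
  have e3 : 4 * ε * (1 / n) ≤ 4 * ε * (2.1 * ε) := by gcongr
  have e4 : ε * ε ≤ 1 / 100 * ε := by gcongr
  have e5 : 0 ≤ 4 * ε * (1 / n) := by positivity
  -- The arithmetic-geometric mean inequality for 9ε and (q + ε)/4. Inserted in the lower end of the
  -- band, it bounds the empirical probability q by a multiple of w.
  have hs1 : 3 * s ≤ 9 * ε + (q + ε) / 4 := by
    by_contra! hc
    have : (9 * ε + (q + ε) / 4) ^ 2 < (3 * s) ^ 2 := by gcongr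
    nlinarith [sq_nonneg (9 * ε - (q + ε) / 4)]
  have hq1 : q ≤ 3.72 * w := by nlinarith
  have hs2 : s ≤ 1.93 * (√(ε / w) * w) := by
    have e6 : √(ε / w) * w = √(ε * w) := by
      rw [show ε * w = ε / w * w ^ 2 by field_simp, Real.sqrt_mul (by positivity),
        Real.sqrt_sq hw0.le]
    rw [e6, hs, show (1.93 : ℝ) = √(1.93 ^ 2) by rw [Real.sqrt_sq (by norm_num)],
      ← Real.sqrt_mul (by norm_num)]
    apply Real.sqrt_le_sqrt
    nlinarith
  have hu : ε ≤ 1 / 20 * (√(ε / w) * w) := by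
    have : 20 * ε ≤ √(ε / w) * w := by
      have e6 : √(ε / w) * w = √(ε * w) := by
        rw [show ε * w = ε / w * w ^ 2 by field_simp, Real.sqrt_mul (by positivity),
          Real.sqrt_sq hw0.le]
      rw [e6]
      apply Real.le_sqrt_of_sq_le
      nlinarith
    linarith
  rw [e2]
  linarith

/-- The window [x - 2h, x] is the largest of half-width h that reaches x from the left. The first
alternative says that the whole of |ψ x| is within the error bound, which suffices because the
estimator is truncated at 0; the second makes the limit from this window finite, negative and
accurate. The restriction on h enters through the hazard bound, which gives h|ψ x| ≤ 1/8, so that f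
is of the order of f x on the window if the score is negative at x - 2h. -/
lemma ScorePair.pointwise {f ψ : ℝ → ℝ} (hs : ScorePair f ψ) {n : ℕ} {ε : ℝ} (hε : 0 < ε)
    (hε1 : ε ≤ 1 / 100) (hn : 1 / (n : ℝ) ≤ 2.1 * ε) {x h : ℝ} (hx : 0 < f x) (hψ : ψ x < 0)
    (hh : 0 < h) (hsmall : 8 * (h * f x) ≤ survival f x) {q : ℝ} (hq : 0 ≤ q)
    (hband : |(law f).real (Set.Icc (x - 2 * h) x) - (1 - 2 * ε) * q - ((3 - 4 / n) * ε - 1 / n)|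
      ≤ widthV n ε q) :
    -ψ x ≤ negScore f ψ x - negScore f ψ (x - 2 * h) + 50 * (√(ε / (h * f x)) / h) ∨
    (2 * widthV n ε q < popB (law f) h (x - h) ∧
      popA (law f) h (x - h) + 4 * widthV n ε q < 0 ∧
      (popA (law f) h (x - h) + 4 * widthV n ε q) /
        (h * (popB (law f) h (x - h) + 2 * widthV n ε q)) - ψ x ≤
          negScore f ψ x - negScore f ψ (x - 2 * h) + 50 * (√(ε / (h * f x)) / h)) := by
  set w := h * f x with hw
  have hw0 : 0 < w := by positivity
  set g := -ψ x with hg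
  have hg0 : 0 < g := by linarith
  have hgx : negScore f ψ x = g := by rw [negScore, if_pos hx, max_eq_left hg0.le]
  set u := √(ε / w) with hu
  have hu0 : 0 ≤ u := Real.sqrt_nonneg _
  have hS := hs.survival_pos hx
  have hhg : h * g ≤ 1 / 8 := by
    have h1 := hs.neg_mul_survival_le hx
    have h2 : h * (g * survival f x) ≤ w := mul_le_mul_of_nonneg_left h1 hh.le
    by_contra! hc
    nlinarith
  have huh : 0 ≤ u / h := by positivity
  rw [hgx]
  -- With so little mass in the window the deviation term is at least 50/(20h), which exceeds |ψ x|
  -- ≤ 1/(8h).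
  rcases le_or_gt w (400 * ε) with hwε | hwε
  · left
    have hu1 : 1 / 20 ≤ u := by
      apply Real.le_sqrt_of_sq_le
      rw [le_div_iff₀ hw0]; linarith
    have h2 : negScore f ψ (x - 2 * h) ≤ g := by
      unfold negScore
      split_ifs with h0
      · exact max_le (by have := hs.antitoneOn h0 hx (by linarith); linarith) hg0.le
      · exact hg0.le
    have h3 : g ≤ 50 * (u / h) := by
      rw [← mul_div_assoc, le_div_iff₀ hh]; linarith
    linarith
  by_cases hleft : 0 < f (x - 2 * h) ∧ ψ (x - 2 * h) < 0
  swap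
  · left
    have : negScore f ψ (x - 2 * h) = 0 := by
      unfold negScore
      split_ifs with h0
      · rw [max_eq_right]
        have : ¬ ψ (x - 2 * h) < 0 := fun h1 => hleft ⟨h0, h1⟩
        linarith
      · rfl
    rw [this]; linarith
  obtain ⟨hf2, hψ2⟩ := hleft
  have hg2 : negScore f ψ (x - 2 * h) = -ψ (x - 2 * h) := by
    rw [negScore, if_pos hf2, max_eq_left (by linarith)]
  rw [hg2]
  set g2 := -ψ (x - 2 * h) with hg2d
  have hg20 : 0 < g2 := by linarith
  have hg2g : g2 ≤ g := by have := hs.antitoneOn hf2 hx (by linarith); linarith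
  have hlow : ∀ y ∈ Set.Icc (x - 2 * h) x, f x ≤ f y := by
    intro y hy
    have := hs.le_mul_integral y x 0 hy.2 fun t ht hft => by
      have := hs.antitoneOn hf2 hft (hy.1.trans ht.1.le); linarith
    linarith
  set P := (law f).real (Set.Icc (x - 2 * h) x) with hP
  have hPeq : P = ∫ t in (x - 2 * h)..x, f t := hs.law_Icc (by linarith)
  have hup : ∀ y ∈ Set.Icc (x - 2 * h) x, f y ≤ f x + g * P := by
    intro y hy
    have h1 := hs.mul_integral_le y x (ψ x) hy.2 fun t ht hft => hs.antitoneOn hft hx ht.2.le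
    have h2 : ∫ t in y..x, f t ≤ P := by
      rw [hPeq, ← intervalIntegral.integral_add_adjacent_intervals
        (hs.continuous.intervalIntegrable (x - 2 * h) y) (hs.continuous.intervalIntegrable y x)]
      linarith [hs.integral_nonneg' hy.1]
    nlinarith
  -- Integrating f ≤ f x + gP over the window gives P ≤ 2w + 2hgP ≤ 2w + P/4.
  have hP1 : P ≤ 8 / 3 * w := by
    have h1 : P ≤ ∫ t in (x - 2 * h)..x, (f x + g * P) := by
      rw [hPeq]
      refine intervalIntegral.integral_mono_on (by linarith)
        (hs.continuous.intervalIntegrable _ _) (by simp) fun t ht => ?_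
      rw [← hPeq]; exact hup t ht
    rw [intervalIntegral.integral_const, smul_eq_mul] at h1
    have hP0 : 0 ≤ P := measureReal_nonneg
    nlinarith
  have hV := widthV_le hε hε1 hn hq hP1 hwε.le hband
  set V := widthV n ε q with hVd
  have hV0 : 0 ≤ V := by rw [hVd]; unfold widthV; positivity
  set B := popB (law f) h (x - h) with hB
  set A := popA (law f) h (x - h) with hA
  -- The density is at least f x on the window, because the score is negative from x - 2h onwards.
  have hBw : h * w ≤ h * B := by
    rw [hB, hs.mul_popB_eq hh]
    have h1 : ∫ s in (0 : ℝ)..h, 2 * s * f x ≤ ∫ s in (0 : ℝ)..h, ∫ t in (x - h - s)..(x - h + s), f t := by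
      refine intervalIntegral.integral_mono_on hh.le
        (Continuous.intervalIntegrable (by fun_prop) _ _)
        ((hs.continuous_integral_symm (x - h)).intervalIntegrable _ _) fun s hs' => ?_
      have h2 : ∫ t in (x - h - s)..(x - h + s), f x ≤ ∫ t in (x - h - s)..(x - h + s), f t := by
        refine intervalIntegral.integral_mono_on (by linarith [hs'.1]) (by simp)
          (hs.continuous.intervalIntegrable _ _) fun t ht => hlow t ⟨?_, ?_⟩
        · linarith [ht.1, hs'.2]
        · linarith [ht.2, hs'.2]
      rw [intervalIntegral.integral_const, smul_eq_mul] at h2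
      linarith
    have h3 : ∫ s in (0 : ℝ)..h, 2 * s * f x = h * w := by
      rw [intervalIntegral.integral_mul_const, intervalIntegral.integral_const_mul, integral_id, hw]
      ring
    linarith
  have hBw' : w ≤ B := le_of_mul_le_mul_left hBw hh
  have hB0 : 0 < B := hw0.trans_le hBw'
  have hAB : A ≤ -g2 * (h * B) := by
    refine hs.popA_le_mul_popB hh fun t ht hft => ?_
    have := hs.antitoneOn hf2 hft (by linarith [ht.1])
    linarith
  have hVB : V ≤ 6 * u * B := by
    calc V ≤ 6 * u * w := by linarith
      _ ≤ _ := by gcongr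
  have hu20 : u < 1 / 20 := by
    rw [hu, Real.sqrt_lt' (by norm_num), div_lt_iff₀ hw0]; linarith
  have hg2h : h * g2 ≤ 1 / 8 := (mul_le_mul_of_nonneg_left hg2g hh.le).trans hhg
  -- If the numerator cannot be certified negative, then h|ψ(x-2h)| ≤ 24u, so the bias term alone is
  -- already close to |ψ x|.
  rcases le_or_gt 0 (A + 4 * V) with hAV | hAV
  · left
    have h1 : g2 * h * B ≤ 24 * u * B := by linarith
    have h2 : g2 * h ≤ 24 * u := le_of_mul_le_mul_right h1 hB0
    have h3 : g2 ≤ 24 * u / h := by rw [le_div_iff₀ hh]; exact h2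
    rw [mul_div_assoc] at h3
    linarith
  · right
    refine ⟨by nlinarith, hAV, ?_⟩
    have hD : 0 < h * (B + 2 * V) := by positivity
    have key : (A + 4 * V) / (h * (B + 2 * V)) ≤ -g2 + 50 * (u / h) := by
      rw [div_le_iff₀ hD]
      have e : (-g2 + 50 * (u / h)) * (h * (B + 2 * V)) =
        -g2 * (h * B) - 2 * V * (h * g2) + 50 * u * (B + 2 * V) := by
        field_simp; ring
      rw [e]
      nlinarith [mul_nonneg hu0 hV0, mul_le_mul_of_nonneg_left hg2h hV0]
    linarith

end

section

/-! ### The estimator on good samples -/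

variable {n : ℕ} {δ : ℝ} {X : Fin n → ℝ} {f ψ : ℝ → ℝ}

lemma ScorePair.law_reflect_Icc (hs : ScorePair f ψ) {a b : ℝ} (hab : a ≤ b) :
    (law fun x => f (-x)).real (Set.Icc a b) = (law f).real (Set.Icc (-b) (-a)) := by
  rw [hs.reflect.law_Icc hab, hs.law_Icc (neg_le_neg hab), intervalIntegral.integral_comp_neg]

lemma ScorePair.popB_reflect (hs : ScorePair f ψ) {h : ℝ} (hh : 0 < h) (z : ℝ) :
    popB (law fun x => f (-x)) h (-z) = popB (law f) h z := by
  refine intervalIntegral.integral_congr fun t ht => ?_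
  rw [Set.uIcc_of_le zero_le_one] at ht
  have : 0 ≤ t * h := mul_nonneg ht.1 hh.le
  rw [hs.law_reflect_Icc (by linarith)]
  congr 2 <;> ring

lemma ScorePair.popA_reflect (hs : ScorePair f ψ) {h : ℝ} (hh : 0 < h) (z : ℝ) :
    popA (law fun x => f (-x)) h (-z) = -popA (law f) h z := by
  rw [popA, popA, hs.reflect.law_Ioo (by linarith), hs.reflect.law_Ioc (by linarith),
    hs.law_Ioo (by linarith), hs.law_Ioc (by linarith), intervalIntegral.integral_comp_neg,
    intervalIntegral.integral_comp_neg]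
  simp only [neg_neg, neg_add, neg_sub, sub_neg_eq_add]
  rw [← sub_eq_add_neg, add_comm h z]

/-- The confidence limits cover the score on good samples. -/
lemma GoodAt.coverage (hs : ScorePair f ψ) (hg : GoodAt (law f) δ X) (hn : 3 ≤ n) (hδ : 0 < δ)
    (hδ1 : δ < 1) {x : ℝ} (hx : 0 < f x) :
    lowerLimit δ X x ≤ (ψ x : EReal) ∧ (ψ x : EReal) ≤ upperLimit δ X x := by
  have := hs.isProbabilityMeasure
  have hε := epsBand_pos hn hδ hδ1
  rw [lowerLimit_eq hε, upperLimit_eq hε]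
  constructor
  · refine iSup_le fun z => iSup_le fun h => iSup_le fun hh => iSup_le fun hz => ?_
    rw [EReal.neg_le, ← EReal.coe_neg]
    have hA := hg.abs_popA_sub_le hn hδ hδ1 hh z
    have hB := abs_le.1 (hg.abs_popB_sub_le hn hδ hδ1 hh z)
    refine le_ratioUpper (A := -popA (law f) h z) (D := h * popB (law f) h z) ?_ ?_ ?_ ?_
    · rw [bandSlope, ← abs_neg]
      convert hA using 2; ring
    · gcongr; unfold bandCenter; linarith
    · gcongr; unfold bandCenter; linarith
    · have := hs.popA_le_mul_popB (z := z) (m := ψ x) hh fun t ht hft =>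
        hs.antitoneOn hx hft (by linarith [ht.1])
      linarith
  · refine le_iInf fun z => le_iInf fun h => le_iInf fun hh => le_iInf fun hz => ?_
    have hA := hg.abs_popA_sub_le hn hδ hδ1 hh z
    have hB := abs_le.1 (hg.abs_popB_sub_le hn hδ hδ1 hh z)
    refine le_ratioUpper (A := popA (law f) h z) (D := h * popB (law f) h z) ?_ ?_ ?_ ?_
    · rwa [one_mul, bandSlope]
    · gcongr; unfold bandCenter; linarith
    · gcongr; unfold bandCenter; linarith
    · exact hs.mul_popB_le_popA hh fun t ht hft => hs.antitoneOn hft hx (by linarith [ht.2])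

/-- The band is used twice, in the construction of the limit and to bound its random centre, so 2V
and V become 4V and 2V. -/
lemma GoodAt.signedLimit_le (hg : GoodAt (law f) δ X) [IsProbabilityMeasure (law f)]
    (hn : 3 ≤ n) (hδ : 0 < δ) (hδ1 : δ < 1) {h z ω : ℝ} (hh : 0 < h) (hω : ω = 1 ∨ ω = -1)
    (hB : 2 * bandV δ X h z < popB (law f) h z) (hA : ω * popA (law f) h z + 4 * bandV δ X h z < 0) :
    signedLimit δ X h z ω ≤ (((ω * popA (law f) h z + 4 * bandV δ X h z) /
      (h * (popB (law f) h z + 2 * bandV δ X h z)) : ℝ) : EReal) := by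
  have hA' := hg.abs_popA_sub_le hn hδ hδ1 hh z
  have hB' := abs_le.1 (hg.abs_popB_sub_le hn hδ hδ1 hh z)
  have hV := bandV_pos (X := X) (epsBand_pos hn hδ hδ1) h z
  refine ratioUpper_le (A := ω * popA (law f) h z) ?_ ?_ ?_ ?_ hA.le
  · rw [← mul_sub, abs_mul]
    have : |ω| = 1 := by rcases hω with rfl | rfl <;> simp
    rwa [this, one_mul, bandSlope]
  · apply mul_pos hh; unfold bandCenter; linarith
  · exact mul_le_mul_of_nonneg_left (by linarith) hh.le
  · exact mul_le_mul_of_nonneg_left (by unfold bandCenter; linarith) hh.le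

lemma one_div_le_epsBand (hn : 3 ≤ n) (hδ : 0 < δ) (hδ1 : δ < 1) :
    1 / (n : ℝ) ≤ 2.1 * epsBand n δ := by
  have h := log_le_n_mul_epsBand (by omega : 0 < n) hδ hδ1
  have hn0 : (0 : ℝ) < n := by positivity
  have hl3 : 1.09 < Real.log n := by
    have hl2 := Real.log_two_gt_d9
    have h1 : Real.log (2 ^ 19) < Real.log (3 ^ 12) := by
      apply Real.log_lt_log <;> norm_num
    rw [Real.log_pow, Real.log_pow] at h1
    push_cast at h1
    have h2 : Real.log 3 ≤ Real.log n := by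
      apply Real.log_le_log (by norm_num); exact_mod_cast hn
    linarith
  rw [div_le_iff₀ hn0]
  linarith

/-- The error bound, to the right of the mode, for an estimate of the score at `x`. -/
def errorBound (f ψ : ℝ → ℝ) (ε x h : ℝ) : ℝ :=
  negScore f ψ x - negScore f ψ (x - 2 * h) + 50 * (√(ε / (h * f x)) / h)

/-- Coverage makes the lower limit negative, so the estimator is the upper limit truncated at 0. As
an infimum over windows, it inherits the error bound of every admissible bandwidth without having to
choose one. -/
lemma GoodAt.estimator_of_neg (hs : ScorePair f ψ) (hg : GoodAt (law f) δ X) (hn : 3 ≤ n)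
    (hδ : 0 < δ) (hδ1 : δ < 1) {x : ℝ} (hx : 0 < f x) (hψ : ψ x < 0) :
    ∃ e : ℝ, multiscaleEstimator n δ x X = e ∧ ψ x ≤ e ∧ e ≤ 0 ∧
      (epsBand n δ ≤ 1 / 100 → ∀ h, 0 < h → 8 * (h * f x) ≤ survival f x →
        e - ψ x ≤ errorBound f ψ (epsBand n δ) x h) := by
  have hP := hs.isProbabilityMeasure
  have hε := epsBand_pos hn hδ hδ1
  obtain ⟨hlow, hup⟩ := hg.coverage hs hn hδ hδ1 hx
  have hl : ¬ 0 < lowerLimit δ X x :=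
    not_lt.2 (hlow.trans (by exact_mod_cast hψ.le))
  have hest : multiscaleEstimator n δ x X = min (upperLimit δ X x) 0 := by
    rw [multiscaleEstimator, if_neg hl]
    split_ifs with h
    · rw [min_eq_left h.le]
    · rw [min_eq_right (not_lt.1 h)]
  have hle0 : min (upperLimit δ X x) 0 ≤ 0 := min_le_right _ _
  have hge : (ψ x : EReal) ≤ min (upperLimit δ X x) 0 := le_min hup (by exact_mod_cast hψ.le)
  obtain ⟨e, he⟩ : ∃ e : ℝ, min (upperLimit δ X x) 0 = e :=
    ⟨_, (EReal.coe_toReal (fun h => by rw [h] at hle0; simp at hle0)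
      (fun h => by rw [h] at hge; simp at hge)).symm⟩
  rw [he] at hle0 hge
  have he0 : e ≤ 0 := by exact_mod_cast hle0
  refine ⟨e, hest.trans he, by exact_mod_cast hge, he0, fun hε1 h hh hsmall => ?_⟩
  have hband := GoodSample.abs_sub_le hg hn (log_le_n_mul_epsBand (by omega : 0 < n) hδ hδ1)
    (I := Set.Icc (x - 2 * h) x) Set.ordConnected_Icc
  have hV : bandV δ X h (x - h) = widthV n (epsBand n δ)
      ((idxIn X (Set.Icc (x - 2 * h) x)).card / n) := by
    rw [bandV_eq]; (congr 5; ring_nf)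
  rcases hs.pointwise hε hε1 (one_div_le_epsBand hn hδ hδ1) hx hψ hh hsmall (by positivity) hband
    with h1 | ⟨h1, h2, h3⟩
  · unfold errorBound; linarith
  · rw [← hV] at h1 h2 h3
    have h4 := hg.signedLimit_le hn hδ hδ1 hh (Or.inl rfl) h1 (by rwa [one_mul])
    have h5 : upperLimit δ X x ≤ signedLimit δ X h (x - h) 1 := by
      rw [upperLimit_eq hε]
      exact iInf_le_of_le (x - h) (iInf_le_of_le h (iInf_le_of_le hh (iInf_le_of_le (by linarith) le_rfl)))
    rw [one_mul] at h4
    have h6 : (e : EReal) ≤ _ := he ▸ ((min_le_left _ _).trans (h5.trans h4))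
    rw [EReal.coe_le_coe_iff] at h6
    unfold errorBound; linarith

/-- The mirror image of the previous lemma. Only the population quantities are reflected, not the
sample, since the estimator treats ties at a window centre asymmetrically. -/
lemma GoodAt.estimator_of_pos (hs : ScorePair f ψ) (hg : GoodAt (law f) δ X) (hn : 3 ≤ n)
    (hδ : 0 < δ) (hδ1 : δ < 1) {x : ℝ} (hx : 0 < f x) (hψ : 0 < ψ x) :
    ∃ e : ℝ, multiscaleEstimator n δ x X = e ∧ e ≤ ψ x ∧ 0 ≤ e ∧
      (epsBand n δ ≤ 1 / 100 → ∀ h, 0 < h → 8 * (h * f x) ≤ survival (fun y => f (-y)) (-x) →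
        ψ x - e ≤ errorBound (fun y => f (-y)) (fun y => -ψ (-y)) (epsBand n δ) (-x) h) := by
  have hP := hs.isProbabilityMeasure
  have hε := epsBand_pos hn hδ hδ1
  obtain ⟨hlow, hup⟩ := hg.coverage hs hn hδ hδ1 hx
  have hu : ¬ upperLimit δ X x < 0 :=
    not_lt.2 (le_trans (by exact_mod_cast hψ.le) hup)
  have hest : multiscaleEstimator n δ x X = max (lowerLimit δ X x) 0 := by
    rw [multiscaleEstimator, if_neg hu]
    split_ifs with h
    · rw [max_eq_left h.le]
    · rw [max_eq_right (not_lt.1 h)]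
  have hge0 : 0 ≤ max (lowerLimit δ X x) 0 := le_max_right _ _
  have hle : max (lowerLimit δ X x) 0 ≤ (ψ x : EReal) := max_le hlow (by exact_mod_cast hψ.le)
  obtain ⟨e, he⟩ : ∃ e : ℝ, max (lowerLimit δ X x) 0 = e :=
    ⟨_, (EReal.coe_toReal (fun h => by rw [h] at hle; simp at hle)
      (fun h => by rw [h] at hge0; simp at hge0)).symm⟩
  rw [he] at hge0 hle
  have he0 : 0 ≤ e := by exact_mod_cast hge0
  refine ⟨e, hest.trans he, by exact_mod_cast hle, he0, fun hε1 h hh hsmall => ?_⟩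
  have hband := GoodSample.abs_sub_le hg hn (log_le_n_mul_epsBand (by omega : 0 < n) hδ hδ1)
    (I := Set.Icc x (x + 2 * h)) Set.ordConnected_Icc
  have hV : bandV δ X h (x + h) = widthV n (epsBand n δ)
      ((idxIn X (Set.Icc x (x + 2 * h))).card / n) := by
    rw [bandV_eq]; (congr 5; ring_nf)
  have hlaw : (law f).real (Set.Icc x (x + 2 * h)) =
      (law fun y => f (-y)).real (Set.Icc (-x - 2 * h) (-x)) := by
    rw [hs.law_reflect_Icc (by linarith)]; congr 2 <;> ring
  rw [hlaw] at hband
  have hcent : -x - h = -(x + h) := by ring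
  have hpt := hs.reflect.pointwise hε hε1 (one_div_le_epsBand hn hδ hδ1) (x := -x)
    (by simpa using hx) (by simpa using hψ) hh (by simpa using hsmall) (by positivity) hband
  rw [hcent, hs.popA_reflect hh, hs.popB_reflect hh] at hpt
  rcases hpt with h1 | ⟨h1, h2, h3⟩
  · simp only [neg_neg] at h1
    unfold errorBound
    simp only [neg_neg]
    linarith
  · rw [← hV] at h1 h2 h3
    have h4 := hg.signedLimit_le hn hδ hδ1 hh (Or.inr rfl) h1 (by rwa [neg_one_mul])
    have h5 : -signedLimit δ X h (x + h) (-1) ≤ lowerLimit δ X x := by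
      rw [lowerLimit_eq hε]
      exact le_iSup_of_le (x + h) (le_iSup_of_le h (le_iSup_of_le hh (le_iSup_of_le (by linarith) le_rfl)))
    rw [neg_one_mul] at h4
    have h6 : -(e : EReal) ≤ _ :=
      (EReal.neg_le_neg_iff.2 (he ▸ (h5.trans (le_max_left _ _)))).trans
        ((neg_neg (signedLimit δ X h (x + h) (-1))).le.trans h4)
    rw [← EReal.coe_neg, EReal.coe_le_coe_iff] at h6
    simp only [neg_neg] at h3
    unfold errorBound
    simp only [neg_neg]
    linarith

lemma GoodAt.estimator_of_eq_zero (hs : ScorePair f ψ) (hg : GoodAt (law f) δ X) (hn : 3 ≤ n)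
    (hδ : 0 < δ) (hδ1 : δ < 1) {x : ℝ} (hx : 0 < f x) (hψ : ψ x = 0) :
    multiscaleEstimator n δ x X = 0 := by
  obtain ⟨hlow, hup⟩ := hg.coverage hs hn hδ hδ1 hx
  rw [hψ, EReal.coe_zero] at hlow hup
  rw [multiscaleEstimator, if_neg (not_lt.2 hlow), if_neg (not_lt.2 hup)]

end

section

/-! ### The right tail of a log-concave density -/

lemma negScore_nonneg (f ψ : ℝ → ℝ) (x : ℝ) : 0 ≤ negScore f ψ x := by
  unfold negScore
  split_ifs
  exacts [le_max_right _ _, le_rfl]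

lemma negScore_of_pos {f ψ : ℝ → ℝ} {x : ℝ} (hx : 0 < f x) : negScore f ψ x = max (-ψ x) 0 :=
  if_pos hx

namespace ScorePair

variable {f ψ : ℝ → ℝ} (hs : ScorePair f ψ)
include hs

lemma survival_le_one (x : ℝ) : survival f x ≤ 1 := by
  have := hs.isProbabilityMeasure
  exact measureReal_le_one

lemma exists_gt_of_survival_pos {x : ℝ} (hx : 0 < survival f x) : ∃ z, x < z ∧ 0 < f z := by
  by_contra! hc
  have : ∫ t in Set.Ioi x, f t = 0 := by
    rw [setIntegral_congr_fun (g := fun _ => 0) measurableSet_Ioi fun t ht =>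
      le_antisymm (hc t ht) (hs.nonneg t)]
    simp
  rw [survival, hs.law_real_eq measurableSet_Ioi, this] at hx
  exact hx.false

lemma pos_of_survival_pos {x y : ℝ} (hx : 0 < f x) (hxy : x ≤ y) (hy : 0 < survival f y) :
    0 < f y := by
  obtain ⟨z, hz, hfz⟩ := hs.exists_gt_of_survival_pos hy
  exact hs.ordConnected.out hx hfz ⟨hxy, hz.le⟩

lemma negScore_le {x y : ℝ} (hxy : x ≤ y) (hy : 0 < survival f y) :
    negScore f ψ x ≤ negScore f ψ y := by
  by_cases hx : 0 < f x
  · have hfy := hs.pos_of_survival_pos hx hxy hy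
    rw [negScore_of_pos hx, negScore_of_pos hfy]
    exact max_le_max_right _ (neg_le_neg (hs.antitoneOn hx hfy hxy))
  · rw [negScore, if_neg hx]
    exact negScore_nonneg _ _ _

lemma continuous_survival : Continuous (survival f) := by
  have : survival f = fun x => survival f 0 - ∫ t in (0 : ℝ)..x, f t := by
    funext x
    rcases le_total 0 x with h | h
    · rw [← hs.survival_sub h]; ring
    · rw [intervalIntegral.integral_symm, ← hs.survival_sub h]; ring
  rw [this]
  exact continuous_const.sub
    (intervalIntegral.continuous_primitive (fun s t => hs.continuous.intervalIntegrable s t) 0)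

lemma exists_survival_eq {x v : ℝ} (hv : 0 < v) (hvx : v ≤ survival f x) :
    ∃ y, x ≤ y ∧ survival f y = v := by
  obtain ⟨b, hb, hxb⟩ := ((hs.survival_tendsto.eventually (gt_mem_nhds hv)).and
    (Filter.eventually_ge_atTop x)).exists
  obtain ⟨y, hy, hyv⟩ := intermediate_value_Icc' hxb hs.continuous_survival.continuousOn
    (show v ∈ Set.Icc (survival f b) (survival f x) from ⟨hb.le, hvx⟩)
  exact ⟨y, hy.1, hyv⟩

lemma antitone_right {x y : ℝ} (hx : 0 < f x) (hψ : ψ x ≤ 0) (hxy : x ≤ y) : f y ≤ f x := by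
  have := hs.le_mul_integral x y 0 hxy fun t ht hft => (hs.antitoneOn hx hft ht.1.le).trans hψ
  linarith

lemma sub_le_negScore_mul {x y : ℝ} (hy : 0 < f y) (hxy : x ≤ y) :
    f x - f y ≤ negScore f ψ y * (survival f x - survival f y) := by
  have h1 := hs.mul_integral_le x y (ψ y) hxy fun t ht hft => hs.antitoneOn hft hy ht.2.le
  have h2 := hs.integral_nonneg' hxy
  rw [hs.survival_sub hxy, negScore_of_pos hy]
  nlinarith [le_max_left (-ψ y) 0]

lemma negScore_mul_survival_le {x : ℝ} (hx : 0 < f x) : negScore f ψ x * survival f x ≤ f x := by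
  rw [negScore_of_pos hx, max_mul_of_nonneg _ _ (survival_nonneg f x), zero_mul]
  exact max_le (hs.neg_mul_survival_le hx) hx.le

/-- To the right of the mode f decreases and is integrable, so it falls to c/2 at some z; as f z >
0, a positive tail mass remains beyond z to serve as threshold. -/
lemma exists_density_lt {x c : ℝ} (hx : 0 < f x) (hψ : ψ x ≤ 0) (hc : 0 < c) :
    ∃ v, 0 < v ∧ ∀ y, x ≤ y → survival f y ≤ v → f y < c := by
  rcases lt_or_ge (f x) c with hfc | hfc
  · exact ⟨1, one_pos, fun y hxy _ => (hs.antitone_right hx hψ hxy).trans_lt hfc⟩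
  have hb : ∃ b, x ≤ b ∧ f b ≤ c / 2 := by
    by_contra! hcon
    have h1 : ∫ t in x..(x + 4 / c), c / 2 ≤ ∫ t in x..(x + 4 / c), f t :=
      intervalIntegral.integral_mono_on (by have : 0 < 4 / c := by positivity
                                            linarith) (by simp)
        (hs.continuous.intervalIntegrable _ _) fun t ht => (hcon t ht.1).le
    rw [← hs.survival_sub (by have : 0 < 4 / c := by positivity
                              linarith), intervalIntegral.integral_const, smul_eq_mul] at h1
    have h2 : (x + 4 / c - x) * (c / 2) = 2 := by field_simp; ring
    rw [h2] at h1
    linarith [survival_nonneg f (x + 4 / c), hs.survival_le_one x]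
  obtain ⟨b, hxb, hfb⟩ := hb
  obtain ⟨z, hz, hfz⟩ := intermediate_value_Icc' hxb hs.continuous.continuousOn
    (show c / 2 ∈ Set.Icc (f b) (f x) from ⟨hfb, by linarith⟩)
  have hz0 : 0 < f z := by rw [hfz]; linarith
  have hSz := hs.survival_pos hz0
  refine ⟨survival f z / 2, by linarith, fun y hxy hy => ?_⟩
  have hzy : z ≤ y := by
    by_contra! hcon
    have := hs.survival_antitone hcon.le
    linarith
  have := hs.antitone_right hz0 ((hs.antitoneOn hx hz0 hz.1).trans hψ) hzy
  linarith

/-- A bound for the negative score in terms of the survival function entails a bound for the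
density. -/
lemma density_le {G : ℝ → ℝ} (hG : ∀ v, 0 < v → G (v / 4) ≤ 2 * G v)
    (hgG : ∀ y, 0 < f y → negScore f ψ y ≤ G (survival f y)) {x : ℝ} (hx : 0 < f x)
    (hψ : ψ x ≤ 0) : f x ≤ 3 * (survival f x * G (survival f x)) := by
  have hS := hs.survival_pos hx
  set S := survival f x with hSd
  have hGj : ∀ j : ℕ, G (S / 4 ^ j) ≤ 2 ^ j * G S := by
    intro j
    induction j with
    | zero => simp
    | succ j ih =>
      have := hG (S / 4 ^ j) (by positivity)
      rw [pow_succ, ← div_div, pow_succ]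
      linarith
  -- Between the levels S/4^j and S/4^(j+1) the density drops by at most the largest score, 2^(j+1)
  -- G S, times the mass (3/4) S/4^j. These drops form a geometric series with sum 3 S G(S), and the
  -- density left over tends to zero.
  have hstep : ∀ j : ℕ, ∃ y, x ≤ y ∧ survival f y = S / 4 ^ j ∧
      f x ≤ f y + 3 * (1 - (1 / 2) ^ j) * (S * G S) := by
    intro j
    induction j with
    | zero => exact ⟨x, le_rfl, by simp [hSd], by simp⟩
    | succ j ih =>
      obtain ⟨y, hxy, hSy, hfy⟩ := ih
      have hpos : 0 < S / 4 ^ (j + 1) := by positivity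
      obtain ⟨z, hyz, hSz⟩ := hs.exists_survival_eq hpos
        (show S / 4 ^ (j + 1) ≤ survival f y by
          rw [hSy]; gcongr <;> norm_num)
      have hxz := hxy.trans hyz
      have hfz := hs.pos_of_survival_pos hx hxz (hSz ▸ hpos)
      refine ⟨z, hxz, hSz, ?_⟩
      have h1 := hs.sub_le_negScore_mul hfz hyz
      have h2 := (hgG z hfz).trans (hSz ▸ hGj (j + 1))
      have h3 : survival f y - survival f z = 3 / 4 * (S / 4 ^ j) := by
        rw [hSy, hSz, pow_succ]; field_simp; norm_num
      rw [h3] at h1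
      have h4 : negScore f ψ z * (3 / 4 * (S / 4 ^ j)) ≤
          2 ^ (j + 1) * G S * (3 / 4 * (S / 4 ^ j)) :=
        mul_le_mul_of_nonneg_right h2 (by positivity)
      have h5 : 2 ^ (j + 1) * G S * (3 / 4 * (S / 4 ^ j)) = 3 * (1 / 2) ^ (j + 1) * (S * G S) := by
        have : (4 : ℝ) ^ j = 2 ^ j * 2 ^ j := by rw [← mul_pow]; norm_num
        rw [this, pow_succ, pow_succ, one_div, inv_pow]
        field_simp; ring
      have h6 : ((1 : ℝ) / 2) ^ (j + 1) = (1 / 2) ^ j / 2 := by rw [pow_succ]; ring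
      rw [h5, h6] at h4
      rw [h6]
      linarith
  have hSG : 0 ≤ S * G S :=
    mul_nonneg hS.le ((negScore_nonneg f ψ x).trans (hgG x hx))
  by_contra! hcon
  obtain ⟨v, hv, hlt⟩ := hs.exists_density_lt hx hψ (sub_pos.2 hcon)
  obtain ⟨j, hj⟩ := exists_pow_lt_of_lt_one (show 0 < v / S by positivity)
    (show (1 / 4 : ℝ) < 1 by norm_num)
  obtain ⟨y, hxy, hSy, hfy⟩ := hstep j
  have h1 := hlt y hxy (by
    rw [hSy, div_eq_mul_inv, ← inv_pow, mul_comm]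
    rw [lt_div_iff₀ hS] at hj
    simpa using hj.le)
  have h2 : 0 ≤ ((1 : ℝ) / 2) ^ j * (S * G S) := by positivity
  linarith

lemma law_survival_le (q : ℝ) : law f {x | survival f x ≤ q} ≤ ENNReal.ofReal q := by
  have hP := hs.isProbabilityMeasure
  have hT : IsClosed {x | survival f x ≤ q} := isClosed_le hs.continuous_survival continuous_const
  have hbd : ∀ n : ℕ, law f ({x | survival f x ≤ q} ∩ Set.Ici (-(n : ℝ))) ≤ ENNReal.ofReal q := by
    intro n
    rcases ({x | survival f x ≤ q} ∩ Set.Ici (-(n : ℝ))).eq_empty_or_nonempty with he | hne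
    · rw [he]; simp
    have hb : BddBelow ({x | survival f x ≤ q} ∩ Set.Ici (-(n : ℝ))) := ⟨-n, fun x hx => hx.2⟩
    have hmem := (hT.inter isClosed_Ici).csInf_mem hne hb
    set a := sInf ({x | survival f x ≤ q} ∩ Set.Ici (-(n : ℝ)))
    have h1 : law f (Set.Ici a) = law f (Set.Ioi a) := by
      have : NullSingletonClass (law f) := by unfold law; infer_instance
      exact (measure_congr Ioi_ae_eq_Ici).symm
    calc _ ≤ law f (Set.Ici a) := measure_mono fun x hx => csInf_le hb hx
      _ = ENNReal.ofReal (survival f a) := by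
        rw [h1, survival, Measure.real, ENNReal.ofReal_toReal (measure_ne_top _ _)]
      _ ≤ _ := ENNReal.ofReal_le_ofReal hmem.1
  have hU : {x | survival f x ≤ q} = ⋃ n : ℕ, {x | survival f x ≤ q} ∩ Set.Ici (-(n : ℝ)) := by
    rw [← Set.inter_iUnion]
    refine (Set.inter_eq_left.2 fun x _ => ?_).symm
    obtain ⟨n, hn⟩ := exists_nat_ge (-x)
    exact Set.mem_iUnion.2 ⟨n, by simp only [Set.mem_Ici]; linarith⟩
  rw [hU, Monotone.measure_iUnion]
  · exact iSup_le hbd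
  · intro m n hmn
    refine Set.inter_subset_inter_right _ (Set.Ici_subset_Ici.2 ?_)
    have : (m : ℝ) ≤ n := by exact_mod_cast hmn
    linarith

end ScorePair

/-- The total increment over steps of length `a` of a bounded monotone function. -/
lemma lintegral_monotone_sub_le {g : ℝ → ℝ} (hg : Monotone g) {M a : ℝ} (ha : 0 ≤ a)
    (hg0 : ∀ x, 0 ≤ g x) (hgM : ∀ x, g x ≤ M) :
    ∫⁻ x, ENNReal.ofReal (g x - g (x - a)) ≤ ENNReal.ofReal (a * M) := by
  have hga : Monotone fun x => g (x - a) := fun x y hxy => hg (by linarith)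
  have hint : ∀ s t, IntervalIntegrable g volume s t := fun s t => hg.intervalIntegrable
  have hcov : AECover volume Filter.atTop fun n : ℕ => Set.Ioc (-(n : ℝ)) n :=
    aecover_Ioc (Filter.tendsto_neg_atTop_atBot.comp tendsto_natCast_atTop_atTop)
      tendsto_natCast_atTop_atTop
  refine le_of_tendsto (hcov.lintegral_tendsto_of_countably_generated
    (hg.measurable.sub hga.measurable).ennreal_ofReal.aemeasurable) (Filter.Eventually.of_forall
    fun n => ?_)
  have hn : -(n : ℝ) ≤ n := by have : (0 : ℝ) ≤ n := by positivity
                               linarith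
  have hint' : IntervalIntegrable (fun x => g x - g (x - a)) volume (-(n : ℝ)) n :=
    (hint _ _).sub hga.intervalIntegrable
  rw [← ofReal_integral_eq_lintegral_ofReal ((intervalIntegrable_iff_integrableOn_Ioc_of_le hn).1 hint')
    (ae_of_all _ fun x => sub_nonneg.2 (hg (by linarith))),
    ← intervalIntegral.integral_of_le hn]
  refine ENNReal.ofReal_le_ofReal ?_
  -- After the shift only two end strips of length a survive, and the left one has the favourable
  -- sign.
  rw [intervalIntegral.integral_sub (hint _ _) hga.intervalIntegrable,
    intervalIntegral.integral_comp_sub_right (fun x => g x) a,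
    intervalIntegral.integral_interval_sub_interval_comm (hint _ _) (hint _ _) (hint _ _)]
  have h1 : 0 ≤ ∫ x in (-(n : ℝ) - a)..(-(n : ℝ)), g x :=
    intervalIntegral.integral_nonneg (by linarith) fun x _ => hg0 x
  have h2 : ∫ x in ((n : ℝ) - a)..n, g x ≤ ∫ x in ((n : ℝ) - a)..n, M :=
    intervalIntegral.integral_mono_on (by linarith) (hint _ _) (by simp) fun x _ => hgM x
  rw [intervalIntegral.integral_const, smul_eq_mul] at h2
  rw [intervalIntegral.integral_symm (-(n : ℝ) - a), intervalIntegral.integral_symm ((n : ℝ) - a)]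
  linarith

end

section

/-! ### The squared error on a block of quantile levels -/

/-- Optimising over dyadic bandwidths an error bound made of a bias and a deviation. -/
lemma sq_le_of_multiscale {e s M : ℝ} {b : ℕ → ℝ} {J : ℕ} (hs : 0 < s) (hb : ∀ j, 0 ≤ b j)
    (he : 0 ≤ e) (heM : e ≤ M) (hM : M < 2 * s * 8 ^ J) (h : ∀ j, e ≤ b j + 8 ^ j * s) :
    e ^ 2 ≤ 4 * s ^ 2 + ∑ j ∈ Finset.range J, 32 * (8 ^ j * s) * b j := by
  have hsum : ∀ j ∈ Finset.range J, 0 ≤ 32 * (8 ^ j * s) * b j := fun j _ =>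
    mul_nonneg (by positivity) (hb j)
  rcases le_or_gt e (2 * s) with h2 | h2
  · have := Finset.sum_nonneg hsum
    nlinarith
  -- At the scale i with 2s 8^i ≤ e < 2s 8^(i+1) the deviation is at most e/2, so e ≤ 2 b i.
  -- Multiplying by e ≤ 16 · 8^i s gives a bound linear in the bias, which can then be integrated.
  obtain ⟨i, hi1, hi2⟩ := exists_nat_pow_near (x := e / (2 * s)) (y := 8)
    (by rw [le_div_iff₀ (by positivity)]; linarith) (by norm_num)
  rw [le_div_iff₀ (by positivity)] at hi1
  rw [div_lt_iff₀ (by positivity)] at hi2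
  have hiJ : i < J := by
    have h3 : (8 : ℝ) ^ i * (2 * s) < 8 ^ J * (2 * s) := by linarith
    exact (pow_lt_pow_iff_right₀ (by norm_num : (1 : ℝ) < 8)).1
      (lt_of_mul_lt_mul_right h3 (by positivity))
  have h4 := Finset.single_le_sum hsum (Finset.mem_range.2 hiJ)
  have h5 := h i
  rw [pow_succ] at hi2
  have h6 : e * e ≤ (16 * (8 ^ i * s)) * (2 * b i) := by
    apply mul_le_mul <;> nlinarith [hb i]
  nlinarith [sq_nonneg s]

/-- The sum of 2^j is of order 2^J, whose cube is 8^J; hence J scales reach the level M at a cost of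
order (M/s)^(1/3). -/
lemma exists_scale_count {s M : ℝ} (hs : 0 < s) (hM : 0 ≤ M) :
    ∃ J : ℕ, M < 2 * s * 8 ^ J ∧ s * (∑ j ∈ Finset.range J, (2 : ℝ) ^ j) ^ 3 ≤ 4 * M := by
  rcases lt_or_ge M (2 * s) with h | h
  · exact ⟨0, by simpa using h, by simp [hM]⟩
  obtain ⟨i, hi1, hi2⟩ := exists_nat_pow_near (x := M / (2 * s)) (y := 8)
    (by rw [le_div_iff₀ (by positivity)]; linarith) (by norm_num)
  rw [le_div_iff₀ (by positivity)] at hi1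
  rw [div_lt_iff₀ (by positivity)] at hi2
  refine ⟨i + 1, by linarith, ?_⟩
  have h1 : ∑ j ∈ Finset.range (i + 1), (2 : ℝ) ^ j ≤ 2 * 2 ^ i := by
    rw [geom_sum_eq (by norm_num), pow_succ]; norm_num; linarith
  have h2 : (∑ j ∈ Finset.range (i + 1), (2 : ℝ) ^ j) ^ 3 ≤ (2 * 2 ^ i) ^ 3 := by gcongr
  have h3 : ((2 : ℝ) * 2 ^ i) ^ 3 = 8 * 8 ^ i := by
    rw [mul_pow, ← pow_mul, mul_comm i, pow_mul]; norm_num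
  rw [h3] at h2
  nlinarith

/-- The points to the right of the mode with upper tail probability in `(q / 2, q]`. -/
def block (f ψ : ℝ → ℝ) (q : ℝ) : Set ℝ :=
  {x | 0 < f x ∧ ψ x < 0 ∧ q / 2 < survival f x ∧ survival f x ≤ q}

namespace ScorePair

variable {f ψ : ℝ → ℝ} (hs : ScorePair f ψ)
include hs

lemma measurableSet_block (q : ℝ) : MeasurableSet (block f ψ q) := by
  have : (block f ψ q).OrdConnected := ⟨fun x hx y hy z hz => by
    have hfz : 0 < f z := hs.ordConnected.out hx.1 hy.1 hz
    exact ⟨hfz, (hs.antitoneOn hx.1 hfz hz.1).trans_lt hx.2.1,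
      hy.2.2.1.trans_le (hs.survival_antitone hz.2), (hs.survival_antitone hz.1).trans hx.2.2.2⟩⟩
  exact this.measurableSet

lemma lintegral_block_le (q : ℝ) :
    ∫⁻ x in block f ψ q, ENNReal.ofReal (f x) ≤ ENNReal.ofReal q := by
  rw [← withDensity_apply _ (hs.measurableSet_block q)]
  exact (measure_mono fun x hx => hx.2.2.2).trans (hs.law_survival_le q)

/-- Across the block the density drops by at most |ψ y| times a mass not exceeding the upper tail at
y, hence by at most f y by the hazard bound. -/
lemma le_two_mul_of_mem_block {q x y : ℝ} (hx : x ∈ block f ψ q) (hy : y ∈ block f ψ q) :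
    f x ≤ 2 * f y := by
  rcases le_total x y with h | h
  · have h1 := hs.sub_le_negScore_mul hy.1 h
    have h2 := hs.negScore_mul_survival_le hy.1
    have h3 : survival f x - survival f y ≤ survival f y := by
      linarith [hx.2.2.2, hy.2.2.1]
    have := mul_le_mul_of_nonneg_left h3 (negScore_nonneg f ψ y)
    linarith
  · have := hs.antitone_right hy.1 hy.2.1.le h
    linarith [hy.1]

/-- Here ρ³q plays the role of ε. With h j of order q/(f₀ 4^j) the deviation scales as h^(-3/2),
that is as 8^j, and the integrated bias as 4^(-j), so scale j contributes q s N 2^j. The sum stops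
near s 8^J = N, which leaves q s N (N/s)^(1/3), and s is at most of order ρ^(3/2) N because f₀ is at
most of order qN. -/
lemma lintegral_sq_block_le {q N ρ : ℝ} (hq : 0 < q) (hN : 0 < N) (hρ : 0 < ρ) (hρ1 : ρ ≤ 1)
    (hg : ∀ x, q / 2 < survival f x → negScore f ψ x ≤ 2 * N)
    (hf : ∀ x ∈ block f ψ q, f x ≤ 6 * (q * N)) {E : ℝ → ℝ}
    (hE : ∀ x ∈ block f ψ q, 0 ≤ E x ∧ E x ≤ negScore f ψ x ∧
      ∀ h, 0 < h → 8 * (h * f x) ≤ survival f x → E x ≤ errorBound f ψ (ρ ^ 3 * q) x h) :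
    ∫⁻ x in block f ψ q, ENNReal.ofReal (E x ^ 2 * f x) ≤
      ENNReal.ofReal (10 ^ 11 * (q * N ^ 2 * ρ)) := by
  rcases (block f ψ q).eq_empty_or_nonempty with he | ⟨x₀, hx₀⟩
  · rw [he]; simp
  set f₀ := f x₀ with hf₀
  have hf₀0 : 0 < f₀ := hx₀.1
  set s := 12800 * √(ρ ^ 3) * f₀ / q with hsd
  have hs0 : 0 < s := by positivity
  obtain ⟨J, hJ1, hJ2⟩ := exists_scale_count hs0 (M := 2 * N) (by positivity)
  set h : ℕ → ℝ := fun j => q / (32 * f₀) / 4 ^ j with hh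
  have hh0 : ∀ j, 0 < h j := fun j => by positivity
  -- A monotone extension of the negative score from the region up to the end of the block, bounded
  -- by 2N on the whole line, so that its increments can be integrated over the line.
  set g : ℝ → ℝ := fun x => if q / 2 < survival f x then negScore f ψ x else 2 * N with hgd
  have hgmono : Monotone g := by
    intro x y hxy
    have hS := hs.survival_antitone hxy
    simp only [hgd]
    split_ifs with h1 h2 h2
    · exact hs.negScore_le hxy (by linarith)
    · exact hg x h1
    · exact absurd (h2.trans_le hS) h1
    · exact le_rfl
  have hgnonneg : ∀ x, 0 ≤ g x := fun x => by
    simp only [hgd]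
    split_ifs
    exacts [negScore_nonneg _ _ _, by positivity]
  have hgle : ∀ x, g x ≤ 2 * N := fun x => by
    simp only [hgd]
    split_ifs with h1
    exacts [hg x h1, le_rfl]
  have hpt : ∀ x ∈ block f ψ q, ENNReal.ofReal (E x ^ 2 * f x) ≤
      ENNReal.ofReal (4 * s ^ 2) * ENNReal.ofReal (f x) +
      ∑ j ∈ Finset.range J, ENNReal.ofReal (64 * f₀ * (8 ^ j * s)) *
        ENNReal.ofReal (g x - g (x - 2 * h j)) := by
    intro x hx
    obtain ⟨hE0, hEg, hEh⟩ := hE x hx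
    have hfx := hx.1
    have hx2 := hs.le_two_mul_of_mem_block hx hx₀
    have hx3 := hs.le_two_mul_of_mem_block hx₀ hx
    have hb : ∀ j, 0 ≤ g x - g (x - 2 * h j) := fun j =>
      sub_nonneg.2 (hgmono (by linarith [hh0 j]))
    have hgx : g x = negScore f ψ x := if_pos hx.2.2.1
    have hgx' : ∀ j, g (x - 2 * h j) = negScore f ψ (x - 2 * h j) := fun j =>
      if_pos (hx.2.2.1.trans_le (hs.survival_antitone (by linarith [hh0 j])))
    have hjb : ∀ j, E x ≤ (g x - g (x - 2 * h j)) + 8 ^ j * s := by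
      intro j
      have hhf : h j * f₀ = q / (32 * 4 ^ j) := by simp only [hh]; field_simp
      have hsmall : 8 * (h j * f x) ≤ survival f x := by
        have h1 : h j * f x ≤ h j * (2 * f₀) := mul_le_mul_of_nonneg_left hx2 (hh0 j).le
        have h2 : q / (32 * 4 ^ j) ≤ q / 32 := by
          apply div_le_div_of_nonneg_left hq.le (by norm_num)
          have : (1 : ℝ) ≤ 4 ^ j := one_le_pow₀ (by norm_num)
          linarith
        linarith [hx.2.2.1]
      have h1 := hEh (h j) (hh0 j) hsmall
      have h2 : √(ρ ^ 3 * q / (h j * f x)) ≤ √(ρ ^ 3) * (8 * 2 ^ j) := by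
        rw [← Real.sqrt_sq (show (0 : ℝ) ≤ 8 * 2 ^ j by positivity), ← Real.sqrt_mul (by positivity)]
        apply Real.sqrt_le_sqrt
        rw [div_le_iff₀ (mul_pos (hh0 j) hfx)]
        have h3 : h j * f₀ ≤ h j * (2 * f x) := mul_le_mul_of_nonneg_left hx3 (hh0 j).le
        have h4 : ((8 : ℝ) * 2 ^ j) ^ 2 = 64 * 4 ^ j := by
          rw [mul_pow, ← pow_mul, mul_comm j, pow_mul]; norm_num
        have h5 : q = 32 * 4 ^ j * (h j * f₀) := by rw [hhf]; field_simp
        rw [h4]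
        calc ρ ^ 3 * q = ρ ^ 3 * (32 * 4 ^ j * (h j * f₀)) := by rw [← h5]
          _ ≤ ρ ^ 3 * (32 * 4 ^ j * (h j * (2 * f x))) := by gcongr
          _ = _ := by ring
      have h3 : 50 * (√(ρ ^ 3 * q / (h j * f x)) / h j) ≤ 8 ^ j * s := by
        calc 50 * (√(ρ ^ 3 * q / (h j * f x)) / h j)
            ≤ 50 * ((√(ρ ^ 3) * (8 * 2 ^ j)) / h j) := by
              have := hh0 j
              gcongr
          _ = 8 ^ j * s := by
            simp only [hh, hsd]
            rw [show (8 : ℝ) = 2 * 4 by norm_num, mul_pow]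
            field_simp; norm_num
      rw [hgx, hgx']
      unfold errorBound at h1
      linarith
    have hkey := sq_le_of_multiscale hs0 hb hE0 (hEg.trans (hg x hx.2.2.1)) hJ1 hjb
    have hfin : E x ^ 2 * f x ≤ 4 * s ^ 2 * f x + ∑ j ∈ Finset.range J,
        64 * f₀ * (8 ^ j * s) * (g x - g (x - 2 * h j)) := by
      have h1 := mul_le_mul_of_nonneg_right hkey hfx.le
      rw [add_mul, Finset.sum_mul] at h1
      refine h1.trans (add_le_add le_rfl (Finset.sum_le_sum fun j _ => ?_))
      have h2 : 0 ≤ 32 * (8 ^ j * s) * (g x - g (x - 2 * h j)) :=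
        mul_nonneg (by positivity) (hb j)
      calc _ ≤ 32 * (8 ^ j * s) * (g x - g (x - 2 * h j)) * (2 * f₀) :=
            mul_le_mul_of_nonneg_left hx2 h2
        _ = _ := by ring
    refine (ENNReal.ofReal_le_ofReal hfin).trans ?_
    rw [ENNReal.ofReal_add (by positivity) (Finset.sum_nonneg fun j _ =>
      mul_nonneg (by positivity) (hb j)), ENNReal.ofReal_sum_of_nonneg (fun j _ =>
      mul_nonneg (by positivity) (hb j)), ENNReal.ofReal_mul (by positivity)]
    gcongr with j _
    rw [ENNReal.ofReal_mul (by positivity)]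
  have hcont := hs.continuous
  have hmeas : ∀ j, Measurable fun x => ENNReal.ofReal (g x - g (x - 2 * h j)) := fun j =>
    (hgmono.measurable.sub (hgmono.measurable.comp (measurable_id.sub_const _))).ennreal_ofReal
  refine (setLIntegral_mono' (hs.measurableSet_block q) hpt).trans ?_
  rw [lintegral_add_left (by fun_prop), lintegral_const_mul _ (by fun_prop),
    lintegral_finsetSum _ fun j _ => (hmeas j).const_mul _]
  simp_rw [lintegral_const_mul _ (hmeas _)]
  have hterm : ∀ j, ENNReal.ofReal (64 * f₀ * (8 ^ j * s)) *
      ∫⁻ x in block f ψ q, ENNReal.ofReal (g x - g (x - 2 * h j)) ≤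
      ENNReal.ofReal (4 * q * (s * (2 * N)) * 2 ^ j) := by
    intro j
    have h1 : ∫⁻ x in block f ψ q, ENNReal.ofReal (g x - g (x - 2 * h j)) ≤
        ENNReal.ofReal (2 * h j * (2 * N)) :=
      (setLIntegral_le_lintegral _ _).trans
        (lintegral_monotone_sub_le hgmono (by linarith [hh0 j]) hgnonneg hgle)
    refine (mul_le_mul_right h1 _).trans (le_of_eq ?_)
    rw [← ENNReal.ofReal_mul (by positivity)]
    congr 1
    simp only [hh]
    rw [show (8 : ℝ) = 2 * 4 by norm_num, mul_pow]
    field_simp; norm_num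
  refine (add_le_add (mul_le_mul_right (hs.lintegral_block_le q) _)
    (Finset.sum_le_sum fun j _ => hterm j)).trans ?_
  rw [← ENNReal.ofReal_sum_of_nonneg (fun j _ => by positivity), ← Finset.mul_sum,
    ← ENNReal.ofReal_mul (by positivity), ← ENNReal.ofReal_add (by positivity)
      (mul_nonneg (by positivity) (Finset.sum_nonneg fun j _ => by positivity))]
  refine ENNReal.ofReal_le_ofReal ?_
  set Y := ∑ j ∈ Finset.range J, (2 : ℝ) ^ j with hY
  have hY0 : 0 ≤ Y := Finset.sum_nonneg fun j _ => by positivity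
  have hs2 : s ^ 2 ≤ 5898240000 * ρ ^ 3 * N ^ 2 := by
    have h1 : s ^ 2 = 163840000 * ρ ^ 3 * (f₀ / q) ^ 2 := by
      rw [hsd, div_pow, mul_pow, mul_pow, Real.sq_sqrt (by positivity)]; ring
    have h2 : f₀ / q ≤ 6 * N := by rw [div_le_iff₀ hq]; linarith [hf x₀ hx₀]
    rw [h1]
    calc _ ≤ 163840000 * ρ ^ 3 * (6 * N) ^ 2 := by gcongr
      _ = _ := by ring
  -- Cubing isolates s Y³, which `exists_scale_count` bounds by 8N, and avoids fractional powers.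
  have hX : s * (2 * N) * Y ≤ 8000 * (ρ * N ^ 2) := by
    refine le_of_pow_le_pow_left₀ (n := 3) (by norm_num) (by positivity) ?_
    calc (s * (2 * N) * Y) ^ 3 = s ^ 2 * (2 * N) ^ 3 * (s * Y ^ 3) := by ring
      _ ≤ (5898240000 * ρ ^ 3 * N ^ 2) * (2 * N) ^ 3 * (4 * (2 * N)) := by gcongr
      _ = 377487360000 * (ρ ^ 3 * N ^ 6) := by ring
      _ ≤ 512000000000 * (ρ ^ 3 * N ^ 6) := by gcongr; norm_num
      _ = _ := by ring
  have hs3 : s ^ 2 ≤ 5898240000 * (ρ * N ^ 2) := by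
    have : ρ ^ 3 ≤ ρ := by
      calc ρ ^ 3 = ρ * (ρ * ρ) := by ring
        _ ≤ ρ * (1 * 1) := by gcongr
        _ = ρ := by ring
    calc _ ≤ _ := hs2
      _ ≤ 5898240000 * ρ * N ^ 2 := by gcongr
      _ = _ := by ring
  have hρN : 0 ≤ ρ * N ^ 2 := by positivity
  calc 4 * s ^ 2 * q + 4 * q * (s * (2 * N)) * Y = q * (4 * s ^ 2 + 4 * (s * (2 * N) * Y)) := by ring
    _ ≤ q * (10 ^ 11 * (ρ * N ^ 2)) := mul_le_mul_of_nonneg_left (by linarith) hq.le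
    _ = _ := by ring

end ScorePair

end

section

/-! ### Sums over dyadic quantile levels -/

lemma sum_range_le_telescope {u v : ℕ → ℝ} (n : ℕ) (h : ∀ k, u k ≤ v (k + 1) - v k) :
    ∑ k ∈ Finset.range n, u k ≤ v n - v 0 :=
  (Finset.sum_le_sum fun k _ => h k).trans (Finset.sum_range_sub v n).le

lemma rpow_neg_le_sub {a y : ℝ} (ha : 0 < a) (hy : 1 ≤ y) :
    y ^ (-a) ≤ (1 - (2 : ℝ) ^ (-a))⁻¹ * (min 1 (y ^ (-a)) - min 1 ((2 * y) ^ (-a))) := by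
  have h2 : (2 : ℝ) ^ (-a) < 1 := Real.rpow_lt_one_of_one_lt_of_neg (by norm_num) (by linarith)
  rw [min_eq_right (Real.rpow_le_one_of_one_le_of_nonpos hy (by linarith)),
    min_eq_right (Real.rpow_le_one_of_one_le_of_nonpos (by linarith) (by linarith)),
    Real.mul_rpow (by norm_num) (by linarith), inv_mul_eq_div, le_div_iff₀ (by linarith)]
  linarith

lemma rpow_le_sub {b y : ℝ} (hb : 0 < b) (hy0 : 0 < y) (hy : y ≤ 1) :
    y ^ b ≤ (1 - (2 : ℝ) ^ (-b))⁻¹ * (min 1 (y ^ b) - min 1 ((y / 2) ^ b)) := by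
  have h2 : (2 : ℝ) ^ (-b) < 1 := Real.rpow_lt_one_of_one_lt_of_neg (by norm_num) (by linarith)
  rw [min_eq_right (Real.rpow_le_one hy0.le hy hb.le),
    min_eq_right (Real.rpow_le_one (by linarith) (by linarith) hb.le),
    div_eq_mul_inv, Real.mul_rpow hy0.le (by norm_num), Real.inv_rpow (by norm_num),
    ← Real.rpow_neg (by norm_num), inv_mul_eq_div, le_div_iff₀ (by linarith)]
  linarith

/-- Along y = x 2^k the terms decay geometrically on both sides of y = 1. Writing each as an
increment of a bounded sequence gives a bound uniform in x. -/
lemma sum_min_rpow_le {a b : ℝ} (ha : 0 < a) (hb : 0 < b) :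
    ∃ C : ℝ, 0 < C ∧ ∀ x : ℝ, 0 < x → ∀ n : ℕ,
      ∑ k ∈ Finset.range n, min ((x * 2 ^ k) ^ (-a)) ((x * 2 ^ k) ^ b) ≤ C := by
  have h2a : (2 : ℝ) ^ (-a) < 1 := Real.rpow_lt_one_of_one_lt_of_neg (by norm_num) (by linarith)
  have h2b : (2 : ℝ) ^ (-b) < 1 := Real.rpow_lt_one_of_one_lt_of_neg (by norm_num) (by linarith)
  set A := (1 - (2 : ℝ) ^ (-a))⁻¹ with hA
  set B := (1 - (2 : ℝ) ^ (-b))⁻¹ with hB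
  have hA0 : 0 < A := inv_pos.2 (by linarith)
  have hB0 : 0 < B := inv_pos.2 (by linarith)
  refine ⟨A + B, by positivity, fun x hx n => ?_⟩
  set v : ℕ → ℝ := fun k => B * min 1 ((x * 2 ^ k / 2) ^ b) - A * min 1 ((x * 2 ^ k) ^ (-a)) with hv
  have hmin : ∀ {t p : ℝ}, 0 < t → 0 ≤ min 1 (t ^ p) := fun ht =>
    le_min zero_le_one (Real.rpow_nonneg ht.le _)
  refine (sum_range_le_telescope (v := v) n fun k => ?_).trans ?_
  · have hy : 0 < x * 2 ^ k := by positivity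
    have e1 : x * 2 ^ (k + 1) / 2 = x * 2 ^ k := by ring
    have e2 : x * 2 ^ (k + 1) = 2 * (x * 2 ^ k) := by ring
    simp only [hv]
    rw [e1, e2]
    set y := x * 2 ^ k
    have m1 : min 1 ((y / 2) ^ b) ≤ min 1 (y ^ b) :=
      min_le_min_left _ (Real.rpow_le_rpow (by positivity) (by linarith) hb.le)
    have m2 : min 1 ((2 * y) ^ (-a)) ≤ min 1 (y ^ (-a)) :=
      min_le_min_left _ (Real.rpow_le_rpow_of_nonpos hy (by linarith) (by linarith))
    have n1 := mul_nonneg hB0.le (sub_nonneg.2 m1)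
    have n2 := mul_nonneg hA0.le (sub_nonneg.2 m2)
    rcases le_total 1 y with h | h
    · have := rpow_neg_le_sub ha h
      rw [← hA] at this
      have := (min_le_left (y ^ (-a)) (y ^ b)).trans this
      linarith
    · have := rpow_le_sub hb hy h
      rw [← hB] at this
      have := (min_le_right (y ^ (-a)) (y ^ b)).trans this
      linarith
  · simp only [hv]
    have i1 : B * min 1 ((x * 2 ^ n / 2) ^ b) ≤ B * 1 :=
      mul_le_mul_of_nonneg_left (min_le_left _ _) hB0.le
    have i2 : 0 ≤ B * min 1 ((x * 2 ^ 0 / 2) ^ b) := mul_nonneg hB0.le (hmin (by positivity))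
    have i3 : A * min 1 ((x * 2 ^ 0) ^ (-a)) ≤ A * 1 :=
      mul_le_mul_of_nonneg_left (min_le_left _ _) hA0.le
    have i4 : 0 ≤ A * min 1 ((x * 2 ^ n) ^ (-a)) := mul_nonneg hA0.le (hmin (by positivity))
    rw [mul_one] at i1 i3
    calc _ ≤ (B - 0) - (0 - A) := sub_le_sub (sub_le_sub i1 i4) (sub_le_sub i2 i3)
      _ = _ := by ring

/-- Of order log(1/x) terms have x 2^k ≤ 1 and count for one each; the others form a geometric
series. -/
lemma sum_min_one_rpow_le {a : ℝ} (ha : 0 < a) :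
    ∃ C : ℝ, 0 < C ∧ ∀ x : ℝ, 0 < x → ∀ n : ℕ,
      ∑ k ∈ Finset.range n, min 1 ((x * 2 ^ k) ^ (-a)) ≤ C * logPlus (1 / x) := by
  have h2a : (2 : ℝ) ^ (-a) < 1 := Real.rpow_lt_one_of_one_lt_of_neg (by norm_num) (by linarith)
  set A := (1 - (2 : ℝ) ^ (-a))⁻¹ with hA
  have hA0 : 0 < A := inv_pos.2 (by linarith)
  have hl2 : 0 < Real.log 2 := Real.log_pos (by norm_num)
  have hl2' : Real.log 2 ≤ 1 := by linarith [Real.log_two_lt_d9]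
  refine ⟨A + 2 * (Real.log 2)⁻¹, by positivity, fun x hx n => ?_⟩
  set v : ℕ → ℝ := fun k => (Real.log 2)⁻¹ * min 0 (Real.log (x * 2 ^ k / 2)) -
    A * min 1 ((x * 2 ^ k) ^ (-a)) with hv
  refine (sum_range_le_telescope (v := v) n fun k => ?_).trans ?_
  · have hy : 0 < x * 2 ^ k := by positivity
    have e1 : x * 2 ^ (k + 1) / 2 = x * 2 ^ k := by ring
    have e2 : x * 2 ^ (k + 1) = 2 * (x * 2 ^ k) := by ring
    simp only [hv]
    rw [e1, e2]
    set y := x * 2 ^ k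
    have m1 : min 0 (Real.log (y / 2)) ≤ min 0 (Real.log y) :=
      min_le_min_left _ (Real.log_le_log (by positivity) (by linarith))
    have m2 : min 1 ((2 * y) ^ (-a)) ≤ min 1 (y ^ (-a)) :=
      min_le_min_left _ (Real.rpow_le_rpow_of_nonpos hy (by linarith) (by linarith))
    have n1 := mul_nonneg (inv_pos.2 hl2).le (sub_nonneg.2 m1)
    have n2 := mul_nonneg hA0.le (sub_nonneg.2 m2)
    rcases le_total 1 y with h | h
    · have := rpow_neg_le_sub ha h
      rw [← hA] at this
      have := (min_le_right 1 (y ^ (-a))).trans this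
      linarith
    · have h3 : (Real.log 2)⁻¹ * (min 0 (Real.log y) - min 0 (Real.log (y / 2))) = 1 := by
        rw [min_eq_right (Real.log_nonpos hy.le h),
          min_eq_right (Real.log_nonpos (by linarith) (by linarith)),
          Real.log_div hy.ne' (by norm_num), sub_sub_cancel, inv_mul_cancel₀ hl2.ne']
      have := min_le_left 1 (y ^ (-a))
      linarith
  · simp only [hv]
    have hℓ : 1 ≤ logPlus (1 / x) := le_max_left _ _
    have hℓ' : -Real.log x ≤ logPlus (1 / x) := by
      rw [← Real.log_inv, ← one_div]; exact le_max_right _ _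
    have i1 : (Real.log 2)⁻¹ * min 0 (Real.log (x * 2 ^ n / 2)) ≤ 0 :=
      mul_nonpos_of_nonneg_of_nonpos (inv_pos.2 hl2).le (min_le_left _ _)
    have i2 : -(2 * logPlus (1 / x)) ≤ min 0 (Real.log (x * 2 ^ 0 / 2)) := by
      refine le_min (by linarith) ?_
      rw [pow_zero, mul_one, Real.log_div hx.ne' (by norm_num)]
      linarith
    have i2' := mul_le_mul_of_nonneg_left i2 (inv_pos.2 hl2).le
    have i3 : A * min 1 ((x * 2 ^ 0) ^ (-a)) ≤ A * logPlus (1 / x) :=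
      mul_le_mul_of_nonneg_left ((min_le_left _ _).trans hℓ) hA0.le
    have i4 : 0 ≤ A * min 1 ((x * 2 ^ n) ^ (-a)) :=
      mul_nonneg hA0.le (le_min zero_le_one (Real.rpow_nonneg (by positivity) _))
    linarith

/-- The rate of convergence, before truncation at one and multiplication by `min r (L ^ 2)`. -/
def rate (γ L r ε : ℝ) : ℝ :=
  (L ^ (2 / γ) / min r (L ^ 2) ^ (1 / γ) * ε) ^ min γ (1 / 3) *
    logPlus (1 / ε) ^ (if γ = 1 / 3 then 1 else 0 : ℕ)

lemma scale_rpow {γ L s : ℝ} (hγ : 0 < γ) (hL : 0 < L) (hs : 0 < s) :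
    (L ^ (2 / γ) / s ^ (1 / γ)) ^ γ = L ^ 2 / s := by
  rw [Real.div_rpow (by positivity) (by positivity), ← Real.rpow_mul hL.le, ← Real.rpow_mul hs.le,
    div_mul_cancel₀ _ hγ.ne', div_mul_cancel₀ _ hγ.ne', Real.rpow_one, Real.rpow_two]

lemma min_le_four_mul_min {L r t : ℝ} (hr : 0 ≤ r) (ht : t ≤ 1) :
    min (4 * L ^ 2 * t) r ≤ 4 * min (L ^ 2 * t) (min r (L ^ 2)) := by
  have hL : 0 ≤ L ^ 2 := sq_nonneg L
  rw [mul_min_of_nonneg _ _ (by norm_num), mul_min_of_nonneg _ _ (by norm_num)]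
  refine le_min (by linarith [min_le_left (4 * L ^ 2 * t) r]) (le_min ?_ ?_)
  · linarith [min_le_right (4 * L ^ 2 * t) r]
  · have := mul_le_mul_of_nonneg_left ht hL
    linarith [min_le_left (4 * L ^ 2 * t) r]

/-- The sum is over levels q = 2^(-k). For γ < 1/3 the levels near q = ε dominate, and the cap r can
be dropped. For γ = 1/3 all levels between ε and 1 count equally, hence the logarithm. For γ > 1/3
the dominant level is q = 1/a, where L² q^γ equals min(r, L²). -/
lemma sum_block_bound_le {γ : ℝ} (hγ : 0 < γ) :
    ∃ C : ℝ, 0 < C ∧ ∀ L r ε : ℝ, 0 < L → 0 < r → 0 < ε → ∀ n : ℕ,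
      ∑ k ∈ Finset.range n, min (4 * L ^ 2 * (1 / 2 ^ k) ^ γ) r *
        min 1 ((ε * 2 ^ k) ^ (1 / 3 : ℝ)) ≤ C * (min r (L ^ 2) * rate γ L r ε) := by
  have hq1 : ∀ k : ℕ, ((1 : ℝ) / 2 ^ k) ^ γ ≤ 1 := fun k =>
    Real.rpow_le_one (by positivity) (by
      rw [div_le_one (by positivity)]; exact one_le_pow₀ (by norm_num)) hγ.le
  have hsmall : γ ≤ 1 / 3 → ∀ L r ε : ℝ, 0 < L → 0 < r → 0 < ε →
      min r (L ^ 2) * rate γ L r ε =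
        L ^ 2 * ε ^ γ * logPlus (1 / ε) ^ (if γ = 1 / 3 then 1 else 0 : ℕ) ∧
      ∀ k : ℕ, min (4 * L ^ 2 * (1 / 2 ^ k) ^ γ) r * min 1 ((ε * 2 ^ k) ^ (1 / 3 : ℝ)) ≤
        4 * (L ^ 2 * ε ^ γ) * min ((ε * 2 ^ k) ^ (-γ)) ((ε * 2 ^ k) ^ (1 / 3 - γ)) := by
    intro h3 L r ε hL hr hε
    have hb : 0 < min r (L ^ 2) := lt_min hr (by positivity)
    refine ⟨?_, fun k => ?_⟩
    · rw [rate, min_eq_left h3, Real.mul_rpow (by positivity) hε.le, scale_rpow hγ hL hb]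
      field_simp
    · have hy : 0 < ε * 2 ^ k := by positivity
      have e1 : ((1 : ℝ) / 2 ^ k) ^ γ = ε ^ γ * (ε * 2 ^ k) ^ (-γ) := by
        rw [Real.rpow_neg hy.le, ← Real.inv_rpow hy.le, ← Real.mul_rpow hε.le (by positivity)]
        congr 1; field_simp
      have e2 : (ε * 2 ^ k) ^ (1 / 3 - γ) = (ε * 2 ^ k) ^ (-γ) * (ε * 2 ^ k) ^ (1 / 3 : ℝ) := by
        rw [← Real.rpow_add hy]; congr 1; ring
      have e3 : min ((ε * 2 ^ k) ^ (-γ)) ((ε * 2 ^ k) ^ (1 / 3 - γ)) =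
          (ε * 2 ^ k) ^ (-γ) * min 1 ((ε * 2 ^ k) ^ (1 / 3 : ℝ)) := by
        rw [e2, mul_min_of_nonneg _ _ (Real.rpow_nonneg hy.le _), mul_one]
      calc _ ≤ 4 * L ^ 2 * (1 / 2 ^ k) ^ γ * min 1 ((ε * 2 ^ k) ^ (1 / 3 : ℝ)) := by
            gcongr
            exact min_le_left _ _
        _ = _ := by rw [e1, e3]; ring
  rcases lt_trichotomy γ (1 / 3) with h | h | h
  · obtain ⟨C, hC, hsum⟩ := sum_min_rpow_le hγ (sub_pos.2 h)
    refine ⟨4 * C, by positivity, fun L r ε hL hr hε n => ?_⟩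
    obtain ⟨h1, h2⟩ := hsmall h.le L r ε hL hr hε
    rw [h1, if_neg h.ne, pow_zero, mul_one]
    refine (Finset.sum_le_sum fun k _ => h2 k).trans ?_
    rw [← Finset.mul_sum]
    have := mul_le_mul_of_nonneg_left (hsum ε hε n) (show 0 ≤ 4 * (L ^ 2 * ε ^ γ) by positivity)
    linarith
  · obtain ⟨C, hC, hsum⟩ := sum_min_one_rpow_le hγ
    refine ⟨4 * C, by positivity, fun L r ε hL hr hε n => ?_⟩
    obtain ⟨h1, h2⟩ := hsmall h.le L r ε hL hr hε
    rw [h1, if_pos h, pow_one]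
    refine (Finset.sum_le_sum fun k _ => h2 k).trans ?_
    have e : (1 : ℝ) / 3 - γ = 0 := by linarith
    simp_rw [e, Real.rpow_zero]
    rw [← Finset.mul_sum]
    simp_rw [min_comm _ (1 : ℝ)]
    have := mul_le_mul_of_nonneg_left (hsum ε hε n) (show 0 ≤ 4 * (L ^ 2 * ε ^ γ) by positivity)
    linarith
  · obtain ⟨C, hC, hsum⟩ := sum_min_rpow_le (sub_pos.2 h) (show (0 : ℝ) < 1 / 3 by norm_num)
    refine ⟨4 * C, by positivity, fun L r ε hL hr hε n => ?_⟩
    have hb : 0 < min r (L ^ 2) := lt_min hr (by positivity)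
    rw [rate, min_eq_right h.le, if_neg h.ne', pow_zero, mul_one]
    have hsc := scale_rpow hγ hL hb
    set b := min r (L ^ 2) with hbd
    set a := L ^ (2 / γ) / b ^ (1 / γ) with had
    have ha : 0 < a := by positivity
    have hterm : ∀ k : ℕ, min (4 * L ^ 2 * (1 / 2 ^ k) ^ γ) r *
        min 1 ((ε * 2 ^ k) ^ (1 / 3 : ℝ)) ≤ 4 * (b * (a * ε) ^ (1 / 3 : ℝ)) *
          min ((a⁻¹ * 2 ^ k) ^ (-(γ - 1 / 3))) ((a⁻¹ * 2 ^ k) ^ (1 / 3 : ℝ)) := by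
      intro k
      have hy : 0 < a⁻¹ * 2 ^ k := by positivity
      have e1 : L ^ 2 * (1 / 2 ^ k) ^ γ = b * (a⁻¹ * 2 ^ k) ^ (-γ) := by
        have : L ^ 2 = b * a ^ γ := by rw [hsc]; field_simp
        rw [this, Real.rpow_neg hy.le, ← Real.inv_rpow hy.le, mul_assoc,
          ← Real.mul_rpow ha.le (by positivity)]
        congr 2; field_simp
      have e2 : (ε * 2 ^ k) ^ (1 / 3 : ℝ) = (a * ε) ^ (1 / 3 : ℝ) * (a⁻¹ * 2 ^ k) ^ (1 / 3 : ℝ) := by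
        rw [← Real.mul_rpow (by positivity) hy.le]; congr 1; field_simp
      have e3 : min ((a⁻¹ * 2 ^ k) ^ (-(γ - 1 / 3))) ((a⁻¹ * 2 ^ k) ^ (1 / 3 : ℝ)) =
          min ((a⁻¹ * 2 ^ k) ^ (-γ)) 1 * (a⁻¹ * 2 ^ k) ^ (1 / 3 : ℝ) := by
        rw [min_mul_of_nonneg _ _ (Real.rpow_nonneg hy.le _), one_mul, ← Real.rpow_add hy]
        congr 2; ring
      have e4 := min_le_four_mul_min (L := L) hr.le (hq1 k)
      rw [← hbd, e1] at e4
      calc _ ≤ 4 * min (b * (a⁻¹ * 2 ^ k) ^ (-γ)) b * (ε * 2 ^ k) ^ (1 / 3 : ℝ) := by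
            refine mul_le_mul e4 (min_le_right _ _) (le_min zero_le_one (by positivity))
              (by positivity)
        _ = _ := by
            rw [e2, e3, show min (b * (a⁻¹ * 2 ^ k) ^ (-γ)) b = b * min ((a⁻¹ * 2 ^ k) ^ (-γ)) 1 by
              rw [mul_min_of_nonneg _ _ hb.le, mul_one]]
            ring
    refine (Finset.sum_le_sum fun k _ => hterm k).trans ?_
    rw [← Finset.mul_sum]
    have := mul_le_mul_of_nonneg_left (hsum a⁻¹ (inv_pos.2 ha) n)
      (show 0 ≤ 4 * (b * (a * ε) ^ (1 / 3 : ℝ)) by positivity)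
    linarith

lemma sum_half_rpow_le {γ : ℝ} (hγ : 0 < γ) (n : ℕ) :
    ∑ k ∈ Finset.range n, ((1 : ℝ) / 2 ^ k) ^ γ ≤ (1 - (2 : ℝ) ^ (-γ))⁻¹ := by
  have h2 : (2 : ℝ) ^ (-γ) < 1 := Real.rpow_lt_one_of_one_lt_of_neg (by norm_num) (by linarith)
  have h0 : 0 < (2 : ℝ) ^ (-γ) := by positivity
  have e : ∀ k : ℕ, ((1 : ℝ) / 2 ^ k) ^ γ = ((2 : ℝ) ^ (-γ)) ^ k := by
    intro k
    rw [Real.rpow_neg (by norm_num), ← Real.inv_rpow (by norm_num), one_div, ← inv_pow,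
      ← Real.rpow_pow_comm (by norm_num)]
  simp_rw [e]
  rw [← tsum_geometric_of_lt_one h0.le h2]
  exact (summable_geometric_of_lt_one h0.le h2).sum_le_tsum _ fun k _ => by positivity

end

section

/-! ### The loss to the right of the mode -/

/-- The tail-growth condition, as a bound for the score. -/
def ScoreTail (f ψ : ℝ → ℝ) (γ L : ℝ) : Prop :=
  ∀ x, 0 < f x → |ψ x| ≤ L / min (1 - survival f x) (survival f x) ^ ((1 - γ) / 2)

/-- The points to the right of the mode. -/
def rightRegion (f ψ : ℝ → ℝ) : Set ℝ := {x | 0 < f x ∧ ψ x < 0}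

/-- An upper bound for the negative score at a point with upper tail probability `v`. -/
def scoreEnvelope (γ L r v : ℝ) : ℝ := min (2 * L * v ^ (-((1 - γ) / 2))) √(r / v)

lemma scoreEnvelope_pos {γ L r v : ℝ} (hL : 0 < L) (hr : 0 < r) (hv : 0 < v) :
    0 < scoreEnvelope γ L r v :=
  lt_min (by positivity) (by positivity)

lemma scoreEnvelope_anti {γ L r v w : ℝ} (hγ' : γ ≤ 1) (hL : 0 < L) (hr : 0 < r) (hv : 0 < v)
    (hvw : v ≤ w) : scoreEnvelope γ L r w ≤ scoreEnvelope γ L r v := by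
  refine min_le_min ?_ ?_
  · exact mul_le_mul_of_nonneg_left (Real.rpow_le_rpow_of_nonpos hv hvw (by linarith))
      (by positivity)
  · exact Real.sqrt_le_sqrt (div_le_div_of_nonneg_left hr.le hv hvw)

/-- Both envelopes grow at most like v^(-1/2) as v decreases. This is the doubling condition
required by `ScorePair.density_le`. -/
lemma scoreEnvelope_quarter_le {γ L r v : ℝ} (hγ : 0 < γ) (hL : 0 < L) (hv : 0 < v) :
    scoreEnvelope γ L r (v / 4) ≤ 2 * scoreEnvelope γ L r v := by
  unfold scoreEnvelope
  rw [mul_min_of_nonneg _ _ (by norm_num)]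
  refine min_le_min ?_ ?_
  · have h1 : (4 : ℝ) ^ ((1 - γ) / 2) ≤ 2 := by
      calc (4 : ℝ) ^ ((1 - γ) / 2) ≤ 4 ^ (1 / 2 : ℝ) :=
            Real.rpow_le_rpow_of_exponent_le (by norm_num) (by linarith)
        _ = 2 := by
          rw [← Real.sqrt_eq_rpow, show (4 : ℝ) = 2 ^ 2 by norm_num, Real.sqrt_sq (by norm_num)]
    have h2 : (v / 4) ^ (-((1 - γ) / 2)) = v ^ (-((1 - γ) / 2)) * 4 ^ ((1 - γ) / 2) := by
      rw [Real.div_rpow hv.le (by norm_num), Real.rpow_neg (by norm_num : (0 : ℝ) ≤ 4), div_inv_eq_mul]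
    rw [h2]
    calc _ ≤ 2 * L * (v ^ (-((1 - γ) / 2)) * 2) := by gcongr
      _ = _ := by ring
  · have : r / (v / 4) = 2 ^ 2 * (r / v) := by field_simp; norm_num
    rw [this, Real.sqrt_mul (by norm_num), Real.sqrt_sq (by norm_num)]

lemma mul_scoreEnvelope_sq_le {γ L r v : ℝ} (hL : 0 < L) (hr : 0 < r) (hv : 0 < v) :
    v * scoreEnvelope γ L r v ^ 2 ≤ min (4 * L ^ 2 * v ^ γ) r := by
  have h0 := (scoreEnvelope_pos (γ := γ) hL hr hv).le
  refine le_min ?_ ?_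
  · calc v * scoreEnvelope γ L r v ^ 2 ≤ v * (2 * L * v ^ (-((1 - γ) / 2))) ^ 2 := by
          gcongr
          exact min_le_left _ _
      _ = 4 * L ^ 2 * (v ^ (1 : ℝ) * v ^ (-((1 - γ) / 2) * 2)) := by
          rw [Real.rpow_mul hv.le, Real.rpow_two, Real.rpow_one]; ring
      _ = _ := by
          rw [← Real.rpow_add hv]; congr 2; ring
  · calc v * scoreEnvelope γ L r v ^ 2 ≤ v * √(r / v) ^ 2 := by
          gcongr
          exact min_le_right _ _
      _ = r := by rw [Real.sq_sqrt (by positivity)]; field_simp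

namespace ScorePair

variable {f ψ : ℝ → ℝ} (hs : ScorePair f ψ) {γ L r : ℝ}
include hs

/-- When the upper tail exceeds 1/2, the tail condition involves the lower tail instead;
monotonicity then bounds the negative score by its value at the median, which costs the factor 2. -/
lemma negScore_le_rpow (ht : ScoreTail f ψ γ L) (hγ : 0 < γ) (hγ' : γ ≤ 1) (hL : 0 < L) {x : ℝ}
    (hx : 0 < f x) : negScore f ψ x ≤ 2 * L * survival f x ^ (-((1 - γ) / 2)) := by
  have hS := hs.survival_pos hx
  have hp : 0 ≤ (1 - γ) / 2 := by linarith
  have habs : ∀ y, 0 < f y → negScore f ψ y ≤ |ψ y| := fun y hy => by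
    rw [negScore_of_pos hy]; exact max_le (neg_le_abs _) (abs_nonneg _)
  rcases le_or_gt (survival f x) (1 / 2) with h | h
  · have h1 := (habs x hx).trans (ht x hx)
    rw [min_eq_right (by linarith), div_eq_mul_inv, ← Real.rpow_neg hS.le] at h1
    have : 0 ≤ L * survival f x ^ (-((1 - γ) / 2)) := by positivity
    linarith
  · obtain ⟨y, hxy, hSy⟩ := hs.exists_survival_eq (show (0 : ℝ) < 1 / 2 by norm_num) h.le
    have hSy0 : 0 < survival f y := by rw [hSy]; norm_num
    have hfy := hs.pos_of_survival_pos hx hxy hSy0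
    have h1 := (hs.negScore_le hxy hSy0).trans ((habs y hfy).trans (ht y hfy))
    rw [hSy, min_eq_right (by norm_num), one_div, Real.inv_rpow (by norm_num), div_inv_eq_mul] at h1
    have h2 : (2 : ℝ) ^ ((1 - γ) / 2) ≤ 2 ^ (1 : ℝ) :=
      Real.rpow_le_rpow_of_exponent_le (by norm_num) (by linarith)
    rw [Real.rpow_one] at h2
    have h3 : 1 ≤ survival f x ^ (-((1 - γ) / 2)) :=
      Real.one_le_rpow_of_pos_of_le_one_of_nonpos hS (hs.survival_le_one x) (by linarith)
    calc _ ≤ L * 2 ^ ((1 - γ) / 2) := h1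
      _ ≤ L * 2 := by gcongr
      _ = 2 * L * 1 := by ring
      _ ≤ _ := by gcongr

/-- The negative score increases to the right, so its square at x times the mass beyond x is at most
the Fisher information. -/
lemma negScore_le_sqrt (hr : ∫⁻ x, ENNReal.ofReal (ψ x ^ 2 * f x) ≤ ENNReal.ofReal r)
    (hr0 : 0 < r) {x : ℝ} (hx : 0 < f x) : negScore f ψ x ≤ √(r / survival f x) := by
  have hS := hs.survival_pos hx
  have hP := hs.isProbabilityMeasure
  have hc := hs.continuous
  have hg0 := negScore_nonneg f ψ x
  apply Real.le_sqrt_of_sq_le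
  rw [le_div_iff₀ hS]
  rw [← ENNReal.ofReal_le_ofReal_iff hr0.le]
  refine le_trans ?_ hr
  have h1 : ENNReal.ofReal (survival f x) = ∫⁻ t in Set.Ioi x, ENNReal.ofReal (f t) := by
    rw [survival, Measure.real, ENNReal.ofReal_toReal (measure_ne_top _ _), law,
      withDensity_apply _ measurableSet_Ioi]
  rw [ENNReal.ofReal_mul (by positivity), h1, ← lintegral_const_mul _ (by fun_prop)]
  refine (setLIntegral_mono' measurableSet_Ioi fun t ht => ?_).trans (setLIntegral_le_lintegral _ _)
  rw [← ENNReal.ofReal_mul (by positivity)]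
  refine ENNReal.ofReal_le_ofReal ?_
  rcases (hs.nonneg t).eq_or_lt with h0 | h0
  · rw [← h0]; simp
  refine mul_le_mul_of_nonneg_right ?_ h0.le
  have h2 := hs.negScore_le (le_of_lt ht) (hs.survival_pos h0)
  have h3 : negScore f ψ t ^ 2 ≤ ψ t ^ 2 := by
    rw [negScore_of_pos h0]
    rcases le_total (-ψ t) 0 with h | h
    · rw [max_eq_right h, zero_pow two_ne_zero]; exact sq_nonneg _
    · rw [max_eq_left h, neg_sq]
  exact (pow_le_pow_left₀ hg0 h2 2).trans h3

lemma negScore_le_scoreEnvelope (ht : ScoreTail f ψ γ L)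
    (hr : ∫⁻ x, ENNReal.ofReal (ψ x ^ 2 * f x) ≤ ENNReal.ofReal r) (hγ : 0 < γ) (hγ' : γ ≤ 1)
    (hL : 0 < L) (hr0 : 0 < r) {x : ℝ} (hx : 0 < f x) :
    negScore f ψ x ≤ scoreEnvelope γ L r (survival f x) :=
  le_min (hs.negScore_le_rpow ht hγ hγ' hL hx) (hs.negScore_le_sqrt hr hr0 hx)

lemma measurableSet_rightRegion : MeasurableSet (rightRegion f ψ) := by
  have : (rightRegion f ψ).OrdConnected := ⟨fun x hx y hy z hz => by
    have hfz : 0 < f z := hs.ordConnected.out hx.1 hy.1 hz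
    exact ⟨hfz, (hs.antitoneOn hx.1 hfz hz.1).trans_lt hx.2⟩⟩
  exact this.measurableSet

lemma lintegral_rightRegion_le_of_blocks {F : ℝ → ℝ≥0∞} {c : ℕ → ℝ} {C : ℝ} (hc : ∀ k, 0 ≤ c k)
    (hblock : ∀ k : ℕ, ∫⁻ x in block f ψ (1 / 2 ^ k), F x ≤ ENNReal.ofReal (c k))
    (hC : ∀ n, ∑ k ∈ Finset.range n, c k ≤ C) :
    ∫⁻ x in rightRegion f ψ, F x ≤ ENNReal.ofReal C := by
  have hsub : rightRegion f ψ ⊆ ⋃ k : ℕ, block f ψ (1 / 2 ^ k) := by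
    intro x hx
    have hS := hs.survival_pos hx.1
    obtain ⟨k, hk1, hk2⟩ := exists_nat_pow_near_of_lt_one hS (hs.survival_le_one x)
      (show (0 : ℝ) < 1 / 2 by norm_num) (by norm_num)
    rw [div_pow, one_pow] at hk1 hk2
    refine Set.mem_iUnion.2 ⟨k, hx.1, hx.2, ?_, hk2⟩
    rw [pow_succ] at hk1
    calc (1 : ℝ) / 2 ^ k / 2 = 1 / (2 ^ k * 2) := by rw [div_div]
      _ < _ := hk1
  refine (lintegral_mono_set hsub).trans ((lintegral_iUnion_le _ _).trans ?_)
  refine (ENNReal.tsum_le_tsum hblock).trans (ENNReal.tsum_le_of_sum_range_le fun n => ?_)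
  rw [← ENNReal.ofReal_sum_of_nonneg fun k _ => hc k]
  exact ENNReal.ofReal_le_ofReal (hC n)

lemma lintegral_block_le_of_le_negScore {q N : ℝ} {E : ℝ → ℝ}
    (hg : ∀ x ∈ block f ψ q, negScore f ψ x ≤ 2 * N)
    (hE : ∀ x ∈ block f ψ q, 0 ≤ E x ∧ E x ≤ negScore f ψ x) :
    ∫⁻ x in block f ψ q, ENNReal.ofReal (E x ^ 2 * f x) ≤ ENNReal.ofReal (4 * (q * N ^ 2)) := by
  have hc := hs.continuous
  calc _ ≤ ∫⁻ x in block f ψ q, ENNReal.ofReal (4 * N ^ 2) * ENNReal.ofReal (f x) := by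
        refine setLIntegral_mono' (hs.measurableSet_block q) fun x hx => ?_
        rw [← ENNReal.ofReal_mul (by positivity)]
        refine ENNReal.ofReal_le_ofReal (mul_le_mul_of_nonneg_right ?_ (hs.nonneg x))
        obtain ⟨h1, h2⟩ := hE x hx
        calc E x ^ 2 ≤ (2 * N) ^ 2 := pow_le_pow_left₀ h1 (h2.trans (hg x hx)) 2
          _ = _ := by ring
    _ ≤ ENNReal.ofReal (4 * N ^ 2) * ENNReal.ofReal q := by
        rw [lintegral_const_mul _ (by fun_prop)]
        exact mul_le_mul_right (hs.lintegral_block_le q) _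
    _ = _ := by
        rw [← ENNReal.ofReal_mul (by positivity)]; congr 1; ring

/-- A bound for the loss that does not use the accuracy of the estimator. -/
lemma lintegral_rightRegion_le_sq (ht : ScoreTail f ψ γ L) (hγ : 0 < γ) (hγ' : γ ≤ 1) (hL : 0 < L)
    {E : ℝ → ℝ} (hE : ∀ x ∈ rightRegion f ψ, 0 ≤ E x ∧ E x ≤ -ψ x) :
    ∫⁻ x in rightRegion f ψ, ENNReal.ofReal (E x ^ 2 * f x) ≤
      ENNReal.ofReal (16 * (1 - (2 : ℝ) ^ (-γ))⁻¹ * L ^ 2) := by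
  refine hs.lintegral_rightRegion_le_of_blocks
    (c := fun k => 16 * L ^ 2 * ((1 : ℝ) / 2 ^ k) ^ γ) (fun k => by positivity) (fun k => ?_)
    fun n => ?_
  · set q : ℝ := 1 / 2 ^ k with hq
    have hq0 : 0 < q := by positivity
    refine (hs.lintegral_block_le_of_le_negScore (N := 2 * L * q ^ (-((1 - γ) / 2)))
      (fun x hx => ?_) fun x hx => ?_).trans (ENNReal.ofReal_le_ofReal (le_of_eq ?_))
    · have h1 := hs.negScore_le_rpow ht hγ hγ' hL hx.1
      have h2 : survival f x ^ (-((1 - γ) / 2)) ≤ (q / 2) ^ (-((1 - γ) / 2)) :=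
        Real.rpow_le_rpow_of_nonpos (by positivity) hx.2.2.1.le (by linarith)
      have h3 : (q / 2) ^ (-((1 - γ) / 2)) ≤ 2 * q ^ (-((1 - γ) / 2)) := by
        rw [div_eq_mul_inv, Real.mul_rpow hq0.le (by norm_num), Real.inv_rpow (by norm_num),
          Real.rpow_neg (by norm_num : (0 : ℝ) ≤ 2), inv_inv, mul_comm]
        refine mul_le_mul_of_nonneg_right ?_ (by positivity)
        calc (2 : ℝ) ^ ((1 - γ) / 2) ≤ 2 ^ (1 : ℝ) :=
              Real.rpow_le_rpow_of_exponent_le (by norm_num) (by linarith)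
          _ = 2 := Real.rpow_one _
      calc _ ≤ _ := h1
        _ ≤ 2 * L * (2 * q ^ (-((1 - γ) / 2))) := by gcongr; exact h2.trans h3
        _ = _ := by ring
    · obtain ⟨h1, h2⟩ := hE x ⟨hx.1, hx.2.1⟩
      exact ⟨h1, h2.trans (by rw [negScore_of_pos hx.1]; exact le_max_left _ _)⟩
    · have : q * (2 * L * q ^ (-((1 - γ) / 2))) ^ 2 = 4 * L ^ 2 * q ^ γ := by
        calc _ = 4 * L ^ 2 * (q ^ (1 : ℝ) * q ^ (-((1 - γ) / 2) * 2)) := by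
              rw [Real.rpow_mul hq0.le, Real.rpow_two, Real.rpow_one]; ring
          _ = _ := by rw [← Real.rpow_add hq0]; congr 2; ring
      rw [this]; ring
  · rw [← Finset.mul_sum]
    have := mul_le_mul_of_nonneg_left (sum_half_rpow_le hγ n) (show 0 ≤ 16 * L ^ 2 by positivity)
    linarith

/-- For ε ≤ q the multiscale bound applies with ρ = (ε/q)^(1/3); below that level the trivial bound
by the squared score is as good. -/
lemma lintegral_block_le_of_errorBound (ht : ScoreTail f ψ γ L)
    (hr : ∫⁻ x, ENNReal.ofReal (ψ x ^ 2 * f x) ≤ ENNReal.ofReal r) (hγ : 0 < γ) (hγ' : γ ≤ 1)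
    (hL : 0 < L) (hr0 : 0 < r) {q ε : ℝ} (hq : 0 < q) (hε : 0 < ε) {E : ℝ → ℝ}
    (hE : ∀ x ∈ block f ψ q, 0 ≤ E x ∧ E x ≤ negScore f ψ x ∧
      ∀ h, 0 < h → 8 * (h * f x) ≤ survival f x → E x ≤ errorBound f ψ ε x h) :
    ∫⁻ x in block f ψ q, ENNReal.ofReal (E x ^ 2 * f x) ≤
      ENNReal.ofReal (10 ^ 11 * (min (4 * L ^ 2 * q ^ γ) r * min 1 ((ε / q) ^ (1 / 3 : ℝ)))) := by
  set G := scoreEnvelope γ L r with hG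
  have hGq : 0 < G q := scoreEnvelope_pos hL hr0 hq
  have hle : ∀ x, 0 < f x → negScore f ψ x ≤ G (survival f x) := fun x hx =>
    hs.negScore_le_scoreEnvelope ht hr hγ hγ' hL hr0 hx
  have hG2 : ∀ v, q / 2 < v → G v ≤ 2 * G q := fun v hv =>
    (scoreEnvelope_anti hγ' hL hr0 (by linarith : 0 < q / 4) (by linarith)).trans
      (scoreEnvelope_quarter_le hγ hL hq)
  have hg : ∀ x, q / 2 < survival f x → negScore f ψ x ≤ 2 * G q := by
    intro x hx
    by_cases hfx : 0 < f x
    · exact (hle x hfx).trans (hG2 _ hx)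
    · rw [negScore, if_neg hfx]; positivity
  have hsq := mul_scoreEnvelope_sq_le (γ := γ) hL hr0 hq
  rcases le_or_gt ε q with hεq | hεq
  · set ρ := (ε / q) ^ (1 / 3 : ℝ) with hρ
    have hρ0 : 0 < ρ := by positivity
    have hρ1 : ρ ≤ 1 := Real.rpow_le_one (by positivity) ((div_le_one hq).2 hεq) (by norm_num)
    have hρ3 : ρ ^ 3 * q = ε := by
      rw [hρ, ← Real.rpow_natCast, ← Real.rpow_mul (by positivity)]
      norm_num
      field_simp
    rw [min_eq_right hρ1]
    refine (hs.lintegral_sq_block_le hq hGq hρ0 hρ1 hg (fun x hx => ?_)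
      (hρ3 ▸ hE)).trans (ENNReal.ofReal_le_ofReal ?_)
    · have h1 := hs.density_le (G := G) (fun v hv => scoreEnvelope_quarter_le hγ hL hv) hle hx.1
        hx.2.1.le
      have h2 : survival f x * G (survival f x) ≤ q * (2 * G q) :=
        mul_le_mul hx.2.2.2 (hG2 _ hx.2.2.1)
          (scoreEnvelope_pos hL hr0 (hs.survival_pos hx.1)).le hq.le
      linarith
    · gcongr
  · have : 1 ≤ (ε / q) ^ (1 / 3 : ℝ) :=
      Real.one_le_rpow ((one_le_div hq).2 hεq.le) (by norm_num)
    rw [min_eq_left this, mul_one]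
    refine (hs.lintegral_block_le_of_le_negScore (fun x hx => hg x hx.2.2.1)
      fun x hx => ⟨(hE x hx).1, (hE x hx).2.1⟩).trans (ENNReal.ofReal_le_ofReal ?_)
    have : 0 ≤ q * G q ^ 2 := by positivity
    linarith

end ScorePair

/-- The loss to the right of the mode is at most of the order of the rate. -/
lemma exists_lintegral_rightRegion_le {γ : ℝ} (hγ : 0 < γ) (hγ' : γ ≤ 1) :
    ∃ C : ℝ, 0 < C ∧ ∀ (f ψ : ℝ → ℝ) (L r ε : ℝ) (E : ℝ → ℝ), ScorePair f ψ → 0 < L → 0 < r →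
      0 < ε → ScoreTail f ψ γ L → ∫⁻ x, ENNReal.ofReal (ψ x ^ 2 * f x) ≤ ENNReal.ofReal r →
      (∀ x ∈ rightRegion f ψ, 0 ≤ E x ∧ E x ≤ -ψ x ∧ (2 * ε / 9 ≤ 1 / 100 → ∀ h, 0 < h →
        8 * (h * f x) ≤ survival f x → E x ≤ errorBound f ψ (2 * ε / 9) x h)) →
      ∫⁻ x in rightRegion f ψ, ENNReal.ofReal (E x ^ 2 * f x) ≤
        ENNReal.ofReal (C * (min r (L ^ 2) * min (rate γ L r ε) 1)) := by
  obtain ⟨C₁, hC₁, hsum⟩ := sum_block_bound_le hγ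
  have h2γ : (2 : ℝ) ^ (-γ) < 1 := Real.rpow_lt_one_of_one_lt_of_neg (by norm_num) (by linarith)
  set C₂ := 16 * (1 - (2 : ℝ) ^ (-γ))⁻¹ with hC₂
  have hC₂0 : 16 ≤ C₂ := by
    have : 1 ≤ (1 - (2 : ℝ) ^ (-γ))⁻¹ := by
      rw [one_le_inv₀ (by linarith)]
      have : 0 < (2 : ℝ) ^ (-γ) := by positivity
      linarith
    linarith
  refine ⟨10 ^ 11 * C₁ + 25 * C₂, by positivity, fun f ψ L r ε E hs hL hr hε ht hfi hE => ?_⟩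
  have hb : 0 < min r (L ^ 2) := lt_min hr (by positivity)
  -- The estimator is no worse than zero, whose loss is bounded by the Fisher information and,
  -- through the tail condition, by a multiple of L².
  have hrough : ∫⁻ x in rightRegion f ψ, ENNReal.ofReal (E x ^ 2 * f x) ≤
      ENNReal.ofReal (C₂ * min r (L ^ 2)) := by
    rw [mul_min_of_nonneg _ _ (by linarith), ENNReal.ofReal_min]
    refine le_min ?_ (hs.lintegral_rightRegion_le_sq ht hγ hγ' hL fun x hx =>
      ⟨(hE x hx).1, (hE x hx).2.1⟩)
    calc _ ≤ ∫⁻ x in rightRegion f ψ, ENNReal.ofReal (ψ x ^ 2 * f x) := by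
          refine setLIntegral_mono' hs.measurableSet_rightRegion fun x hx => ?_
          refine ENNReal.ofReal_le_ofReal (mul_le_mul_of_nonneg_right ?_ (hs.nonneg x))
          rw [← neg_sq (ψ x)]
          exact pow_le_pow_left₀ (hE x hx).1 (hE x hx).2.1 2
      _ ≤ _ := (setLIntegral_le_lintegral _ _).trans hfi
      _ ≤ _ := ENNReal.ofReal_le_ofReal (by nlinarith)
  have hscale : 1 ≤ L ^ (2 / γ) / min r (L ^ 2) ^ (1 / γ) := by
    rw [one_le_div (by positivity)]
    calc min r (L ^ 2) ^ (1 / γ) ≤ (L ^ 2) ^ (1 / γ) :=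
          Real.rpow_le_rpow hb.le (min_le_right _ _) (by positivity)
      _ = L ^ (2 / γ) := by
          rw [← Real.rpow_two, ← Real.rpow_mul hL.le]; congr 1; ring
  have hrate0 : 0 < rate γ L r ε := by
    unfold rate
    have : 0 < logPlus (1 / ε) := one_pos.trans_le (le_max_left _ _)
    positivity
  rcases le_or_gt (rate γ L r ε) 1 with hr1 | hr1
  swap
  · refine hrough.trans (ENNReal.ofReal_le_ofReal ?_)
    rw [min_eq_right hr1.le, mul_one]
    exact mul_le_mul_of_nonneg_right (by linarith) hb.le
  rw [min_eq_left hr1]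
  -- For larger ε the rate is at least 1/25, since ε > 9/200, the scale factor is at least one and
  -- the exponent at most one; the rough bound then suffices.
  rcases le_or_gt (2 * ε / 9) (1 / 100) with hε1 | hε1
  swap
  · refine hrough.trans (ENNReal.ofReal_le_ofReal ?_)
    have h1 : 1 / 25 ≤ rate γ L r ε := by
      have hℓ : 1 ≤ logPlus (1 / ε) ^ (if γ = 1 / 3 then 1 else 0 : ℕ) :=
        one_le_pow₀ (le_max_left _ _)
      have h2 : (1 : ℝ) / 25 ≤ (L ^ (2 / γ) / min r (L ^ 2) ^ (1 / γ) * ε) ^ min γ (1 / 3) := by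
        calc (1 : ℝ) / 25 = (1 / 25) ^ (1 : ℝ) := (Real.rpow_one _).symm
          _ ≤ (1 / 25) ^ min γ (1 / 3) :=
            Real.rpow_le_rpow_of_exponent_ge (by norm_num) (by norm_num)
              ((min_le_left _ _).trans hγ')
          _ ≤ _ := by
            refine Real.rpow_le_rpow (by norm_num) ?_ (by positivity)
            nlinarith
      unfold rate
      nlinarith
    have h3 : C₂ * min r (L ^ 2) * (1 / 25) ≤ C₂ * min r (L ^ 2) * rate γ L r ε :=
      mul_le_mul_of_nonneg_left h1 (by positivity)
    have h4 : 0 ≤ 10 ^ 11 * C₁ * (min r (L ^ 2) * rate γ L r ε) := by positivity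
    linarith
  have hmain := hs.lintegral_rightRegion_le_of_blocks (F := fun x => ENNReal.ofReal (E x ^ 2 * f x))
    (c := fun k => 10 ^ 11 * (min (4 * L ^ 2 * (1 / 2 ^ k) ^ γ) r *
      min 1 ((ε * 2 ^ k) ^ (1 / 3 : ℝ)))) (C := 10 ^ 11 * (C₁ * (min r (L ^ 2) * rate γ L r ε)))
    (fun k => by positivity) (fun k => ?_) fun n => ?_
  · refine hmain.trans (ENNReal.ofReal_le_ofReal ?_)
    have h4 : 0 ≤ 25 * C₂ * (min r (L ^ 2) * rate γ L r ε) := by positivity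
    linarith
  · refine (hs.lintegral_block_le_of_errorBound (ε := 2 * ε / 9) ht hfi hγ hγ' hL hr
      (by positivity) (by positivity) fun x hx => ?_).trans (ENNReal.ofReal_le_ofReal ?_)
    · obtain ⟨h1, h2, h3⟩ := hE x ⟨hx.1, hx.2.1⟩
      exact ⟨h1, h2.trans (by rw [negScore_of_pos hx.1]; exact le_max_left _ _), h3 hε1⟩
    · gcongr
      have : (0 : ℝ) < 2 ^ k := by positivity
      rw [div_div_eq_mul_div, div_one]
      exact mul_le_mul_of_nonneg_right (by linarith) this.le
  · rw [← Finset.mul_sum]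
    exact mul_le_mul_of_nonneg_left (hsum L r ε hL hr hε n) (by norm_num)

end

section

/-! ### The loss of the multiscale estimator -/

namespace ScorePair

variable {f ψ : ℝ → ℝ} (hs : ScorePair f ψ)
include hs

lemma cdf_eq_one_sub_survival (x : ℝ) : cdf (law f) x = 1 - survival f x := by
  have := hs.isProbabilityMeasure
  rw [cdf_eq_real, survival, ← Set.compl_Ioi, probReal_compl_eq_one_sub measurableSet_Ioi]

lemma survival_reflect (x : ℝ) : survival (fun y => f (-y)) x = 1 - survival f (-x) := by
  have := hs.isProbabilityMeasure
  rw [survival, hs.reflect.law_real_eq measurableSet_Ioi, integral_comp_neg_Ioi,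
    ← hs.law_real_eq measurableSet_Iic, ← hs.cdf_eq_one_sub_survival, cdf_eq_real]

lemma survival_lt_of_lt {x y : ℝ} (hx : 0 < f x) (hyx : y < x) : survival f x < survival f y := by
  have hopen : IsOpen {y | 0 < f y} := isOpen_lt continuous_const hs.continuous
  obtain ⟨r, hr, hball⟩ := Metric.isOpen_iff.1 hopen x hx
  have hz : max y (x - r / 2) < x := max_lt hyx (by linarith)
  have h1 : 0 < ∫ t in (max y (x - r / 2))..x, f t := by
    refine intervalIntegral.intervalIntegral_pos_of_pos_on
      (hs.continuous.intervalIntegrable _ _) (fun t ht => hball ?_) hz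
    rw [Metric.mem_ball, Real.dist_eq, abs_lt]
    have := (le_max_right y (x - r / 2)).trans_lt ht.1
    constructor <;> linarith [ht.2]
  rw [← hs.survival_sub hz.le] at h1
  linarith [hs.survival_antitone (le_max_left y (x - r / 2))]

lemma quantileFn_eq {x : ℝ} (hx : 0 < f x) : quantileFn f (1 - survival f x) = x := by
  have : {y : ℝ | 1 - survival f x ≤ cdf (law f) y} = Set.Ici x := by
    ext y
    rw [Set.mem_ofPred_eq, hs.cdf_eq_one_sub_survival, Set.mem_Ici]
    constructor
    · intro h
      by_contra! hy
      linarith [hs.survival_lt_of_lt hx hy]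
    · intro h
      linarith [hs.survival_antitone h]
  rw [quantileFn, this, csInf_Ici]

/-- The score of the reflected density is the reflected score with the opposite sign, so integrals
split at the mode into two of the same kind. -/
lemma lintegral_le_add_reflect {F : ℝ → ℝ≥0∞} (hF : ∀ x, F x ≠ 0 → 0 < f x ∧ ψ x ≠ 0) :
    ∫⁻ x, F x ≤ (∫⁻ x in rightRegion f ψ, F x) +
      ∫⁻ x in rightRegion (fun y => f (-y)) (fun y => -ψ (-y)), F (-x) := by
  rw [← lintegral_add_compl F hs.measurableSet_rightRegion]
  refine add_le_add le_rfl ?_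
  set R := rightRegion (fun y => f (-y)) (fun y => -ψ (-y)) with hR
  rw [← lintegral_indicator hs.measurableSet_rightRegion.compl,
    ← lintegral_indicator hs.reflect.measurableSet_rightRegion,
    ← lintegral_neg_eq_self (R.indicator fun x => F (-x))]
  refine lintegral_mono fun x => ?_
  by_cases hx : F x = 0
  · refine (Set.indicator_apply_le' (fun _ => ?_) fun _ => ?_)
    · rw [hx]; exact zero_le
    · exact zero_le
  obtain ⟨h1, h2⟩ := hF x hx
  rcases h2.lt_or_gt with h | h
  · rw [Set.indicator_of_notMem]
    · exact zero_le
    · exact fun hc => hc ⟨h1, h⟩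
  · have hmem : -x ∈ R := by
      rw [hR, rightRegion, Set.mem_ofPred_eq]
      simp only [neg_neg]
      exact ⟨h1, by linarith⟩
    rw [Set.indicator_of_mem hmem, neg_neg]
    exact Set.indicator_apply_le' (fun _ => le_rfl) fun _ => zero_le

end ScorePair

lemma scoreTail_reflect {f ψ : ℝ → ℝ} {γ L : ℝ} (hs : ScorePair f ψ) (ht : ScoreTail f ψ γ L) :
    ScoreTail (fun x => f (-x)) (fun x => -ψ (-x)) γ L := by
  intro x hx
  rw [hs.survival_reflect, sub_sub_cancel, abs_neg, min_comm]
  exact ht (-x) hx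

lemma scoreTail_of_mem {f : ℝ → ℝ} {γ L : ℝ} (hf : f ∈ tailGrowthClass γ L) :
    ScoreTail f (score f) γ L := by
  have hs := hf.1.scorePair
  intro x hx
  have h1 : survival f x < 1 :=
    (hs.survival_lt_of_lt hx (sub_one_lt x)).trans_le (hs.survival_le_one _)
  have h2 := hf.2 (1 - survival f x) ⟨by linarith, by linarith [hs.survival_pos hx]⟩
  rwa [densityQuantileDeriv, hs.quantileFn_eq hx, sub_sub_cancel] at h2

lemma lintegral_score_reflect {f ψ : ℝ → ℝ} :
    ∫⁻ x, ENNReal.ofReal ((-ψ (-x)) ^ 2 * f (-x)) = ∫⁻ x, ENNReal.ofReal (ψ x ^ 2 * f x) := by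
  simp_rw [neg_sq]
  exact lintegral_neg_eq_self fun x => ENNReal.ofReal (ψ x ^ 2 * f x)

/-- The tail-growth condition bounds the Fisher information. -/
lemma exists_mem_tailGrowthFisherClass {γ : ℝ} (hγ : 0 < γ) (hγ' : γ ≤ 1) :
    ∃ K : ℝ, 1 ≤ K ∧ ∀ L, 0 < L → ∀ f ∈ tailGrowthClass γ L,
      f ∈ tailGrowthFisherClass γ L (K * L ^ 2) := by
  have h2γ : (2 : ℝ) ^ (-γ) < 1 := Real.rpow_lt_one_of_one_lt_of_neg (by norm_num) (by linarith)
  set K := 16 * (1 - (2 : ℝ) ^ (-γ))⁻¹ with hK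
  have hK1 : 1 ≤ K := by
    have : 1 ≤ (1 - (2 : ℝ) ^ (-γ))⁻¹ := by
      rw [one_le_inv₀ (by linarith)]
      have : 0 < (2 : ℝ) ^ (-γ) := by positivity
      linarith
    linarith
  refine ⟨2 * K, by linarith, fun L hL f hf => ⟨hf, ?_⟩⟩
  have hs := hf.1.scorePair
  have ht := scoreTail_of_mem hf
  refine (hs.lintegral_le_add_reflect fun x hx => ?_).trans ?_
  · have hx' : 0 < score f x ^ 2 * f x := by
      by_contra! h
      exact hx (ENNReal.ofReal_of_nonpos h)
    constructor
    · refine (hs.nonneg x).lt_of_ne fun h => ?_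
      rw [← h] at hx'; simp at hx'
    · intro h
      rw [h] at hx'; simp at hx'
  -- Taking as error the score itself, the rough loss bound becomes a bound for the Fisher
  -- information.
  · have h1 := hs.lintegral_rightRegion_le_sq ht hγ hγ' hL (E := fun x => -score f x)
      fun x hx => ⟨by have := hx.2; linarith, le_rfl⟩
    have h2 := hs.reflect.lintegral_rightRegion_le_sq (scoreTail_reflect hs ht) hγ hγ' hL
      (E := fun x => score f (-x)) fun x hx => ⟨by have := hx.2; linarith, by rw [neg_neg]⟩
    simp_rw [neg_sq] at h1
    refine (add_le_add h1 h2).trans (le_of_eq ?_)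
    rw [← ENNReal.ofReal_add (by positivity) (by positivity)]
    congr 1; ring

lemma abs_coe_sub_coe_sq_mul (a b : ℝ) {c : ℝ} :
    ((a : EReal) - (b : EReal)).abs ^ 2 * ENNReal.ofReal c = ENNReal.ofReal ((a - b) ^ 2 * c) := by
  rw [← EReal.coe_sub, EReal.abs_def, ← ENNReal.ofReal_pow (abs_nonneg _), sq_abs,
    ← ENNReal.ofReal_mul (sq_nonneg _)]

variable {n : ℕ} {δ : ℝ} {X : Fin n → ℝ}

/-- On good samples, every version of the multiscale estimator attains the rate. -/
lemma exists_loss_le {γ : ℝ} (hγ : 0 < γ) (hγ' : γ ≤ 1) :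
    ∃ C : ℝ, 0 < C ∧ ∀ (n : ℕ) (δ L r : ℝ) (f : ℝ → ℝ) (X : Fin n → ℝ) (φ : ℝ → EReal), 3 ≤ n →
      0 < δ → δ < 1 → 0 < L → 0 < r → f ∈ tailGrowthFisherClass γ L r → GoodAt (law f) δ X →
      (∀ x, 0 < f x → φ x = ((multiscaleEstimator n δ x X).toReal : EReal)) →
      loss f φ ≤ ENNReal.ofReal (C * (min r (L ^ 2) * min (rate γ L r (epsRate n δ)) 1)) := by
  obtain ⟨C, hC, hbound⟩ := exists_lintegral_rightRegion_le hγ hγ'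
  refine ⟨2 * C, by positivity, fun n δ L r f X φ hn hδ hδ1 hL hr hf hg hφ => ?_⟩
  have hs := hf.1.1.scorePair
  have ht := scoreTail_of_mem hf.1
  have hε : 0 < epsRate n δ := by
    have := epsBand_pos hn hδ hδ1
    unfold epsBand at this
    linarith
  set e : ℝ → ℝ := fun x => (multiscaleEstimator n δ x X).toReal with he
  have hloss : loss f φ = ∫⁻ x, ENNReal.ofReal ((e x - score f x) ^ 2 * f x) := by
    refine lintegral_congr fun x => ?_
    rcases (hs.nonneg x).eq_or_lt with h | h
    · rw [← h]; simp
    · rw [hφ x h, abs_coe_sub_coe_sq_mul]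
  rw [hloss]
  refine (hs.lintegral_le_add_reflect fun x hx => ?_).trans ?_
  · have hx' : 0 < (e x - score f x) ^ 2 * f x := by
      by_contra! h
      exact hx (ENNReal.ofReal_of_nonpos h)
    have hfx : 0 < f x := by
      refine (hs.nonneg x).lt_of_ne fun h => ?_
      rw [← h] at hx'; simp at hx'
    refine ⟨hfx, fun h => ?_⟩
    simp only [he] at hx'
    rw [hg.estimator_of_eq_zero hs hn hδ hδ1 hfx h, h] at hx'
    simp at hx'
  · have h1 := hbound f (score f) L r (epsRate n δ) (fun x => e x - score f x) hs hL hr hε ht hf.2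
      fun x hx => by
        obtain ⟨a, ha, h1, h2, h3⟩ := hg.estimator_of_neg hs hn hδ hδ1 hx.1 hx.2
        have hea : e x = a := by simp only [he]; rw [ha, EReal.toReal_coe]
        rw [hea]
        exact ⟨by linarith, by linarith, h3⟩
    have h2 := hbound _ _ L r (epsRate n δ) (fun x => score f (-x) - e (-x)) hs.reflect hL hr hε
      (scoreTail_reflect hs ht) (lintegral_score_reflect.trans_le hf.2)
      fun x hx => by
        obtain ⟨a, ha, h1, h2, h3⟩ := hg.estimator_of_pos hs hn hδ hδ1 (x := -x) hx.1
          (by have := hx.2; linarith)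
        have hea : e (-x) = a := by simp only [he]; rw [ha, EReal.toReal_coe]
        rw [hea]
        rw [neg_neg x] at h3
        exact ⟨by linarith, by linarith, h3⟩
    have h3 : ∀ x, (score f (-x) - e (-x)) ^ 2 = (e (-x) - score f (-x)) ^ 2 := fun x => by ring
    simp_rw [h3] at h2
    refine (add_le_add h1 h2).trans (le_of_eq ?_)
    have hrate : 0 ≤ rate γ L r (epsRate n δ) := by
      unfold rate
      have : 0 < logPlus (1 / epsRate n δ) := one_pos.trans_le (le_max_left _ _)
      have : 0 < min r (L ^ 2) := lt_min hr (by positivity)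
      positivity
    have : 0 ≤ min r (L ^ 2) := le_min hr.le (by positivity)
    rw [← ENNReal.ofReal_add (by positivity) (by positivity)]
    congr 1; ring

/-- Covering the sample space by the loss event and the bad samples uses only subadditivity, so
neither set has to be measurable. -/
lemma lossQuantile_le {f : ℝ → ℝ} (hP : IsProbabilityMeasure (law f)) (hn : 0 < n) (hδ : 0 < δ)
    {ψhat : ℝ → (Fin n → ℝ) → EReal} {B : ℝ}
    (hB : ∀ X, GoodAt (law f) δ X → loss f (fun x => ψhat x X) ≤ ENNReal.ofReal B) :
    lossQuantile n δ f ψhat ≤ ENNReal.ofReal B := by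
  refine iInf₂_le (Real.toNNReal B) ?_
  have h1 := measure_not_goodSample_le (n := n) (law f) (9 / 2 * n * epsBand n δ)
  have h2 : (n : ℝ) ^ 2 * Real.exp (-(9 / 2 * n * epsBand n δ)) = δ := by
    have hn0 : (0 : ℝ) < n := by exact_mod_cast hn
    rw [n_mul_epsBand hn, Real.exp_neg, Real.exp_log (by positivity)]
    field_simp
  rw [h2] at h1
  rw [ENNReal.ofReal_sub _ hδ.le, ENNReal.ofReal_one, tsub_le_iff_right]
  calc (1 : ℝ≥0∞) = Measure.pi (fun _ : Fin n => law f) Set.univ := measure_univ.symm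
    _ ≤ Measure.pi (fun _ : Fin n => law f)
        ({X | loss f (fun x => ψhat x X) ≤ (Real.toNNReal B : ℝ≥0∞)} ∪
          {X | ¬ GoodSample (law f) (9 / 2 * n * epsBand n δ) X}) := by
        refine measure_mono fun X _ => ?_
        by_cases hX : GoodSample (law f) (9 / 2 * n * epsBand n δ) X
        · exact Or.inl (hB X hX)
        · exact Or.inr hX
    _ ≤ _ := (measure_union_le _ _).trans (add_le_add le_rfl h1)

end

end ScoreEstimation

end

open ScoreEstimation in
theorem theorem2 (γ : ℝ) (hγ : 0 < γ) (hγ' : γ ≤ 1) :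
    ∃ C : ℝ, 0 < C ∧ ∀ (n : ℕ) (δ L r : ℝ), 3 ≤ n → 0 < δ → δ < 1 → 0 < L → 0 < r →
      let ε : ℝ := epsRate n δ
      let ℓ : ℝ := logPlus (1 / ε) ^ (if γ = 1 / 3 then 1 else 0 : ℕ)
      let rbar : ℝ := min r (L ^ 2)
      let boundFull : ℝ≥0∞ := ENNReal.ofReal (C * (rbar *
        min ((L ^ (2 / γ) / rbar ^ (1 / γ) * ε) ^ min γ (1 / 3) * ℓ) 1))
      let boundSimple : ℝ≥0∞ := ENNReal.ofReal (C * (L ^ 2 * min (ε ^ min γ (1 / 3) * ℓ) 1))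
      -- the minimax quantile bounds
      minimaxQuantile n δ (tailGrowthFisherClass γ L r) ≤ boundFull ∧
      minimaxQuantile n δ (tailGrowthClass γ L) ≤ boundSimple ∧
      -- they are attained by the multiscale estimator
      Measurable (Function.uncurry (multiscaleEstimator n δ)) ∧
      worstQuantile n δ (tailGrowthFisherClass γ L r) (multiscaleEstimator n δ) ≤ boundFull ∧
      worstQuantile n δ (tailGrowthClass γ L) (multiscaleEstimator n δ) ≤ boundSimple := by
  obtain ⟨C, hC, hloss⟩ := exists_loss_le hγ hγ'
  obtain ⟨K, hK, hmem⟩ := exists_mem_tailGrowthFisherClass hγ hγ'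
  refine ⟨C, hC, fun n δ L r hn hδ hδ1 hL hr => ?_⟩
  intro ε ℓ rbar boundFull boundSimple
  have hmeas := measurable_multiscaleEstimator hn hδ hδ1
  have hfull : ∀ s, 0 < s → ∀ f ∈ tailGrowthFisherClass γ L s,
      ∀ ψhat : ℝ → (Fin n → ℝ) → EReal,
      (∀ X, GoodAt (law f) δ X → ∀ x, 0 < f x →
        ψhat x X = ((multiscaleEstimator n δ x X).toReal : EReal)) →
      lossQuantile n δ f ψhat ≤ ENNReal.ofReal (C * (min s (L ^ 2) * min (rate γ L s ε) 1)) :=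
    fun s hs f hf ψhat hψ => lossQuantile_le hf.1.1.scorePair.isProbabilityMeasure (by omega) hδ
      fun X hX => hloss n δ L s f X _ hn hδ hδ1 hL hs hf hX (hψ X hX)
  -- At r = K L² with K ≥ 1 the minimum is L² and the scale factor in the rate is one.
  have hsimple : ENNReal.ofReal (C * (min (K * L ^ 2) (L ^ 2) * min (rate γ L (K * L ^ 2) ε) 1)) =
      boundSimple := by
    have h1 : min (K * L ^ 2) (L ^ 2) = L ^ 2 := min_eq_right (by nlinarith [sq_nonneg L])
    have h2 : (L ^ 2) ^ (1 / γ) = L ^ (2 / γ) := by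
      rw [← Real.rpow_two, ← Real.rpow_mul hL.le]; congr 1; ring
    have h3 : 0 < L ^ (2 / γ) := by positivity
    simp only [boundSimple, ℓ, rate]
    rw [h1, h2, div_self h3.ne', one_mul]
  -- On good samples the estimator is finite where f > 0, so it may be replaced there by the
  -- real-valued version that competes in the minimax infimum.
  have hreal : ∀ f ∈ tailGrowthClass γ L, ∀ X, GoodAt (law f) δ X → ∀ x, 0 < f x →
      multiscaleEstimator n δ x X = ((multiscaleEstimator n δ x X).toReal : EReal) := by
    intro f hf X hX x hx
    have hs := hf.1.scorePair
    rcases lt_trichotomy (score f x) 0 with h | h | h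
    · obtain ⟨a, ha, -⟩ := hX.estimator_of_neg hs hn hδ hδ1 hx h
      rw [ha, EReal.toReal_coe]
    · rw [hX.estimator_of_eq_zero hs hn hδ hδ1 hx h, EReal.toReal_zero, EReal.coe_zero]
    · obtain ⟨a, ha, -⟩ := hX.estimator_of_pos hs hn hδ hδ1 hx h
      rw [ha, EReal.toReal_coe]
  have hKL : 0 < K * L ^ 2 := by positivity
  refine ⟨?_, ?_, hmeas, ?_, ?_⟩
  · exact (iInf₂_le (fun x X => (multiscaleEstimator n δ x X).toReal) hmeas.ereal_toReal).trans
      (iSup₂_le fun f hf => hfull r hr f hf _ fun _ _ _ _ => rfl)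
  · rw [← hsimple]
    exact (iInf₂_le (fun x X => (multiscaleEstimator n δ x X).toReal) hmeas.ereal_toReal).trans
      (iSup₂_le fun f hf => hfull _ hKL f (hmem L hL f hf) _ fun _ _ _ _ => rfl)
  · exact iSup₂_le fun f hf => hfull r hr f hf _ (hreal f hf.1)
  · rw [← hsimple]
    exact iSup₂_le fun f hf => hfull _ hKL f (hmem L hL f hf) _ (hreal f hf)
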